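/- \textbf{Setting.} For $i=1,\dots,m$ let $f_i(\mathbf x,\mathbf y_i)=\mathbb E_{\xi\sim\mathcal P_i}[f_i(\mathbf x,\mathbf y_i;\xi)]$ and $g_i(\mathbf x,\mathbf y_i)=\mathbb E_{\zeta\sim\mathcal Q_i}[g_i(\mathbf x,\mathbf y_i;\zeta)]$ with $\mathbf x\in\mathbb R^{d_x}$, $\mathbf y_i\in\mathbb R^{d_{y,i}}$, $d_{y,i}\le D$, $\mathbf y_i(\mathbf x)=\arg\min_{\mathbf y_i}g_i(\mathbf x,\mathbf y_i)$ and $F(\mathbf x)=\frac1m\sum_{i=1}^m f_i(\mathbf x,\mathbf y_i(\mathbf x))$. Norms of vectors are $\ell_2$ norms and norms of matrices are spectral norms. \textbf{Assumptions.} (1) For all $\mathbf x$ and $i$, $g_i(\mathbf x,\cdot)$ is $L_g$-smooth and $\lambda$-strongly convex, $\lambda>0$. (2) The stochastic derivatives $\nabla_xf_i(\mathbf x,\mathbf y_i;\xi)$, $\nabla_yf_i(\mathbf x,\mathbf y_i;\xi)$, $\nabla_yg_i(\mathbf x,\mathbf y_i;\zeta)$, $\nabla^2_{xy}g_i(\mathbf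 x,\mathbf y_i;\zeta)$, $\nabla^2_{yy}g_i(\mathbf x,\mathbf y_i;\zeta)$ exist, are Lipschitz in $(\mathbf x,\mathbf y_i)$ with constants $L_{fx},L_{fy},L_{gy},L_{gxy},L_{gyy}$, and have variance at most $\sigma^2$ around the corresponding derivatives of $f_i,g_i$; moreover $\|\nabla_xf_i\|\le C_{fx}$ and $\|\nabla_yf_i\|\le C_{fy}$. \textbf{Algorithm ($\mathrm{BSVRB}^{\mathrm{v1}}$).} Write $h(\cdot;\mathcal B)$ for the average of $h(\cdot;\xi)$ over a mini-batch $\mathcal B$, $\mathbf S_\lambda$ for the Euclidean (Frobenius) projection onto $\{X=X^\top: X\succeq\lambda I\}$, and $$\Psi_i(\mathbf x,\mathbf y,H;\mathcal B,\widetilde{\mathcal B})=\nabla_xf_i(\mathbf x,\mathbf y;\mathcal B)-\nabla^2_{xy}g_i(\mathbf x,\mathbf y;\widetilde{\mathcal B})H^{-1}\nabla_yf_i(\mathbf x,\mathbf y;\mathcal B).$$ Start at $\mathbf x_0=\mathbf x_1$ and $\mathbf y_0=\mathbf y_1$ ($\mathbf y_1$ possibly random), and with independent mini-batches $\mathcal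 B_i^0\sim\mathcal P_i,\widetilde{\mathcal B}_i^0\sim\mathcal Q_i$ of size $B_0$ for all blocks put $\mathbf s_{i,1}=\nabla_yg_i(\mathbf x_1,\mathbf y_{i,1};\widetilde{\mathcal B}_i^0)$, $H_{i,0}=H_{i,1}=\mathbf S_\lambda[\nabla^2_{yy}g_i(\mathbf x_1,\mathbf y_{i,1};\widetilde{\mathcal B}_i^0)]$, $\mathbf z_1=\frac1m\sum_{i=1}^m\Psi_i(\mathbf x_1,\mathbf y_{i,1},H_{i,1};\mathcal B_i^0,\widetilde{\mathcal B}_i^0)$. For $t\ge1$ draw a uniformly random set $\mathcal I_t\subset\{1,\dots,m\}$ with $|\mathcal I_t|=I$ and mini-batches $\mathcal B_i^t\sim\mathcal P_i,\widetilde{\mathcal B}_i^t\sim\mathcal Q_i$ of size $B$, all samples and $\mathbf y_1$ being mutually independent. For $i\in\mathcal I_t$ set $$\mathbf s_{i,t+1}=(1-\alpha)\mathbf s_{i,t}+\alpha\nabla_yg_i(\mathbf x_t,\mathbf y_{i,t};\widetilde{\mathcal B}_i^t)+\gamma\big(\nabla_yg_i(\mathbf x_t,\mathbf y_{i,t};\widetilde{\mathcal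 B}_i^t)-\nabla_yg_i(\mathbf x_{t-1},\mathbf y_{i,t-1};\widetilde{\mathcal B}_i^t)\big),$$ $$H_{i,t+1}=\mathbf S_\lambda\big[(1-\bar\alpha)H_{i,t}+\bar\alpha\nabla^2_{yy}g_i(\mathbf x_t,\mathbf y_{i,t};\widetilde{\mathcal B}_i^t)+\bar\gamma\big(\nabla^2_{yy}g_i(\mathbf x_t,\mathbf y_{i,t};\widetilde{\mathcal B}_i^t)-\nabla^2_{yy}g_i(\mathbf x_{t-1},\mathbf y_{i,t-1};\widetilde{\mathcal B}_i^t)\big)\big],$$ with $\gamma=\frac{m-I}{I(1-\alpha)}+(1-\alpha)$, $\bar\gamma=\frac{m-I}{I(1-\bar\alpha)}+(1-\bar\alpha)$, and keep $\mathbf s_{i,t+1}=\mathbf s_{i,t}$, $H_{i,t+1}=H_{i,t}$ for $i\notin\mathcal I_t$. With $G_t=\frac1I\sum_{i\in\mathcal I_t}\Psi_i(\mathbf x_t,\mathbf y_{i,t},H_{i,t};\mathcal B_i^t,\widetilde{\mathcal B}_i^t)$ and $\widetilde G_t=\frac1I\sum_{i\in\mathcal I_t}\Psi_i(\mathbf x_{t-1},\mathbf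 y_{i,t-1},H_{i,t-1};\mathcal B_i^t,\widetilde{\mathcal B}_i^t)$ set $$\mathbf z_{t+1}=(1-\beta)(\mathbf z_t-\widetilde G_t)+G_t,\qquad \mathbf y_{t+1}=\mathbf y_t-\tau\tau_t\mathbf s_t,\qquad \mathbf x_{t+1}=\mathbf x_t-\eta\,\mathbf z_{t+1},$$ where $\alpha,\bar\alpha,\beta,\tau_t,\eta$ do not depend on $t$. \textbf{Theorem.} Let the constants of the assumptions, $D$, $\Delta,R\ge0$, $\kappa>0$, $\theta\in(0,1]$ and $0<\tau\le\frac{2}{3L_g}$ be given. There are constants $C_8,C_{10},C_{11},L_F,C_T>0$ depending only on these (in particular not on $m,I,B,\epsilon$ or $d_x$) such that for every problem as above $F$ is $L_F$-smooth and the following holds for all $1\le I\le m$, $B\ge1$, $\epsilon>0$. Put $\rho=\frac{\mathbb I(I<m)}{I}+\frac1B$ and assume $$\alpha\le\min\Big\{\tfrac12,\tfrac{B\epsilon^2}{12C_{10}}\Big\},\quad \bar\alpha\le\min\Big\{\tfrac12,\tfrac{\epsilon^2}{12C_{10}}\rho^{-1}\Big\},\quad \beta\le\min\Big\{1,\tfrac{\epsilon^2}{12C_{10}}\rho^{-1}\Big\},$$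 $$\tau_t\le\sqrt{\tfrac{C_8}{12C_{10}}}\,\tfrac{I\epsilon}{m}\rho^{-1/2},\quad \eta\le\min\Big\{\tfrac1{2L_F},\sqrt{C_{11}}\,\tfrac{I\epsilon}{m}\rho^{-1/2}\Big\},$$ where each step size is also at least $\theta$ times the $\epsilon$-dependent bound in its line (so it is of exactly that order; such step sizes exist when $B\epsilon^2$ is below a constant). Assume $F(\mathbf x_1)-\inf F\le\Delta$, $\frac1m\,\mathbb E\sum_{i=1}^m\|\mathbf y_{i,1}-\mathbf y_i(\mathbf x_1)\|^2\le R$, and that the initial mini-batch size satisfies $B_0\ge\kappa/\epsilon$. Then for every $$T\ \ge\ C_T\left(\frac{m\,\epsilon^{-3}\,\mathbb I(I<m)}{I\sqrt I}+\frac{m\,\epsilon^{-3}}{I\sqrt B}\right)$$ one has $\mathbb E\big[\frac1T\sum_{t=1}^T\|\nabla F(\mathbf x_t)\|^2\big]\le\epsilon^2$. In particular $T=\mathcal O\big(\frac{m\epsilon^{-3}\mathbb I(I<m)}{I\sqrt I}+\frac{m\epsilon^{-3}}{I\sqrt B}\big)$ iterations suffice. -/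

import Mathlib

open MeasureTheory ProbabilityTheory

namespace MBBO

noncomputable section

/-- Euclidean space `ℝⁿ` with the `ℓ²` norm. Continuous linear maps between such spaces carry
the operator norm, i.e. the spectral norm of the corresponding matrix. -/
abbrev Vec (n : ℕ) := EuclideanSpace ℝ (Fin n)

/-! ### Partial derivatives of a function of two vector variables -/

section Derivatives

variable {p q : ℕ}

/-- `∇ₓ h(x, y)`. -/
def gradX (h : Vec p → Vec q → ℝ) (x : Vec p) (y : Vec q) : Vec p :=
  gradient (fun x' => h x' y) x

/-- `∇_y h(x, y)`. -/
def gradY (h : Vec p → Vec q → ℝ) (x : Vec p) (y : Vec q) : Vec q :=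
  gradient (fun y' => h x y') y

/-- `∇²_{xy} h(x, y)`, the `p × q` matrix of mixed second derivatives: it is the transpose of the
derivative of `x ↦ ∇_y h(x, y)`. -/
def jacXY (h : Vec p → Vec q → ℝ) (x : Vec p) (y : Vec q) : Vec q →L[ℝ] Vec p :=
  ContinuousLinearMap.adjoint (fderiv ℝ (fun x' => gradY h x' y) x)

/-- `∇²_{yy} h(x, y)`, the Hessian in `y`. -/
def hessYY (h : Vec p → Vec q → ℝ) (x : Vec p) (y : Vec q) : Vec q →L[ℝ] Vec q :=
  fderiv ℝ (fun y' => gradY h x y') y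

/-- `h` is `L`-Lipschitz with respect to the pair `(x, y)` (Euclidean norm of the pair). -/
def LipschitzXY {V : Type*} [NormedAddCommGroup V] (L : ℝ) (h : Vec p → Vec q → V) : Prop :=
  ∀ x y x' y', ‖h x y - h x' y'‖ ≤ L * √(‖x - x'‖ ^ 2 + ‖y - y'‖ ^ 2)

end Derivatives

/-! ### Projection onto `{X : X ⪰ λ I}` -/

section Projection

variable {n : ℕ}

/-- The symmetric matrices `X` with `X ⪰ lam · I`. -/
def geSet (lam : ℝ) : Set (Vec n →L[ℝ] Vec n) :=
  {X | IsSelfAdjoint X ∧ ∀ v, lam * ‖v‖ ^ 2 ≤ inner ℝ (X v) v}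

/-- Squared Frobenius norm (sum of the squared norms of the columns). -/
def frobSq (X : Vec n →L[ℝ] Vec n) : ℝ := ∑ k, ‖X (EuclideanSpace.single k 1)‖ ^ 2

/-- `P` is a closest point to `X`, in the Frobenius norm, of `{X : X ⪰ lam · I}`. -/
def IsProj (lam : ℝ) (X P : Vec n →L[ℝ] Vec n) : Prop :=
  P ∈ geSet lam ∧ ∀ Q ∈ geSet lam, frobSq (X - P) ≤ frobSq (X - Q)

/-- The Euclidean projection `S_lam[X]` onto the nonempty closed convex set `{X : X ⪰ lam · I}`
(the closest point exists and is unique). For symmetric `X` it replaces every eigenvalue `μ`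
of `X` by `max μ lam`. -/
def proj (lam : ℝ) (X : Vec n →L[ℝ] Vec n) : Vec n →L[ℝ] Vec n :=
  Classical.epsilon (IsProj lam X)

end Projection

/-! ### The multi-block bilevel problem -/

/-- The data of a problem with `m` blocks: the stochastic upper-level functions `f i x y ξ` with
`ξ ∼ P i`, and the stochastic lower-level functions `g i x y ζ` with `ζ ∼ Q i`. -/
structure Problem (m dx : ℕ) (dy : Fin m → ℕ) (Ξ Z : Fin m → Type*)
    [∀ i, MeasurableSpace (Ξ i)] [∀ i, MeasurableSpace (Z i)] where
  f : (i : Fin m) → Vec dx → Vec (dy i) → Ξ i → ℝ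
  g : (i : Fin m) → Vec dx → Vec (dy i) → Z i → ℝ
  P : (i : Fin m) → Measure (Ξ i)
  Q : (i : Fin m) → Measure (Z i)

/-- The constants of the assumptions. -/
structure Consts where
  (Lg lam Lfx Lfy Lgy Lgxy Lgyy Cfx Cfy σ : ℝ)
  Lg_pos : 0 < Lg
  lam_pos : 0 < lam
  Lfx_nonneg : 0 ≤ Lfx
  Lfy_nonneg : 0 ≤ Lfy
  Lgy_nonneg : 0 ≤ Lgy
  Lgxy_nonneg : 0 ≤ Lgxy
  Lgyy_nonneg : 0 ≤ Lgyy
  Cfx_nonneg : 0 ≤ Cfx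
  Cfy_nonneg : 0 ≤ Cfy
  σ_nonneg : 0 ≤ σ

namespace Problem

variable {m dx : ℕ} {dy : Fin m → ℕ} {Ξ Z : Fin m → Type*}
  [∀ i, MeasurableSpace (Ξ i)] [∀ i, MeasurableSpace (Z i)]
  (p : Problem m dx dy Ξ Z)

/-- `f_i(x, y) = E_ξ[f_i(x, y; ξ)]`. -/
def fBar (i : Fin m) (x : Vec dx) (y : Vec (dy i)) : ℝ := ∫ ξ, p.f i x y ξ ∂(p.P i)

/-- `g_i(x, y) = E_ζ[g_i(x, y; ζ)]`. -/
def gBar (i : Fin m) (x : Vec dx) (y : Vec (dy i)) : ℝ := ∫ ζ, p.g i x y ζ ∂(p.Q i)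

/-- `y_i(x) = argmin_y g_i(x, y)`. -/
def yStar (i : Fin m) (x : Vec dx) : Vec (dy i) :=
  Classical.epsilon fun y => ∀ y', p.gBar i x y ≤ p.gBar i x y'

/-- The objective `F(x) = (1/m) ∑ᵢ f_i(x, y_i(x))`. -/
def F (x : Vec dx) : ℝ := (m : ℝ)⁻¹ * ∑ i, p.fBar i x (p.yStar i x)

/-- `∇ₓ f_i(x, y; ξ)`. -/
def fx (i : Fin m) (x : Vec dx) (y : Vec (dy i)) (ξ : Ξ i) : Vec dx :=
  gradX (fun x' y' => p.f i x' y' ξ) x y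

/-- `∇_y f_i(x, y; ξ)`. -/
def fy (i : Fin m) (x : Vec dx) (y : Vec (dy i)) (ξ : Ξ i) : Vec (dy i) :=
  gradY (fun x' y' => p.f i x' y' ξ) x y

/-- `∇_y g_i(x, y; ζ)`. -/
def gy (i : Fin m) (x : Vec dx) (y : Vec (dy i)) (ζ : Z i) : Vec (dy i) :=
  gradY (fun x' y' => p.g i x' y' ζ) x y

/-- `∇²_{xy} g_i(x, y; ζ)`. -/
def gxy (i : Fin m) (x : Vec dx) (y : Vec (dy i)) (ζ : Z i) : Vec (dy i) →L[ℝ] Vec dx :=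
  jacXY (fun x' y' => p.g i x' y' ζ) x y

/-- `∇²_{yy} g_i(x, y; ζ)`. -/
def gyy (i : Fin m) (x : Vec dx) (y : Vec (dy i)) (ζ : Z i) : Vec (dy i) →L[ℝ] Vec (dy i) :=
  hessYY (fun x' y' => p.g i x' y' ζ) x y

/-- The problem is well posed: `P i`, `Q i` are probability measures, the expectations defining
`f_i` and `g_i` exist, and the derivatives of the stochastic functions that are used exist. -/
structure Regular : Prop where
  probP : ∀ i, IsProbabilityMeasure (p.P i)
  probQ : ∀ i, IsProbabilityMeasure (p.Q i)
  f_meas : ∀ i x y, Measurable (p.f i x y)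
  g_meas : ∀ i x y, Measurable (p.g i x y)
  f_int : ∀ i x y, Integrable (p.f i x y) (p.P i)
  g_int : ∀ i x y, Integrable (p.g i x y) (p.Q i)
  f_diff : ∀ i ξ, Differentiable ℝ fun w : Vec dx × Vec (dy i) => p.f i w.1 w.2 ξ
  g_diff : ∀ i x ζ, Differentiable ℝ fun y => p.g i x y ζ
  gy_diff : ∀ i ζ, Differentiable ℝ fun w : Vec dx × Vec (dy i) => p.gy i w.1 w.2 ζ

/-- Every `g_i(x, ·)` is `L_g`-smooth and `λ`-strongly convex. -/
structure LowerLevel (K : Consts) : Prop where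
  smooth : ∀ i x y y', ‖gradY (p.gBar i) x y - gradY (p.gBar i) x y'‖ ≤ K.Lg * ‖y - y'‖
  strong : ∀ i x y y', p.gBar i x y' + inner ℝ (gradY (p.gBar i) x y') (y - y')
    + K.lam / 2 * ‖y - y'‖ ^ 2 ≤ p.gBar i x y

/-- The conditions on the stochastic derivatives: Lipschitz continuity, bounded expected upper
gradients, and variance (mean squared deviation, in the `ℓ²` or spectral norm, from the
derivatives of `f_i` and `g_i`) at most `σ²`. -/
structure Stochastic (K : Consts) : Prop where
  fx_lip : ∀ i ξ, LipschitzXY K.Lfx fun x y => p.fx i x y ξ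
  fy_lip : ∀ i ξ, LipschitzXY K.Lfy fun x y => p.fy i x y ξ
  gy_lip : ∀ i ζ, LipschitzXY K.Lgy fun x y => p.gy i x y ζ
  gxy_lip : ∀ i ζ, LipschitzXY K.Lgxy fun x y => p.gxy i x y ζ
  gyy_lip : ∀ i ζ, LipschitzXY K.Lgyy fun x y => p.gyy i x y ζ
  fx_bdd : ∀ i x y, ‖gradX (p.fBar i) x y‖ ^ 2 ≤ K.Cfx ^ 2
  fy_bdd : ∀ i x y, ‖gradY (p.fBar i) x y‖ ^ 2 ≤ K.Cfy ^ 2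
  fx_var : ∀ i x y, ∫⁻ ξ, ‖p.fx i x y ξ - gradX (p.fBar i) x y‖ₑ ^ 2 ∂(p.P i)
    ≤ ENNReal.ofReal (K.σ ^ 2)
  fy_var : ∀ i x y, ∫⁻ ξ, ‖p.fy i x y ξ - gradY (p.fBar i) x y‖ₑ ^ 2 ∂(p.P i)
    ≤ ENNReal.ofReal (K.σ ^ 2)
  gy_var : ∀ i x y, ∫⁻ ζ, ‖p.gy i x y ζ - gradY (p.gBar i) x y‖ₑ ^ 2 ∂(p.Q i)
    ≤ ENNReal.ofReal (K.σ ^ 2)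
  gxy_var : ∀ i x y, ∫⁻ ζ, ‖p.gxy i x y ζ - jacXY (p.gBar i) x y‖ₑ ^ 2 ∂(p.Q i)
    ≤ ENNReal.ofReal (K.σ ^ 2)
  gyy_var : ∀ i x y, ∫⁻ ζ, ‖p.gyy i x y ζ - hessYY (p.gBar i) x y‖ₑ ^ 2 ∂(p.Q i)
    ≤ ENNReal.ofReal (K.σ ^ 2)

end Problem

/-! ### Random samples -/

section Samples

variable {m : ℕ} (Ξ Z : Fin m → Type*)

/-- For every block, a mini-batch of `b` upper-level and of `b` lower-level samples. -/
abbrev Batches (b : ℕ) := ((i : Fin m) → Fin b → Ξ i) × ((i : Fin m) → Fin b → Z i)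

/-- The randomness of one iteration: the set of sampled blocks, and the mini-batches (only those
of sampled blocks are used). -/
abbrev IterSample (b : ℕ) := Finset (Fin m) × Batches Ξ Z b

/-- Average of `φ` over a mini-batch. -/
def batchMean {S V : Type*} [AddCommGroup V] [Module ℝ V] {b : ℕ} (φ : S → V) (w : Fin b → S) : V :=
  (b : ℝ)⁻¹ • ∑ k, φ (w k)

variable {Ξ Z} [∀ i, MeasurableSpace (Ξ i)] [∀ i, MeasurableSpace (Z i)]
  {dx : ℕ} {dy : Fin m → ℕ}

/-- All samples of all mini-batches are independent, with laws `P i` and `Q i`. -/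
def batchLaw (p : Problem m dx dy Ξ Z) (b : ℕ) : Measure (Batches Ξ Z b) :=
  (Measure.pi fun i => Measure.pi fun _ : Fin b => p.P i).prod
    (Measure.pi fun i => Measure.pi fun _ : Fin b => p.Q i)

/-- The sampled blocks form a uniformly random subset of size `I`, independent of the
mini-batches. -/
def iterLaw (p : Problem m dx dy Ξ Z) (I b : ℕ) : Measure (IterSample Ξ Z b) :=
  (uniformOn {S : Finset (Fin m) | S.card = I}).prod (batchLaw p b)

/-- The randomness of a run: a (possibly random) initial point `y₁`, the initial mini-batches
`w₀` of size `b₀`, and the samples `w t` of the iterations `t = 0, 1, …` (blocks of size `I`,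
mini-batches of size `b`), all of them mutually independent. -/
structure IsSampling (p : Problem m dx dy Ξ Z) (I b b₀ : ℕ) {Ω : Type*} [MeasurableSpace Ω]
    (μ : Measure Ω) (y₁ : Ω → (i : Fin m) → Vec (dy i)) (w₀ : Ω → Batches Ξ Z b₀)
    (w : ℕ → Ω → IterSample Ξ Z b) : Prop where
  y₁_meas : Measurable y₁
  w₀_meas : Measurable w₀
  w_meas : ∀ t, Measurable (w t)
  w₀_law : μ.map w₀ = batchLaw p b₀
  w_law : ∀ t, μ.map (w t) = iterLaw p I b
  indep_init : IndepFun y₁ w₀ μ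
  indep_init_iter : IndepFun (fun ω => (y₁ ω, w₀ ω)) (fun ω t => w t ω) μ
  indep_iter : iIndepFun w μ

end Samples

/-! ### The algorithm -/

/-- The constant parameters `α, ᾱ, β, τ, τ_t, η` of the algorithm. -/
structure Steps where
  (α αb β τ τt η : ℝ)

/-- The MSVR parameter `(m - I) / (I (1 - a)) + (1 - a)`. -/
def msvrGamma (m I : ℕ) (a : ℝ) : ℝ := ((m : ℝ) - I) / (I * (1 - a)) + (1 - a)

/-- The variables `x_t, x_{t-1}, y_t, y_{t-1}, s_t, H_t, H_{t-1}, z_t`. -/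
structure State {m : ℕ} (dx : ℕ) (dy : Fin m → ℕ) where
  x : Vec dx
  xPrev : Vec dx
  y : (i : Fin m) → Vec (dy i)
  yPrev : (i : Fin m) → Vec (dy i)
  s : (i : Fin m) → Vec (dy i)
  H : (i : Fin m) → Vec (dy i) →L[ℝ] Vec (dy i)
  HPrev : (i : Fin m) → Vec (dy i) →L[ℝ] Vec (dy i)
  z : Vec dx

section Algorithm

variable {m : ℕ} {Ξ Z : Fin m → Type*} [∀ i, MeasurableSpace (Ξ i)] [∀ i, MeasurableSpace (Z i)]
  {dx : ℕ} {dy : Fin m → ℕ} (p : Problem m dx dy Ξ Z)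

/-- The stochastic hyper-gradient of block `i`,
`∇ₓ f_i(x, y; 𝓑) - ∇²_{xy} g_i(x, y; 𝓑') H⁻¹ ∇_y f_i(x, y; 𝓑)`. -/
def hyperGrad {b : ℕ} (i : Fin m) (x : Vec dx) (y : Vec (dy i)) (H : Vec (dy i) →L[ℝ] Vec (dy i))
    (w : Batches Ξ Z b) : Vec dx :=
  batchMean (p.fx i x y) (w.1 i)
    - batchMean (p.gxy i x y) (w.2 i) (H.inverse (batchMean (p.fy i x y) (w.1 i)))

/-- Initialization: `x₀ = x₁`, `y₀ = y₁`, `H₀ = H₁`, and `s₁, H₁, z₁` are the mini-batch estimators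
over all blocks at `(x₁, y₁)`. -/
def initState {b₀ : ℕ} (lam : ℝ) (x₁ : Vec dx) (y₁ : (i : Fin m) → Vec (dy i))
    (w : Batches Ξ Z b₀) : State dx dy :=
  let H₁ := fun i => proj lam (batchMean (p.gyy i x₁ (y₁ i)) (w.2 i))
  { x := x₁
    xPrev := x₁
    y := y₁
    yPrev := y₁
    s := fun i => batchMean (p.gy i x₁ (y₁ i)) (w.2 i)
    H := H₁
    HPrev := H₁
    z := (m : ℝ)⁻¹ • ∑ i, hyperGrad p i x₁ (y₁ i) (H₁ i) w }

open Classical in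
/-- One iteration of the algorithm. -/
def step {b : ℕ} (lam : ℝ) (I : ℕ) (c : Steps) (w : IterSample Ξ Z b) (st : State dx dy) :
    State dx dy :=
  let s' := fun i => if i ∈ w.1 then
      (1 - c.α) • st.s i + c.α • batchMean (p.gy i st.x (st.y i)) (w.2.2 i)
        + msvrGamma m I c.α • (batchMean (p.gy i st.x (st.y i)) (w.2.2 i)
          - batchMean (p.gy i st.xPrev (st.yPrev i)) (w.2.2 i))
    else st.s i
  let H' := fun i => if i ∈ w.1 then
      proj lam ((1 - c.αb) • st.H i + c.αb • batchMean (p.gyy i st.x (st.y i)) (w.2.2 i)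
        + msvrGamma m I c.αb • (batchMean (p.gyy i st.x (st.y i)) (w.2.2 i)
          - batchMean (p.gyy i st.xPrev (st.yPrev i)) (w.2.2 i)))
    else st.H i
  let G := (I : ℝ)⁻¹ • ∑ i ∈ w.1, hyperGrad p i st.x (st.y i) (st.H i) w.2
  let G' := (I : ℝ)⁻¹ • ∑ i ∈ w.1, hyperGrad p i st.xPrev (st.yPrev i) (st.HPrev i) w.2
  let z' := (1 - c.β) • (st.z - G') + G
  { x := st.x - c.η • z'
    xPrev := st.x
    y := fun i => st.y i - (c.τ * c.τt) • st.s i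
    yPrev := st.y
    s := s'
    H := H'
    HPrev := st.H
    z := z' }

/-- The state of the algorithm: `run … t` holds the variables with index `t + 1`, so that
`(run … 0).x = x₁`. -/
def run {b₀ b : ℕ} (lam : ℝ) (I : ℕ) (c : Steps) (x₁ : Vec dx) (y₁ : (i : Fin m) → Vec (dy i))
    (w₀ : Batches Ξ Z b₀) (w : ℕ → IterSample Ξ Z b) : ℕ → State dx dy
  | 0 => initState p lam x₁ y₁ w₀
  | t + 1 => step p lam I c (w t) (run lam I c x₁ y₁ w₀ w t)

end Algorithm

/-- `𝕀(I < m) / I + 1 / B`. -/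
def rho (m I B : ℕ) : ℝ := (if I < m then 1 / (I : ℝ) else 0) + 1 / B

/-- `m ε⁻³ 𝕀(I < m) / (I √I) + m ε⁻³ / (I √B)`. -/
def rate (m I B : ℕ) (ε : ℝ) : ℝ :=
  (if I < m then m / (ε ^ 3 * (I * √I)) else 0) + m / (ε ^ 3 * (I * √B))

/-- `a` is at most `u` and at least `θ u`. -/
def OfOrder (θ a u : ℝ) : Prop := θ * u ≤ a ∧ a ≤ u

/-- The choice of the parameters: step sizes of the stated orders, below the stated bounds. -/
structure Admissible (θ C8 C10 C11 LF : ℝ) (m I B : ℕ) (ε : ℝ) (c : Steps) : Prop where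
  α_le : c.α ≤ 1 / 2
  α_ord : OfOrder θ c.α (B * ε ^ 2 / (12 * C10))
  αb_le : c.αb ≤ 1 / 2
  αb_ord : OfOrder θ c.αb (ε ^ 2 / (12 * C10) * (rho m I B)⁻¹)
  β_le : c.β ≤ 1
  β_ord : OfOrder θ c.β (ε ^ 2 / (12 * C10) * (rho m I B)⁻¹)
  τt_ord : OfOrder θ c.τt (√(C8 / (12 * C10)) * (I / m * ε) * (√(rho m I B))⁻¹)
  η_le : c.η ≤ 1 / (2 * LF)
  η_ord : OfOrder θ c.η (√C11 * (I / m * ε) * (√(rho m I B))⁻¹)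

end

end MBBO

namespace MBBO


/-! ### Elementary norm inequalities -/

section Norms

variable {V : Type*} [NormedAddCommGroup V]

/-! Write q = I/m and a = τ τ_t. Along x ↦ y_i(x) the field ∇_y g_i vanishes identically.
Linearising this identity gives the derivative -(∇²_yy g_i)⁻¹(∇²_xy g_i)ᵀ of y_i, so ∇F is the block
average of `hyperMean` at y = y_i(x), H = ∇²_yy g_i (`hasFDerivAt_yStar`, `gradient_F`). Inversion
is Lipschitz on {X ⪰ λI}, hence `hyperMean` is Lipschitz in (x, y, H), and the distance from z to ∇F
is controlled by the errors of z, H and y (`norm_z_sub_gradient_sq_le`); the error of y is in turn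
driven by that of s.

Each error obeys a recursion of the form contraction + sampling noise + movement of the iterates.
For s and H (`meanLE_errS`, `meanLE_errH`) the rate is 1 - qα resp. 1 - qᾱ: the parameter γ is
exactly the one for which the cross terms of sampled and idle blocks cancel in expectation
(`estimator_contraction`). The projection does no harm, because the true Hessian lies in the convex
set projected onto; this is true in the Frobenius norm, which is why H is measured there and why D
enters. For z (`meanLE_errZ`) the rate is 1 - β and the noise is β² times the variance of a sampled
block average, of order 𝕀(I < m)/I + 1/B. For y (`errY_step_le`) an inexact gradient step contracts
by 1 - aλ/2.

The errors are combined in `potential`. Each weight is a constant times η divided by the contraction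
rate, so one iteration releases a fixed multiple of η times the error, and the constants `wY`, `wS`,
`wH` are chosen so that this pays for the other places where that error occurs. Movement is paid for
as follows: the step in x by the term -(η/4)‖z‖² of the descent inequality, the step in y by a²
times the errors of s and y, the step in H by the error of H. What is left closes under the
relations of `Steps.Balanced`: a² is at most a small multiple of q² min(α, ᾱ, β), and η at most a
small multiple of a. The outcome (`meanLE_potential`) is E Φ_{t+1} ≤ Φ_t - (η/2)‖∇F(x_t)‖² + η ·
`noise`, conditionally on the past.

Since the samples of an iteration are independent of the past, this sums along the run
(`sum_lintegral_gradient_le`). The prescribed orders make the noise at most ε²/12 and the initial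
potential at most (η/4) T ε²; as 1/4 + 1/12 < 1/2, the mean squared gradient is at most ε². The
number of iterations is governed by 1/(η ε²), of order (m/I) ε⁻³ √ρ, and √ρ ≤ 𝕀(I < m)/√I + 1/√B.

One-step expectations are stated with `MeanLE`, an integrable majorant, so that measurability of the
integrand is not needed there. Expectations along the run are lower Lebesgue integrals, so that
integrability of the potential need not be known beforehand. -/

lemma norm_add_sq_le_two (a b : V) : ‖a + b‖ ^ 2 ≤ 2 * ‖a‖ ^ 2 + 2 * ‖b‖ ^ 2 := by
  have := norm_add_le a b
  have h0 := norm_nonneg (a + b)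
  nlinarith [sq_nonneg (‖a‖ - ‖b‖)]

lemma norm_sub_sq_le_two (a b : V) : ‖a - b‖ ^ 2 ≤ 2 * ‖a‖ ^ 2 + 2 * ‖b‖ ^ 2 := by
  simpa [sub_eq_add_neg] using norm_add_sq_le_two a (-b)

lemma norm_add_sq_le_three (a b c : V) :
    ‖a + b + c‖ ^ 2 ≤ 3 * (‖a‖ ^ 2 + ‖b‖ ^ 2 + ‖c‖ ^ 2) := by
  have := norm_add₃_le (a := a) (b := b) (c := c)
  have h0 := norm_nonneg (a + b + c)
  nlinarith [sq_nonneg (‖a‖ - ‖b‖), sq_nonneg (‖a‖ - ‖c‖), sq_nonneg (‖b‖ - ‖c‖)]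

lemma norm_add_sq_le_four (a b c d : V) :
    ‖a + b + c + d‖ ^ 2 ≤ 4 * (‖a‖ ^ 2 + ‖b‖ ^ 2 + ‖c‖ ^ 2 + ‖d‖ ^ 2) := by
  have h1 := norm_add_sq_le_two (a + b) (c + d)
  have h2 := norm_add_sq_le_two a b
  have h3 := norm_add_sq_le_two c d
  rw [← add_assoc] at h1
  linarith

/-- Young's inequality for a squared norm. -/
lemma norm_add_sq_le_young (a b : V) {t : ℝ} (ht : 0 < t) :
    ‖a + b‖ ^ 2 ≤ (1 + t) * ‖a‖ ^ 2 + (1 + 1 / t) * ‖b‖ ^ 2 := by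
  have h1 := norm_add_le a b
  have h2 : ‖a + b‖ ^ 2 ≤ (‖a‖ + ‖b‖) ^ 2 := by gcongr
  have h3 : 2 * ‖a‖ * ‖b‖ ≤ t * ‖a‖ ^ 2 + 1 / t * ‖b‖ ^ 2 := by
    have : 0 ≤ (1 / t) * (t * ‖a‖ - ‖b‖) ^ 2 := by positivity
    have e : (1 / t) * (t * ‖a‖ - ‖b‖) ^ 2
        = t * ‖a‖ ^ 2 + 1 / t * ‖b‖ ^ 2 - 2 * ‖a‖ * ‖b‖ := by
      field_simp
      ring
    linarith
  nlinarith

lemma norm_sum_sq_le_card_mul {ι : Type*} (s : Finset ι) (v : ι → V) :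
    ‖∑ i ∈ s, v i‖ ^ 2 ≤ s.card * ∑ i ∈ s, ‖v i‖ ^ 2 := by
  calc ‖∑ i ∈ s, v i‖ ^ 2 ≤ (∑ i ∈ s, ‖v i‖) ^ 2 := by
        gcongr
        exact norm_sum_le _ _
    _ ≤ _ := sq_sum_le_card_mul_sum_sq

/-- Jensen's inequality for the average over a nonempty finite set. -/
lemma norm_avg_sq_le [NormedSpace ℝ V] {ι : Type*} (s : Finset ι) (v : ι → V) {n : ℕ}
    (hn : s.card = n) (h0 : 1 ≤ n) :
    ‖(n : ℝ)⁻¹ • ∑ i ∈ s, v i‖ ^ 2 ≤ (n : ℝ)⁻¹ * ∑ i ∈ s, ‖v i‖ ^ 2 := by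
  have hn0 : (0 : ℝ) < n := by exact_mod_cast h0
  rw [norm_smul, mul_pow, norm_inv, Real.norm_natCast]
  have := norm_sum_sq_le_card_mul s v
  rw [hn] at this
  calc ((n : ℝ)⁻¹) ^ 2 * ‖∑ i ∈ s, v i‖ ^ 2
      ≤ ((n : ℝ)⁻¹) ^ 2 * (n * ∑ i ∈ s, ‖v i‖ ^ 2) := by gcongr
    _ = _ := by field_simp

lemma norm_avg_le [NormedSpace ℝ V] {m : ℕ} {v : Fin m → V} {c : ℝ}
    (hc : 0 ≤ c) (hv : ∀ i, ‖v i‖ ≤ c) : ‖(m : ℝ)⁻¹ • ∑ i, v i‖ ≤ c := by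
  rcases Nat.eq_zero_or_pos m with hm | hm
  · subst hm
    simpa using hc
  · have hm0 : (0 : ℝ) < m := by exact_mod_cast hm
    rw [norm_smul, norm_inv, Real.norm_natCast, inv_mul_le_iff₀ hm0]
    calc ‖∑ k, v k‖ ≤ ∑ k, ‖v k‖ := norm_sum_le _ _
      _ ≤ ∑ _k : Fin m, c := Finset.sum_le_sum fun k _ => hv k
      _ = m * c := by simp

end Norms

/-! ### Second moments -/

section Moments

lemma integrable_norm_sq {W : Type*} [MeasurableSpace W] {ν : Measure W} {V : Type*}
    [NormedAddCommGroup V] {N : W → V} (hN : MemLp N 2 ν) : Integrable (fun w => ‖N w‖ ^ 2) ν :=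
  hN.integrable_norm_pow (by norm_num)

variable {W : Type*} [MeasurableSpace W] {ν : Measure W} [IsProbabilityMeasure ν]
  {V : Type*} [NormedAddCommGroup V] [InnerProductSpace ℝ V] [CompleteSpace V]

/-- Bias-variance decomposition. -/
lemma integral_norm_const_add_sq {N : W → V} (hN : MemLp N 2 ν) (h0 : ∫ w, N w ∂ν = 0) (c : V) :
    ∫ w, ‖c + N w‖ ^ 2 ∂ν = ‖c‖ ^ 2 + ∫ w, ‖N w‖ ^ 2 ∂ν := by
  have hi : Integrable N ν := hN.integrable (by norm_num)
  have h1 : Integrable (fun w => ‖N w‖ ^ 2) ν := integrable_norm_sq hN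
  have h2 : Integrable (fun w => 2 * inner ℝ c (N w)) ν := (hi.const_inner c).const_mul 2
  have e : ∀ w, ‖c + N w‖ ^ 2 = ‖c‖ ^ 2 + 2 * inner ℝ c (N w) + ‖N w‖ ^ 2 := fun w =>
    norm_add_sq_real c (N w)
  simp_rw [e]
  have h3 : Integrable (fun w => ‖c‖ ^ 2 + 2 * inner ℝ c (N w)) ν := (integrable_const _).add h2
  rw [integral_add h3 h1, integral_add (integrable_const _) h2,
    integral_const_mul, integral_inner hi, h0]
  simp

/-- The variance is at most the second moment. -/
lemma integral_norm_sub_mean_sq_le {N : W → V} (hN : MemLp N 2 ν) :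
    ∫ w, ‖N w - ∫ w, N w ∂ν‖ ^ 2 ∂ν ≤ ∫ w, ‖N w‖ ^ 2 ∂ν := by
  set c := ∫ w, N w ∂ν with hc
  have hi : Integrable N ν := hN.integrable (by norm_num)
  have h := integral_norm_const_add_sq (N := fun w => N w - c) (hN.sub (memLp_const c))
    (by rw [integral_sub hi (integrable_const _)]; simp [hc]) c
  simp only [add_sub_cancel] at h
  rw [h]
  linarith [sq_nonneg ‖c‖]

end Moments

/-! ### Mini-batch averages -/

section Batch

variable {S : Type*} [MeasurableSpace S] {P : Measure S} [IsProbabilityMeasure P] {b : ℕ}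

lemma memLp_eval {V : Type*} [NormedAddCommGroup V] {φ : S → V} {r : ENNReal} (h : MemLp φ r P)
    (k : Fin b) : MemLp (fun w : Fin b → S => φ (w k)) r (Measure.pi fun _ => P) :=
  h.comp_measurePreserving (measurePreserving_eval (fun _ : Fin b => P) k)

lemma integral_eval {V : Type*} [NormedAddCommGroup V] [NormedSpace ℝ V] {φ : S → V}
    (h : AEStronglyMeasurable φ P) (k : Fin b) :
    ∫ w : Fin b → S, φ (w k) ∂(Measure.pi fun _ => P) = ∫ s, φ s ∂P := by
  have hp := measurePreserving_eval (fun _ : Fin b => P) k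
  have := integral_map (μ := Measure.pi fun _ : Fin b => P) hp.measurable.aemeasurable
    (f := φ) (by rw [hp.map_eq]; exact h)
  rw [hp.map_eq] at this
  exact this.symm

lemma memLp_batchMean {V : Type*} [NormedAddCommGroup V] [NormedSpace ℝ V] {φ : S → V}
    {r : ENNReal} (h : MemLp φ r P) :
    MemLp (batchMean (b := b) φ) r (Measure.pi fun _ => P) := by
  unfold batchMean
  exact (memLp_finsetSum _ fun k _ => memLp_eval h k).const_smul _

lemma integral_batchMean {V : Type*} [NormedAddCommGroup V] [NormedSpace ℝ V] {φ : S → V}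
    (h : Integrable φ P) (hb : 1 ≤ b) :
    ∫ w : Fin b → S, batchMean φ w ∂(Measure.pi fun _ => P) = ∫ s, φ s ∂P := by
  have hb0 : (b : ℝ) ≠ 0 := by positivity
  unfold batchMean
  rw [integral_smul, integral_finsetSum _ fun k _ =>
    (memLp_one_iff_integrable.1 (memLp_eval (memLp_one_iff_integrable.2 h) k))]
  simp_rw [integral_eval h.1]
  simp [← Nat.cast_smul_eq_nsmul ℝ, smul_smul, hb0]

lemma batchMean_sub_const {V : Type*} [AddCommGroup V] [Module ℝ V] (φ : S → V) (hb : 1 ≤ b)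
    (w : Fin b → S) (c : V) : batchMean φ w - c = batchMean (fun s => φ s - c) w := by
  have hb0 : (b : ℝ) ≠ 0 := by positivity
  simp [batchMean, Finset.sum_sub_distrib, smul_sub, ← Nat.cast_smul_eq_nsmul ℝ, smul_smul, hb0]

lemma batchMean_sub {V : Type*} [AddCommGroup V] [Module ℝ V] (φ ψ : S → V)
    (w : Fin b → S) : batchMean φ w - batchMean ψ w = batchMean (fun s => φ s - ψ s) w := by
  simp [batchMean, Finset.sum_sub_distrib, smul_sub]

lemma norm_batchMean_le {V : Type*} [NormedAddCommGroup V] [NormedSpace ℝ V] {φ : S → V} {c : ℝ}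
    (hb : 1 ≤ b) (h : ∀ s, ‖φ s‖ ≤ c) (w : Fin b → S) : ‖batchMean φ w‖ ≤ c := by
  have hb0 : (0 : ℝ) < b := by exact_mod_cast hb
  unfold batchMean
  rw [norm_smul, norm_inv, Real.norm_natCast, inv_mul_le_iff₀ hb0]
  calc ‖∑ k, φ (w k)‖ ≤ ∑ k : Fin b, ‖φ (w k)‖ := norm_sum_le _ _
    _ ≤ ∑ _k : Fin b, c := Finset.sum_le_sum fun k _ => h _
    _ = b * c := by simp

/-- A mini-batch of size `b` reduces the variance by the factor `b`. -/
lemma integral_norm_batchMean_sub_sq_le {V : Type*} [NormedAddCommGroup V]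
    [InnerProductSpace ℝ V] [CompleteSpace V] [MeasurableSpace V] [BorelSpace V]
    {φ : S → V} (h : MemLp φ 2 P) (hm : Measurable φ) (hb : 1 ≤ b) :
    ∫ w : Fin b → S, ‖batchMean φ w - ∫ s, φ s ∂P‖ ^ 2 ∂(Measure.pi fun _ => P)
      ≤ (b : ℝ)⁻¹ * ∫ s, ‖φ s - ∫ s, φ s ∂P‖ ^ 2 ∂P := by
  have hb0 : (0 : ℝ) < b := by exact_mod_cast hb
  set c := ∫ s, φ s ∂P with hc
  set ψ : S → V := fun s => φ s - c with hψ
  have hψm : Measurable ψ := hm.sub_const c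
  have hψ2 : MemLp ψ 2 P := h.sub (memLp_const c)
  have hψ0 : ∫ s, ψ s ∂P = 0 := by
    rw [hψ, integral_sub (h.integrable (by norm_num)) (integrable_const _)]
    simp [hc]
  have hind : iIndepFun (fun (k : Fin b) (w : Fin b → S) => ψ (w k))
      (Measure.pi fun _ : Fin b => P) := iIndepFun_pi fun _ => hψm.aemeasurable
  have hint : ∀ k l : Fin b, Integrable (fun w : Fin b → S => inner ℝ (ψ (w k)) (ψ (w l)))
      (Measure.pi fun _ => P) := fun k l => by
    have hk := memLp_eval (b := b) hψ2 k
    have hl := memLp_eval (b := b) hψ2 l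
    refine Integrable.mono' ((integrable_norm_sq hk).add (integrable_norm_sq hl))
      (hk.1.inner hl.1) (Filter.Eventually.of_forall fun w => ?_)
    refine (norm_inner_le_norm _ _).trans ?_
    simp only [Pi.add_apply]
    nlinarith [sq_nonneg (‖ψ (w k)‖ - ‖ψ (w l)‖), sq_nonneg (‖ψ (w k)‖ + ‖ψ (w l)‖)]
  -- Independence removes the off-diagonal inner products, so only b of the b² terms survive; this
  -- is the gain of 1/b.
  have hval : ∀ k l : Fin b, ∫ w : Fin b → S, inner ℝ (ψ (w k)) (ψ (w l)) ∂(Measure.pi fun _ => P)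
      = if k = l then ∫ s, ‖ψ s‖ ^ 2 ∂P else 0 := fun k l => by
    split_ifs with hkl
    · subst hkl
      simp_rw [real_inner_self_eq_norm_sq]
      exact integral_eval (φ := fun s => ‖ψ s‖ ^ 2) (integrable_norm_sq hψ2).1 k
    · have hk := (memLp_eval (b := b) hψ2 k).integrable (by norm_num)
      have hl := (memLp_eval (b := b) hψ2 l).integrable (by norm_num)
      have := (hind.indepFun hkl).integral_bilin hk hl (innerSL ℝ)
      rw [integral_eval hψ2.1 k, hψ0] at this
      simp only [map_zero, zero_apply] at this
      exact this
  have e : ∀ w : Fin b → S, ‖batchMean φ w - c‖ ^ 2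
      = ((b : ℝ)⁻¹) ^ 2 * ∑ k, ∑ l, inner ℝ (ψ (w k)) (ψ (w l)) := fun w => by
    rw [batchMean_sub_const φ hb, batchMean, norm_smul, mul_pow, norm_inv, Real.norm_natCast,
      ← real_inner_self_eq_norm_sq, sum_inner]
    simp_rw [inner_sum]
    rfl
  simp_rw [e]
  rw [integral_const_mul, integral_finsetSum _ fun k _ => integrable_finsetSum _ fun l _ =>
    hint k l]
  simp_rw [integral_finsetSum Finset.univ fun l _ => hint _ l, hval]
  simp only [Finset.sum_ite_eq, Finset.mem_univ, if_true, Finset.sum_const, Finset.card_univ,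
    Fintype.card_fin, nsmul_eq_mul]
  apply le_of_eq
  field_simp
  rfl

end Batch



/-! ### Sampling a uniformly random set of blocks -/

section BlockSampling

variable {m I : ℕ}

/-- The law of a uniformly random subset of size `I`. -/
noncomputable abbrev blockLaw (m I : ℕ) : Measure (Finset (Fin m)) :=
  uniformOn {S : Finset (Fin m) | S.card = I}

lemma setOf_card_eq (m I : ℕ) :
    {S : Finset (Fin m) | S.card = I} = ↑(Finset.powersetCard I (Finset.univ : Finset (Fin m))) := by
  ext S
  simp [Finset.mem_powersetCard]

lemma isProbabilityMeasure_blockLaw (hI : I ≤ m) : IsProbabilityMeasure (blockLaw m I) := by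
  rw [blockLaw, setOf_card_eq]
  refine isProbabilityMeasure_uniformOn (Finset.finite_toSet _) ?_
  rw [Finset.coe_nonempty, Finset.powersetCard_nonempty]
  simpa using hI

open Classical in
lemma integral_blockLaw {V : Type*} [NormedAddCommGroup V] [NormedSpace ℝ V] [CompleteSpace V]
    (hI : I ≤ m) (φ : Finset (Fin m) → V) :
    ∫ S, φ S ∂(blockLaw m I)
      = ((m.choose I : ℝ)⁻¹) • ∑ S ∈ Finset.powersetCard I Finset.univ, φ S := by
  have := isProbabilityMeasure_blockLaw hI
  rw [integral_fintype Integrable.of_finite, Finset.smul_sum]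
  rw [← Finset.sum_subset (Finset.subset_univ (Finset.powersetCard I Finset.univ))]
  · refine Finset.sum_congr rfl fun S hS => ?_
    congr 1
    rw [blockLaw, setOf_card_eq, measureReal_def, ← Finset.coe_singleton, uniformOn_apply_finset,
      Finset.inter_singleton_of_mem hS]
    simp
  · intro S _ hS
    rw [blockLaw, setOf_card_eq, measureReal_def, ← Finset.coe_singleton, uniformOn_apply_finset,
      Finset.inter_singleton_of_notMem hS]
    simp

/-- There are C(m-1, I-1) such sets, and m C(m-1, I-1) = I C(m, I). -/
lemma card_filter_mem (hI1 : 1 ≤ I) (hI : I ≤ m) (i : Fin m) :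
    (((Finset.powersetCard I Finset.univ).filter fun S : Finset (Fin m) => i ∈ S).card : ℝ)
      = (I / m : ℝ) * m.choose I := by
  have h := Finset.card_filter_powersetCard_subset {i} (Finset.univ : Finset (Fin m)) I
    (Finset.subset_univ _) (by simpa using hI1)
  simp only [Finset.singleton_subset_iff, Finset.card_univ, Fintype.card_fin,
    Finset.card_singleton] at h
  rw [h]
  obtain ⟨m, rfl⟩ : ∃ k, m = k + 1 := ⟨m - 1, by omega⟩
  obtain ⟨I, rfl⟩ : ∃ k, I = k + 1 := ⟨I - 1, by omega⟩
  have h2 := Nat.add_one_mul_choose_eq m I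
  simp only [Nat.add_sub_cancel]
  have h3 : ((m + 1 : ℕ) : ℝ) * (m.choose I : ℝ)
      = ((m + 1).choose (I + 1) : ℝ) * ((I + 1 : ℕ) : ℝ) := by exact_mod_cast h2
  have h4 : ((m + 1 : ℕ) : ℝ) ≠ 0 := by positivity
  field_simp
  linarith

/-- Two distinct blocks are sampled together equally often. -/
lemma exists_card_filter_mem_mem (m I : ℕ) : ∃ n : ℕ, ∀ i j : Fin m, i ≠ j →
    ((Finset.powersetCard I Finset.univ).filter fun S : Finset (Fin m) => i ∈ S ∧ j ∈ S).card
      = n := by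
  by_cases hI : 2 ≤ I
  · refine ⟨(m - 2).choose (I - 2), fun i j hij => ?_⟩
    have h := Finset.card_filter_powersetCard_subset {i, j} (Finset.univ : Finset (Fin m)) I
      (Finset.subset_univ _) (by rw [Finset.card_pair hij]; exact hI)
    simpa [Finset.insert_subset_iff, Finset.card_pair hij] using h
  · refine ⟨0, fun i j hij => ?_⟩
    rw [Finset.card_eq_zero, Finset.filter_eq_empty_iff]
    rintro S hS ⟨hi, hj⟩
    have h1 : ({i, j} : Finset (Fin m)) ⊆ S := by simp [Finset.insert_subset_iff, hi, hj]
    have h2 := Finset.card_le_card h1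
    rw [Finset.card_pair hij, (Finset.mem_powersetCard.1 hS).2] at h2
    omega

open Classical in
/-- Probability that a block is sampled. -/
lemma integral_mem_blockLaw {V : Type*} [NormedAddCommGroup V] [NormedSpace ℝ V] [CompleteSpace V]
    (hI1 : 1 ≤ I) (hI : I ≤ m) (i : Fin m) (a : V) :
    ∫ S, (if i ∈ S then a else 0) ∂(blockLaw m I) = (I / m : ℝ) • a := by
  have hc : (m.choose I : ℝ) ≠ 0 := by exact_mod_cast (Nat.choose_pos hI).ne'
  rw [integral_blockLaw hI, ← Finset.sum_filter, Finset.sum_const, ← Nat.cast_smul_eq_nsmul ℝ,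
    smul_smul]
  congr 1
  have h := card_filter_mem hI1 hI i
  rw [show (Finset.powersetCard I Finset.univ).filter (fun S : Finset (Fin m) => i ∈ S)
    = (Finset.powersetCard I Finset.univ).filter (fun S : Finset (Fin m) => i ∈ S) from rfl] at h
  convert! congrArg (fun x : ℝ => (m.choose I : ℝ)⁻¹ * x) h using 1
  field_simp

variable {V : Type*} [NormedAddCommGroup V] [InnerProductSpace ℝ V] [CompleteSpace V]

/-- Expanding the squares, every pair i ≠ j is counted the same number n of times, so the inner
products with coefficient n add up to n‖∑ v i‖² = 0. Only the diagonal excess N - n remains, and it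
is at most N, the number of sets containing a given block. -/
lemma sum_powersetCard_norm_sum_sq_le (hI1 : 1 ≤ I) (hI : I ≤ m) (v : Fin m → V)
    (h0 : ∑ i, v i = 0) :
    ∑ S ∈ Finset.powersetCard I Finset.univ, ‖∑ i ∈ S, v i‖ ^ 2
      ≤ (I / m : ℝ) * m.choose I * ∑ i, ‖v i‖ ^ 2 := by
  classical
  obtain ⟨n, hn⟩ := exists_card_filter_mem_mem m I
  have e : ∀ S : Finset (Fin m), ‖∑ i ∈ S, v i‖ ^ 2
      = ∑ i, ∑ j, if i ∈ S ∧ j ∈ S then inner ℝ (v i) (v j) else 0 := fun S => by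
    rw [← real_inner_self_eq_norm_sq, sum_inner]
    simp_rw [inner_sum]
    have h1 : ∀ i, (∑ j, if i ∈ S ∧ j ∈ S then inner ℝ (v i) (v j) else 0)
        = if i ∈ S then ∑ j ∈ S, inner ℝ (v i) (v j) else 0 := fun i => by
      by_cases hi : i ∈ S <;> simp [hi, Finset.sum_ite_mem]
    simp_rw [h1]
    simp [Finset.sum_ite_mem]
  have hsw : ∑ S ∈ Finset.powersetCard I Finset.univ, ‖∑ i ∈ S, v i‖ ^ 2
      = ∑ i, ∑ j, (((Finset.powersetCard I Finset.univ).filter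
          fun S : Finset (Fin m) => i ∈ S ∧ j ∈ S).card : ℝ) * inner ℝ (v i) (v j) := by
    simp_rw [e]
    rw [Finset.sum_comm]
    refine Finset.sum_congr rfl fun i _ => ?_
    rw [Finset.sum_comm]
    refine Finset.sum_congr rfl fun j _ => ?_
    rw [← Finset.sum_filter, Finset.sum_const, nsmul_eq_mul]
  set N : ℝ := (I / m : ℝ) * m.choose I with hN
  have hcard : ∀ i j : Fin m, (((Finset.powersetCard I Finset.univ).filter
      fun S : Finset (Fin m) => i ∈ S ∧ j ∈ S).card : ℝ) = n + if i = j then N - n else 0 := by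
    intro i j
    split_ifs with hij
    · subst hij
      simp only [and_self]
      rw [add_sub_cancel, hN, ← card_filter_mem hI1 hI i]
    · rw [hn i j hij, add_zero]
  rw [hsw]
  simp_rw [hcard, add_mul, Finset.sum_add_distrib, ite_mul, zero_mul, Finset.sum_ite_eq,
    Finset.mem_univ, if_true, ← Finset.mul_sum, ← inner_sum, h0, inner_zero_right,
    Finset.sum_const_zero, mul_zero, zero_add, real_inner_self_eq_norm_sq]
  gcongr
  simp

/-- Variance of the average over the sampled blocks. -/
lemma integral_norm_blockAvg_sub_sq_le (hI1 : 1 ≤ I) (hI : I ≤ m) (v : Fin m → V) :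
    ∫ S, ‖(I : ℝ)⁻¹ • ∑ i ∈ S, v i - (m : ℝ)⁻¹ • ∑ i, v i‖ ^ 2 ∂(blockLaw m I)
      ≤ (if I < m then 1 / (I : ℝ) else 0) * ((m : ℝ)⁻¹ * ∑ i, ‖v i‖ ^ 2) := by
  have hm : 1 ≤ m := hI1.trans hI
  have hm0 : (0 : ℝ) < m := by exact_mod_cast hm
  have hI0 : (0 : ℝ) < I := by exact_mod_cast hI1
  have hc : (0 : ℝ) < m.choose I := by exact_mod_cast Nat.choose_pos hI
  rw [integral_blockLaw hI]
  set c := (m : ℝ)⁻¹ • ∑ i, v i with hcdef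
  have e : ∀ S ∈ Finset.powersetCard I (Finset.univ : Finset (Fin m)),
      ‖(I : ℝ)⁻¹ • ∑ i ∈ S, v i - c‖ ^ 2 = ((I : ℝ)⁻¹) ^ 2 * ‖∑ i ∈ S, (v i - c)‖ ^ 2 := by
    intro S hS
    have hSc : S.card = I := (Finset.mem_powersetCard.1 hS).2
    have : (I : ℝ)⁻¹ • ∑ i ∈ S, v i - c = (I : ℝ)⁻¹ • ∑ i ∈ S, (v i - c) := by
      rw [Finset.sum_sub_distrib, smul_sub, Finset.sum_const, hSc, ← Nat.cast_smul_eq_nsmul ℝ,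
        smul_smul, inv_mul_cancel₀ hI0.ne', one_smul]
    rw [this, norm_smul, mul_pow, norm_inv, Real.norm_natCast]
  rw [Finset.sum_congr rfl e, ← Finset.mul_sum]
  have h0 : ∑ i, (v i - c) = 0 := by
    rw [Finset.sum_sub_distrib, Finset.sum_const, Finset.card_univ, Fintype.card_fin,
      ← Nat.cast_smul_eq_nsmul ℝ, hcdef, smul_smul, mul_inv_cancel₀ hm0.ne', one_smul, sub_self]
  by_cases hlt : I < m
  · have h1 := sum_powersetCard_norm_sum_sq_le hI1 hI (fun i => v i - c) h0
    have h2 : ∑ i, ‖v i - c‖ ^ 2 ≤ ∑ i, ‖v i‖ ^ 2 := by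
      have e2 : ∀ i, ‖v i‖ ^ 2 = ‖v i - c‖ ^ 2 + 2 * inner ℝ c (v i - c) + ‖c‖ ^ 2 := fun i => by
        have := norm_add_sq_real (v i - c) c
        rw [sub_add_cancel, real_inner_comm] at this
        exact this
      simp_rw [e2, Finset.sum_add_distrib, ← Finset.mul_sum, ← inner_sum, h0]
      simp
      positivity
    rw [if_pos hlt, smul_eq_mul]
    calc (m.choose I : ℝ)⁻¹ * (((I : ℝ)⁻¹) ^ 2 * ∑ S ∈ Finset.powersetCard I Finset.univ,
          ‖∑ i ∈ S, (v i - c)‖ ^ 2)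
        ≤ (m.choose I : ℝ)⁻¹ * (((I : ℝ)⁻¹) ^ 2 *
          ((I / m : ℝ) * m.choose I * ∑ i, ‖v i‖ ^ 2)) := by
          gcongr
          exact h1.trans (by gcongr)
      _ = _ := by field_simp
  -- Without subsampling the only set is the full one, and the block average is exact; hence the
  -- indicator in the bound.
  · have hIm : I = m := le_antisymm hI (not_lt.1 hlt)
    subst hIm
    have hp : Finset.powersetCard I (Finset.univ : Finset (Fin I)) = {Finset.univ} := by
      have := Finset.powersetCard_self (Finset.univ : Finset (Fin I))
      simpa using this
    rw [hp, Finset.sum_singleton, h0]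
    simp

end BlockSampling

/-! ### Expectations over sampled blocks and mini-batches jointly -/

section Product

variable {m I : ℕ} {W : Type*} [MeasurableSpace W] (ν : Measure W) [IsProbabilityMeasure ν]

lemma measurableSet_mem_fst (i : Fin m) :
    MeasurableSet {w : Finset (Fin m) × W | i ∈ w.1} :=
  measurable_fst (MeasurableSet.of_discrete (s := {S : Finset (Fin m) | i ∈ S}))

open Classical in
lemma memLp_ite_mem {V : Type*} [NormedAddCommGroup V] (hI : I ≤ m) {r : ENNReal}
    (i : Fin m) {φ : W → V} (hφ : MemLp φ r ν) :
    MemLp (fun w : Finset (Fin m) × W => if i ∈ w.1 then φ w.2 else 0) r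
      ((blockLaw m I).prod ν) := by
  have := isProbabilityMeasure_blockLaw hI
  have h1 : MemLp (fun w : Finset (Fin m) × W => φ w.2) r ((blockLaw m I).prod ν) :=
    hφ.comp_measurePreserving measurePreserving_snd
  have h2 := h1.indicator (measurableSet_mem_fst (W := W) i)
  convert h2 using 1
  ext w
  simp [Set.indicator]

open Classical in
lemma integral_ite_mem {V : Type*} [NormedAddCommGroup V] [NormedSpace ℝ V] [CompleteSpace V]
    (hI1 : 1 ≤ I) (hI : I ≤ m) (i : Fin m) {φ : W → V} (hφ : Integrable φ ν) :
    ∫ w : Finset (Fin m) × W, (if i ∈ w.1 then φ w.2 else 0) ∂((blockLaw m I).prod ν)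
      = (I / m : ℝ) • ∫ w, φ w ∂ν := by
  have := isProbabilityMeasure_blockLaw hI
  have h := memLp_one_iff_integrable.1
    (memLp_ite_mem ν hI i (memLp_one_iff_integrable.2 hφ))
  rw [integral_prod _ h]
  have : ∀ S : Finset (Fin m), ∫ w, (if i ∈ S then φ w else 0) ∂ν
      = if i ∈ S then ∫ w, φ w ∂ν else 0 := fun S => by split_ifs <;> simp
  simp_rw [this]
  exact integral_mem_blockLaw hI1 hI i _

open Classical in
/-- Expectation of a quantity that changes only if its block is sampled. -/
lemma integral_ite_mem_else (hI1 : 1 ≤ I) (hI : I ≤ m) (i : Fin m) {φ : W → ℝ}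
    (hφ : Integrable φ ν) (c : ℝ) :
    Integrable (fun w : Finset (Fin m) × W => if i ∈ w.1 then φ w.2 else c)
      ((blockLaw m I).prod ν) ∧
    ∫ w : Finset (Fin m) × W, (if i ∈ w.1 then φ w.2 else c) ∂((blockLaw m I).prod ν)
      = (I / m : ℝ) * ∫ w, φ w ∂ν + (1 - I / m) * c := by
  have := isProbabilityMeasure_blockLaw hI
  have hφc : Integrable (fun w => φ w - c) ν := hφ.sub (integrable_const c)
  have h := memLp_one_iff_integrable.1
    (memLp_ite_mem ν hI i (memLp_one_iff_integrable.2 hφc))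
  have e : (fun w : Finset (Fin m) × W => if i ∈ w.1 then φ w.2 else c)
      = fun w => (if i ∈ w.1 then φ w.2 - c else 0) + c := by
    ext w
    split_ifs <;> simp
  rw [e]
  refine ⟨h.add (integrable_const c), ?_⟩
  rw [integral_add h (integrable_const c), integral_ite_mem ν hI1 hI i hφc,
    integral_sub hφ (integrable_const c)]
  simp
  ring

variable {V : Type*} [NormedAddCommGroup V] [InnerProductSpace ℝ V] [CompleteSpace V]

lemma blockAvg_eq (u : Fin m → W → V) (w : Finset (Fin m) × W) :
    (I : ℝ)⁻¹ • ∑ i ∈ w.1, u i w.2 = (I : ℝ)⁻¹ • ∑ i, if i ∈ w.1 then u i w.2 else 0 := by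
  simp [Finset.sum_ite_mem]

lemma memLp_blockAvg (hI : I ≤ m) {u : Fin m → W → V} {r : ENNReal} (hu : ∀ i, MemLp (u i) r ν) :
    MemLp (fun w : Finset (Fin m) × W => (I : ℝ)⁻¹ • ∑ i ∈ w.1, u i w.2) r
      ((blockLaw m I).prod ν) := by
  classical
  rw [show (fun w : Finset (Fin m) × W => (I : ℝ)⁻¹ • ∑ i ∈ w.1, u i w.2)
    = fun w => (I : ℝ)⁻¹ • ∑ i, if i ∈ w.1 then u i w.2 else 0 from funext (blockAvg_eq u)]
  have h : MemLp (fun w : Finset (Fin m) × W => ∑ i, if i ∈ w.1 then u i w.2 else 0) r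
      ((blockLaw m I).prod ν) :=
    memLp_finsetSum (f := fun i (w : Finset (Fin m) × W) => if i ∈ w.1 then u i w.2 else 0)
      Finset.univ fun i _ => memLp_ite_mem ν hI i (hu i)
  exact h.const_smul ((I : ℝ)⁻¹)

lemma integral_blockAvg (hI1 : 1 ≤ I) (hI : I ≤ m) {u : Fin m → W → V}
    (hu : ∀ i, Integrable (u i) ν) :
    ∫ w : Finset (Fin m) × W, (I : ℝ)⁻¹ • ∑ i ∈ w.1, u i w.2 ∂((blockLaw m I).prod ν)
      = (m : ℝ)⁻¹ • ∑ i, ∫ w, u i w ∂ν := by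
  classical
  have hI0 : (I : ℝ) ≠ 0 := by positivity
  rw [show (fun w : Finset (Fin m) × W => (I : ℝ)⁻¹ • ∑ i ∈ w.1, u i w.2)
    = fun w => (I : ℝ)⁻¹ • ∑ i, if i ∈ w.1 then u i w.2 else 0 from funext (blockAvg_eq u)]
  rw [integral_smul, integral_finsetSum _ fun i _ => memLp_one_iff_integrable.1
    (memLp_ite_mem ν hI i (memLp_one_iff_integrable.2 (hu i)))]
  simp_rw [fun i => integral_ite_mem ν hI1 hI i (hu i)]
  rw [← Finset.smul_sum, smul_smul]
  congr 1
  field_simp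

/-- Second moment of the average over the sampled blocks. -/
lemma integral_norm_blockAvg_sq_le (hI1 : 1 ≤ I) (hI : I ≤ m) {u : Fin m → W → V}
    (hu : ∀ i, MemLp (u i) 2 ν) :
    ∫ w : Finset (Fin m) × W, ‖(I : ℝ)⁻¹ • ∑ i ∈ w.1, u i w.2‖ ^ 2 ∂((blockLaw m I).prod ν)
      ≤ (m : ℝ)⁻¹ * ∑ i, ∫ w, ‖u i w‖ ^ 2 ∂ν := by
  classical
  have := isProbabilityMeasure_blockLaw hI
  have hsq : ∀ i, Integrable (fun w => ‖u i w‖ ^ 2) ν := fun i => integrable_norm_sq (hu i)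
  have hL := integrable_norm_sq (memLp_blockAvg ν hI hu)
  have hR : MemLp (fun w : Finset (Fin m) × W => (I : ℝ)⁻¹ • ∑ i ∈ w.1, ‖u i w.2‖ ^ 2) 1
      ((blockLaw m I).prod ν) :=
    memLp_blockAvg ν hI fun i => memLp_one_iff_integrable.2 (hsq i)
  -- Jensen's inequality needs exactly I summands, which holds only almost surely.
  have hcard : ∀ᵐ w ∂((blockLaw m I).prod ν), w.1.card = I := by
    have h1 : ∀ᵐ S ∂(blockLaw m I), S.card = I := by
      rw [blockLaw, uniformOn]
      exact ProbabilityTheory.ae_cond_mem (MeasurableSet.of_discrete)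
    exact Measure.quasiMeasurePreserving_fst.ae h1
  have := integral_blockAvg (V := ℝ) ν hI1 hI hsq
  rw [smul_eq_mul] at this
  rw [← this]
  refine integral_mono_ae hL (memLp_one_iff_integrable.1 hR) ?_
  filter_upwards [hcard] with w hw
  exact norm_avg_sq_le w.1 (fun i => u i w.2) hw hI1

/-- Variance of the average over the sampled blocks of random vectors. -/
lemma integral_norm_blockAvg_sub_mean_sq_le (hI1 : 1 ≤ I) (hI : I ≤ m) {u : Fin m → W → V}
    (hu : ∀ i, MemLp (u i) 2 ν) {c v : ℝ} (hc : ∀ i, ‖∫ w, u i w ∂ν‖ ^ 2 ≤ c)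
    (hv : ∀ i, ∫ w, ‖u i w - ∫ w, u i w ∂ν‖ ^ 2 ∂ν ≤ v) :
    ∫ w : Finset (Fin m) × W, ‖(I : ℝ)⁻¹ • ∑ i ∈ w.1, u i w.2
        - (m : ℝ)⁻¹ • ∑ i, ∫ w, u i w ∂ν‖ ^ 2 ∂((blockLaw m I).prod ν)
      ≤ 2 * v + 2 * ((if I < m then 1 / (I : ℝ) else 0) * c) := by
  have := isProbabilityMeasure_blockLaw hI
  have hm0 : (0 : ℝ) < m := by exact_mod_cast hI1.trans hI
  set a : Fin m → V := fun i => ∫ w, u i w ∂ν with ha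
  -- The deviation splits into the noise inside the sampled blocks and the error of averaging the
  -- means over a random set; the second part carries the factor 1/I.
  have hd : ∀ i, MemLp (fun w => u i w - a i) 2 ν := fun i => (hu i).sub (memLp_const _)
  have h1 := integral_norm_blockAvg_sq_le ν hI1 hI hd
  have h2 := integral_norm_blockAvg_sub_sq_le hI1 hI a
  have i1 := integrable_norm_sq (memLp_blockAvg ν hI hd)
  have i2 : Integrable (fun w : Finset (Fin m) × W => ‖(I : ℝ)⁻¹ • ∑ i ∈ w.1, a i
      - (m : ℝ)⁻¹ • ∑ i, a i‖ ^ 2) ((blockLaw m I).prod ν) := by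
    have : Integrable (fun S : Finset (Fin m) => ‖(I : ℝ)⁻¹ • ∑ i ∈ S, a i
      - (m : ℝ)⁻¹ • ∑ i, a i‖ ^ 2) (blockLaw m I) := Integrable.of_finite
    exact this.comp_fst ν
  have h2' : ∫ w : Finset (Fin m) × W, ‖(I : ℝ)⁻¹ • ∑ i ∈ w.1, a i
      - (m : ℝ)⁻¹ • ∑ i, a i‖ ^ 2 ∂((blockLaw m I).prod ν)
      = ∫ S, ‖(I : ℝ)⁻¹ • ∑ i ∈ S, a i - (m : ℝ)⁻¹ • ∑ i, a i‖ ^ 2 ∂(blockLaw m I) := by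
    rw [integral_prod _ i2]
    simp
  have hle : ∫ w : Finset (Fin m) × W, ‖(I : ℝ)⁻¹ • ∑ i ∈ w.1, u i w.2
        - (m : ℝ)⁻¹ • ∑ i, a i‖ ^ 2 ∂((blockLaw m I).prod ν)
      ≤ ∫ w : Finset (Fin m) × W, (2 * ‖(I : ℝ)⁻¹ • ∑ i ∈ w.1, (u i w.2 - a i)‖ ^ 2
        + 2 * ‖(I : ℝ)⁻¹ • ∑ i ∈ w.1, a i - (m : ℝ)⁻¹ • ∑ i, a i‖ ^ 2)
          ∂((blockLaw m I).prod ν) := by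
    refine integral_mono_of_nonneg (Filter.Eventually.of_forall fun w => by positivity)
      ((i1.const_mul 2).add (i2.const_mul 2)) (Filter.Eventually.of_forall fun w => ?_)
    have := norm_add_sq_le_two ((I : ℝ)⁻¹ • ∑ i ∈ w.1, (u i w.2 - a i))
      ((I : ℝ)⁻¹ • ∑ i ∈ w.1, a i - (m : ℝ)⁻¹ • ∑ i, a i)
    simp only [Finset.sum_sub_distrib, smul_sub] at this ⊢
    rwa [sub_add_sub_cancel] at this
  rw [integral_add (i1.const_mul 2) (i2.const_mul 2), integral_const_mul, integral_const_mul,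
    h2'] at hle
  have h3 : (m : ℝ)⁻¹ * ∑ i, ∫ w, ‖u i w - a i‖ ^ 2 ∂ν ≤ v := by
    rw [inv_mul_le_iff₀ hm0]
    calc _ ≤ ∑ _i : Fin m, v := Finset.sum_le_sum fun i _ => hv i
      _ = m * v := by simp
  have h4 : (m : ℝ)⁻¹ * ∑ i, ‖a i‖ ^ 2 ≤ c := by
    rw [inv_mul_le_iff₀ hm0]
    calc _ ≤ ∑ _i : Fin m, c := Finset.sum_le_sum fun i _ => hc i
      _ = m * c := by simp
  have h5 : (if I < m then 1 / (I : ℝ) else 0) * ((m : ℝ)⁻¹ * ∑ i, ‖a i‖ ^ 2)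
      ≤ (if I < m then 1 / (I : ℝ) else 0) * c := by
    gcongr
  linarith

end Product



/-! ### Operators bounded below -/

section Operators

variable {n : ℕ} {lam : ℝ}

lemma le_norm_apply_of_mem_geSet {X : Vec n →L[ℝ] Vec n} (hX : X ∈ geSet lam) (v : Vec n) :
    lam * ‖v‖ ≤ ‖X v‖ := by
  by_cases hv : ‖v‖ = 0
  · rw [hv]; simp
  have h0 : 0 < ‖v‖ := lt_of_le_of_ne (norm_nonneg v) (Ne.symm hv)
  have h1 := hX.2 v
  have h2 := real_inner_le_norm (X v) v
  nlinarith

lemma isInvertible_of_mem_geSet (hlam : 0 < lam) {X : Vec n →L[ℝ] Vec n} (hX : X ∈ geSet lam) :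
    X.IsInvertible := by
  have hinj : Function.Injective (X : Vec n →ₗ[ℝ] Vec n) := by
    rw [← LinearMap.ker_eq_bot, LinearMap.ker_eq_bot']
    intro v hv
    have h1 := le_norm_apply_of_mem_geSet hX v
    have h2 : X v = 0 := hv
    rw [h2, norm_zero] at h1
    have : ‖v‖ ≤ 0 := by nlinarith [norm_nonneg v]
    exact norm_le_zero_iff.1 this
  refine ⟨(LinearEquiv.ofInjectiveEndo (X : Vec n →ₗ[ℝ] Vec n) hinj).toContinuousLinearEquiv, ?_⟩
  ext v
  rfl

lemma apply_inverse_of_mem_geSet (hlam : 0 < lam) {X : Vec n →L[ℝ] Vec n} (hX : X ∈ geSet lam)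
    (v : Vec n) : X (X.inverse v) = v := by
  obtain ⟨e, rfl⟩ := isInvertible_of_mem_geSet hlam hX
  simp [ContinuousLinearMap.inverse_equiv]

lemma inverse_apply_of_mem_geSet (hlam : 0 < lam) {X : Vec n →L[ℝ] Vec n} (hX : X ∈ geSet lam)
    (v : Vec n) : X.inverse (X v) = v := by
  obtain ⟨e, rfl⟩ := isInvertible_of_mem_geSet hlam hX
  simp [ContinuousLinearMap.inverse_equiv]

lemma norm_inverse_apply_le (hlam : 0 < lam) {X : Vec n →L[ℝ] Vec n} (hX : X ∈ geSet lam)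
    (v : Vec n) : ‖X.inverse v‖ ≤ lam⁻¹ * ‖v‖ := by
  have h := le_norm_apply_of_mem_geSet hX (X.inverse v)
  rw [apply_inverse_of_mem_geSet hlam hX] at h
  rw [← div_eq_inv_mul, le_div_iff₀ hlam]
  linarith

/-- The resolvent identity X⁻¹ - Y⁻¹ = X⁻¹(Y - X)Y⁻¹. -/
lemma norm_inverse_sub_inverse_apply_le (hlam : 0 < lam) {X Y : Vec n →L[ℝ] Vec n}
    (hX : X ∈ geSet lam) (hY : Y ∈ geSet lam) (v : Vec n) :
    ‖X.inverse v - Y.inverse v‖ ≤ lam⁻¹ * lam⁻¹ * ‖X - Y‖ * ‖v‖ := by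
  have e : X.inverse v - Y.inverse v = X.inverse ((Y - X) (Y.inverse v)) := by
    rw [sub_apply, map_sub, apply_inverse_of_mem_geSet hlam hY, inverse_apply_of_mem_geSet hlam hX]
  rw [e]
  have hl : 0 ≤ lam⁻¹ := by positivity
  calc _ ≤ lam⁻¹ * ‖(Y - X) (Y.inverse v)‖ := norm_inverse_apply_le hlam hX _
    _ ≤ lam⁻¹ * (‖Y - X‖ * (lam⁻¹ * ‖v‖)) := by
        gcongr
        exact ((Y - X).le_opNorm _).trans (by gcongr; exact norm_inverse_apply_le hlam hY v)
    _ = _ := by rw [norm_sub_rev]; ring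

/-- The inverse is continuous on the open set of units and is 0 by convention elsewhere. -/
lemma measurable_inverse : Measurable fun X : Vec n →L[ℝ] Vec n => X.inverse := by
  classical
  have hU : IsOpen {X : Vec n →L[ℝ] Vec n | IsUnit X} := Units.isOpen
  have e : (fun X : Vec n →L[ℝ] Vec n => X.inverse) = Ring.inverse := by
    ext1 X
    rw [ContinuousLinearMap.ringInverse_eq_inverse]
  rw [e]
  have h : (Ring.inverse : (Vec n →L[ℝ] Vec n) → (Vec n →L[ℝ] Vec n))
      = Set.piecewise {X | IsUnit X} Ring.inverse 0 := by
    ext1 X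
    by_cases hX : IsUnit X
    · rw [Set.piecewise_eq_of_mem _ _ _ (show X ∈ {X | IsUnit X} from hX)]
    · rw [Set.piecewise_eq_of_notMem _ _ _ (show X ∉ {X | IsUnit X} from hX),
        Ring.inverse_non_unit X hX]
      rfl
  rw [h]
  refine ContinuousOn.measurable_piecewise ?_ continuousOn_const hU.measurableSet
  rintro X ⟨u, rfl⟩
  exact (NormedRing.inverse_continuousAt u).continuousWithinAt

end Operators

/-! ### The Frobenius norm and the projection -/

section Frobenius

variable {n : ℕ} {lam : ℝ}

/-- The entries of a matrix, as a vector whose Euclidean norm is the Frobenius norm. -/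
noncomputable def entries (n : ℕ) : (Vec n →L[ℝ] Vec n) →ₗ[ℝ] EuclideanSpace ℝ (Fin n × Fin n) where
  toFun X := WithLp.toLp 2 fun k => X (EuclideanSpace.single k.1 1) k.2
  map_add' X Y := by ext; simp
  map_smul' c X := by ext; simp

lemma norm_entries_sq (X : Vec n →L[ℝ] Vec n) : ‖entries n X‖ ^ 2 = frobSq X := by
  rw [EuclideanSpace.norm_sq_eq, Fintype.sum_prod_type]
  simp_rw [frobSq, EuclideanSpace.norm_sq_eq]
  rfl

lemma frobSq_nonneg (X : Vec n →L[ℝ] Vec n) : 0 ≤ frobSq X := by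
  unfold frobSq
  positivity

lemma apply_eq_sum_single {V : Type*} [NormedAddCommGroup V] [NormedSpace ℝ V]
    (X : Vec n →L[ℝ] V) (v : Vec n) : X v = ∑ k, v k • X (EuclideanSpace.single k 1) := by
  have h : v = ∑ k, v k • (EuclideanSpace.single k (1 : ℝ) : Vec n) := by
    ext j
    simp [Finset.sum_apply, Pi.single_apply]
  conv_lhs => rw [h, map_sum]
  simp

/-- The operator norm is at most the Frobenius norm. -/
lemma norm_sq_le_sum_single {V : Type*} [NormedAddCommGroup V] [NormedSpace ℝ V]
    (X : Vec n →L[ℝ] V) : ‖X‖ ^ 2 ≤ ∑ k, ‖X (EuclideanSpace.single k 1)‖ ^ 2 := by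
  have h : ‖X‖ ≤ √(∑ k, ‖X (EuclideanSpace.single k 1)‖ ^ 2) := by
    refine X.opNorm_le_bound (Real.sqrt_nonneg _) fun v => ?_
    rw [apply_eq_sum_single X v, EuclideanSpace.norm_eq, ← Real.sqrt_mul (by positivity)]
    refine (norm_sum_le _ _).trans (Real.le_sqrt_of_sq_le ?_)
    simp_rw [norm_smul]
    rw [mul_comm]
    exact Finset.sum_mul_sq_le_sq_mul_sq _ _ _
  calc ‖X‖ ^ 2 ≤ (√(∑ k, ‖X (EuclideanSpace.single k 1)‖ ^ 2)) ^ 2 := by gcongr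
    _ = _ := Real.sq_sqrt (by positivity)

lemma norm_sq_le_frobSq (X : Vec n →L[ℝ] Vec n) : ‖X‖ ^ 2 ≤ frobSq X := norm_sq_le_sum_single X

lemma frobSq_le {D : ℕ} (hn : n ≤ D) (X : Vec n →L[ℝ] Vec n) : frobSq X ≤ D * ‖X‖ ^ 2 := by
  have hD : (n : ℝ) ≤ D := by exact_mod_cast hn
  calc frobSq X ≤ ∑ _k : Fin n, ‖X‖ ^ 2 := by
        refine Finset.sum_le_sum fun k _ => ?_
        have := X.le_opNorm (EuclideanSpace.single k 1)
        rw [PiLp.norm_single, norm_one, mul_one] at this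
        gcongr
    _ = n * ‖X‖ ^ 2 := by simp
    _ ≤ _ := by gcongr

lemma injective_entries : Function.Injective (entries n) := by
  rw [← LinearMap.ker_eq_bot, LinearMap.ker_eq_bot']
  intro X hX
  have h := norm_entries_sq X
  rw [hX, norm_zero] at h
  have h2 := norm_sq_le_frobSq X
  have : ‖X‖ ^ 2 = 0 := le_antisymm (by linarith [h]) (by positivity)
  exact norm_eq_zero.1 (pow_eq_zero_iff (by norm_num) |>.1 this)

lemma smul_one_mem_geSet (lam : ℝ) : lam • ContinuousLinearMap.id ℝ (Vec n) ∈ geSet lam := by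
  refine ⟨?_, fun v => ?_⟩
  · exact (IsSelfAdjoint.all lam).smul (IsSelfAdjoint.one _)
  · simp [inner_smul_left]

lemma convex_geSet : Convex ℝ (geSet lam : Set (Vec n →L[ℝ] Vec n)) := by
  intro X hX Y hY a b ha hb hab
  refine ⟨?_, fun v => ?_⟩
  · rw [ContinuousLinearMap.isSelfAdjoint_iff']
    simp [ContinuousLinearMap.isSelfAdjoint_iff'.1 hX.1,
      ContinuousLinearMap.isSelfAdjoint_iff'.1 hY.1]
  have h1 := mul_le_mul_of_nonneg_left (hX.2 v) ha
  have h2 := mul_le_mul_of_nonneg_left (hY.2 v) hb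
  simp only [add_apply, smul_apply, inner_add_left, inner_smul_left, conj_trivial]
  have : lam * ‖v‖ ^ 2 = a * (lam * ‖v‖ ^ 2) + b * (lam * ‖v‖ ^ 2) := by
    rw [← add_mul, hab, one_mul]
  linarith

lemma isClosed_geSet : IsClosed (geSet lam : Set (Vec n →L[ℝ] Vec n)) := by
  have h1 : IsClosed {X : Vec n →L[ℝ] Vec n | IsSelfAdjoint X} :=
    by
    simp_rw [ContinuousLinearMap.isSelfAdjoint_iff']
    exact isClosed_eq (LinearIsometryEquiv.continuous _) continuous_id
  have h2 : IsClosed {X : Vec n →L[ℝ] Vec n | ∀ v, lam * ‖v‖ ^ 2 ≤ inner ℝ (X v) v} := by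
    rw [Set.ofPred_forall]
    exact isClosed_iInter fun v => isClosed_le continuous_const (by fun_prop)
  exact h1.inter h2

/-- Through `entries` the set becomes a closed convex subset of a Euclidean space, where the Hilbert
projection theorem also supplies the variational inequality. -/
lemma exists_isProj (lam : ℝ) (X : Vec n →L[ℝ] Vec n) : ∃ P, P ∈ geSet lam ∧
    ∀ Q ∈ geSet lam, inner ℝ (entries n X - entries n P) (entries n Q - entries n P) ≤ 0 := by
  set s : Set (EuclideanSpace ℝ (Fin n × Fin n)) := entries n '' geSet lam with hs
  have hne : s.Nonempty := ⟨_, _, smul_one_mem_geSet lam, rfl⟩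
  have hcl : IsClosed s :=
    (LinearMap.isClosedEmbedding_of_injective (LinearMap.ker_eq_bot.2 injective_entries)).isClosedMap
      _ isClosed_geSet
  have hcv : Convex ℝ s := convex_geSet.linear_image _
  obtain ⟨v, hv, hv2⟩ := exists_norm_eq_iInf_of_complete_convex hne (IsClosed.isComplete hcl) hcv (entries n X)
  obtain ⟨P, hP, rfl⟩ := hv
  refine ⟨P, hP, fun Q hQ => ?_⟩
  exact (norm_eq_iInf_iff_real_inner_le_zero hcv ⟨P, hP, rfl⟩).1 hv2 _ ⟨Q, hQ, rfl⟩

lemma frobSq_sub_eq (X P Q : Vec n →L[ℝ] Vec n) :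
    frobSq (X - Q) = frobSq (X - P) + frobSq (Q - P)
      - 2 * inner ℝ (entries n X - entries n P) (entries n Q - entries n P) := by
  rw [← norm_entries_sq, ← norm_entries_sq, ← norm_entries_sq, map_sub, map_sub, map_sub]
  have e : entries n X - entries n Q
      = (entries n X - entries n P) - (entries n Q - entries n P) := by abel
  rw [e, norm_sub_sq_real]
  ring

lemma isProj_proj (lam : ℝ) (X : Vec n →L[ℝ] Vec n) : IsProj lam X (proj lam X) := by
  refine Classical.epsilon_spec (p := IsProj lam X) ?_
  obtain ⟨P, hP, h⟩ := exists_isProj lam X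
  refine ⟨P, hP, fun Q hQ => ?_⟩
  rw [frobSq_sub_eq X P Q]
  linarith [h Q hQ, frobSq_nonneg (Q - P)]

lemma proj_mem_geSet (lam : ℝ) (X : Vec n →L[ℝ] Vec n) : proj lam X ∈ geSet lam :=
  (isProj_proj lam X).1

/-- The variational inequality of the projection. -/
lemma inner_entries_sub_proj_le (lam : ℝ) (X : Vec n →L[ℝ] Vec n) {Q : Vec n →L[ℝ] Vec n}
    (hQ : Q ∈ geSet lam) :
    inner ℝ (entries n X - entries n (proj lam X)) (entries n Q - entries n (proj lam X)) ≤ 0 := by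
  obtain ⟨P, hP, h⟩ := exists_isProj lam X
  -- So far `proj` is just some minimiser. Comparing distances through `frobSq_sub_eq` identifies it
  -- with the point satisfying the variational inequality.
  have h1 := (isProj_proj lam X).2 P hP
  have h2 := frobSq_sub_eq X P (proj lam X)
  have h3 := h _ (proj_mem_geSet lam X)
  have h4 : frobSq (proj lam X - P) ≤ 0 := by linarith
  have h5 : proj lam X = P := by
    have h6 := norm_sq_le_frobSq (proj lam X - P)
    have : ‖proj lam X - P‖ ^ 2 = 0 := le_antisymm (by linarith) (by positivity)
    exact sub_eq_zero.1 (norm_eq_zero.1 (pow_eq_zero_iff (by norm_num) |>.1 this))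
  rw [h5]
  exact h Q hQ

/-- At the projection the angle between X and any point of the set is obtuse. The true Hessian lies
in the set, so projecting never increases the error of an estimator H. -/
lemma frobSq_proj_sub_le (lam : ℝ) (X : Vec n →L[ℝ] Vec n) {Q : Vec n →L[ℝ] Vec n}
    (hQ : Q ∈ geSet lam) : frobSq (proj lam X - Q) ≤ frobSq (X - Q) := by
  have h1 := frobSq_sub_eq X (proj lam X) Q
  have h2 := inner_entries_sub_proj_le lam X hQ
  have h3 : frobSq (proj lam X - Q) = frobSq (Q - proj lam X) := by
    rw [← norm_entries_sq, ← norm_entries_sq, map_sub, map_sub, norm_sub_rev]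
  linarith [frobSq_nonneg (X - proj lam X)]

/-- Adding the two variational inequalities shows that the projection is nonexpansive. This gives
its continuity, hence the measurability of the run. -/
lemma norm_entries_proj_sub_le (lam : ℝ) (X Y : Vec n →L[ℝ] Vec n) :
    ‖entries n (proj lam X) - entries n (proj lam Y)‖ ≤ ‖entries n X - entries n Y‖ := by
  have h1 := inner_entries_sub_proj_le lam X (proj_mem_geSet lam Y)
  have h2 := inner_entries_sub_proj_le lam Y (proj_mem_geSet lam X)
  set a := entries n X
  set b := entries n Y
  set p := entries n (proj lam X)
  set q := entries n (proj lam Y)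
  have e : ‖p - q‖ ^ 2 = inner ℝ (a - p) (q - p) + inner ℝ (b - q) (p - q)
      + inner ℝ (a - b) (p - q) := by
    rw [← real_inner_self_eq_norm_sq]
    simp only [inner_sub_left, inner_sub_right]
    ring
  have h3 := real_inner_le_norm (a - b) (p - q)
  by_contra hlt
  push Not at hlt
  nlinarith [norm_nonneg (a - b), norm_nonneg (p - q)]

lemma continuous_proj (lam : ℝ) : Continuous (proj lam : (Vec n →L[ℝ] Vec n) → _) := by
  have hemb := LinearMap.isClosedEmbedding_of_injective
    (LinearMap.ker_eq_bot.2 (injective_entries (n := n)))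
  rw [hemb.isInducing.continuous_iff, continuous_iff_continuousAt]
  intro X
  have hc : Continuous (entries n) := hemb.continuous
  rw [ContinuousAt, tendsto_iff_norm_sub_tendsto_zero]
  refine squeeze_zero (fun _ => norm_nonneg _) (fun Y => norm_entries_proj_sub_le lam Y X) ?_
  exact tendsto_iff_norm_sub_tendsto_zero.1 (hc.tendsto X)

end Frobenius



/-! ### Differentiation under the integral sign -/

section Differentiation

variable {S : Type*} [MeasurableSpace S] {E V : Type*} [NormedAddCommGroup E] [NormedSpace ℝ E]
  [NormedAddCommGroup V] [NormedSpace ℝ V]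

/-- A stochastic gradient need not be bounded, but its oscillation over a unit ball is; so ‖h' e₀‖ +
C is an integrable dominating function. -/
lemma hasFDerivAt_integral_of_bounded_oscillation {P : Measure S} [IsFiniteMeasure P]
    {h : E → S → V} {h' : E → S → E →L[ℝ] V} {e₀ : E} {C : ℝ} (hi : ∀ e, Integrable (h e) P)
    (hi' : Integrable (h' e₀) P)
    (hC : ∀ s, ∀ e ∈ Metric.ball e₀ 1, ‖h' e s - h' e₀ s‖ ≤ C)
    (hd : ∀ s e, HasFDerivAt (fun e => h e s) (h' e s) e) :
    HasFDerivAt (fun e => ∫ s, h e s ∂P) (∫ s, h' e₀ s ∂P) e₀ := by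
  refine hasFDerivAt_integral_of_dominated_of_fderiv_le (bound := fun s => ‖h' e₀ s‖ + C)
    (Metric.ball_mem_nhds e₀ one_pos) (Filter.Eventually.of_forall fun e => (hi e).1) (hi e₀) hi'.1
    (Filter.Eventually.of_forall fun s e he => ?_) (hi'.norm.add (integrable_const C))
    (Filter.Eventually.of_forall fun s e _ => hd s e)
  have := norm_add_le (h' e₀ s) (h' e s - h' e₀ s)
  rw [add_sub_cancel] at this
  linarith [hC s e he]

/-- At a fixed point the directional derivative is a limit of difference quotients, each measurable
in the sample. -/
lemma measurable_fderiv_apply_of_measurable [MeasurableSpace V] [BorelSpace V]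
    [SecondCountableTopology V] {h : E → S → V} (hm : ∀ e, Measurable (h e)) {e : E}
    (hd : ∀ s, DifferentiableAt ℝ (fun e => h e s) e) (v : E) :
    Measurable fun s => fderiv ℝ (fun e => h e s) e v := by
  have hlim : ∀ s, Filter.Tendsto
      (fun k : ℕ => (k : ℝ) • (h (e + (k : ℝ)⁻¹ • v) s - h e s)) Filter.atTop
      (nhds (fderiv ℝ (fun e => h e s) e v)) := fun s =>
    (hd s).hasFDerivAt.lim v (c := fun k : ℕ => (k : ℝ))
      (by simpa using tendsto_natCast_atTop_atTop (R := ℝ))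
  refine measurable_of_tendsto_metrizable (f := fun (k : ℕ) s =>
    (k : ℝ) • (h (e + (k : ℝ)⁻¹ • v) s - h e s)) (fun k => ?_) (tendsto_pi_nhds.2 hlim)
  exact ((hm _).sub (hm _)).const_smul _

/-- A matrix is a finite continuous combination of its columns. -/
lemma measurable_of_measurable_apply {n : ℕ} [MeasurableSpace V] [BorelSpace V]
    [SecondCountableTopology V] [FiniteDimensional ℝ V] {A : S → Vec n →L[ℝ] V}
    (h : ∀ v, Measurable fun s => A s v) : Measurable A := by
  have e : A = fun s => ∑ k, ContinuousLinearMap.smulRightL ℝ (Vec n) V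
      (EuclideanSpace.proj k) (A s (EuclideanSpace.single k 1)) := by
    ext1 s
    ext v
    rw [apply_eq_sum_single (A s) v]
    simp
  rw [e]
  exact Finset.measurable_sum _ fun k _ =>
    (ContinuousLinearMap.continuous _).measurable.comp (h _)

lemma measurable_gradient_of_measurable {n : ℕ} {h : Vec n → S → ℝ} (hm : ∀ e, Measurable (h e))
    {e : Vec n} (hd : ∀ s, DifferentiableAt ℝ (fun e => h e s) e) :
    Measurable fun s => gradient (fun e => h e s) e := by
  have h1 : Measurable fun s => fderiv ℝ (fun e => h e s) e :=
    measurable_of_measurable_apply fun v => measurable_fderiv_apply_of_measurable hm hd v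
  exact (InnerProductSpace.toDual ℝ (Vec n)).symm.continuous.measurable.comp h1

/-- The total derivative of a function of two variables. -/
lemma hasFDerivAt_prod_of_differentiableAt {E₁ E₂ : Type*} [NormedAddCommGroup E₁]
    [NormedSpace ℝ E₁] [NormedAddCommGroup E₂] [NormedSpace ℝ E₂] {h : E₁ × E₂ → V} {w : E₁ × E₂}
    (hd : DifferentiableAt ℝ h w) :
    HasFDerivAt h ((fderiv ℝ (fun x => h (x, w.2)) w.1).comp (ContinuousLinearMap.fst ℝ E₁ E₂)
      + (fderiv ℝ (fun y => h (w.1, y)) w.2).comp (ContinuousLinearMap.snd ℝ E₁ E₂)) w := by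
  have h1 : HasFDerivAt (fun x => h (x, w.2)) ((fderiv ℝ h w).comp
      (ContinuousLinearMap.inl ℝ E₁ E₂)) w.1 :=
    HasFDerivAt.comp (g := h) w.1 hd.hasFDerivAt (hasFDerivAt_prodMk_left w.1 w.2)
  have h2 : HasFDerivAt (fun y => h (w.1, y)) ((fderiv ℝ h w).comp
      (ContinuousLinearMap.inr ℝ E₁ E₂)) w.2 :=
    HasFDerivAt.comp (g := h) w.2 hd.hasFDerivAt (hasFDerivAt_prodMk_right w.1 w.2)
  rw [h1.fderiv, h2.fderiv]
  convert hd.hasFDerivAt using 1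
  ext v <;> simp <;> exact map_zero (fderiv ℝ h w)

lemma memLp_two_of_lintegral_sub_le {P : Measure S} [IsFiniteMeasure P] {φ : S → V} {c : V}
    {σ : ℝ} (hm : AEStronglyMeasurable φ P)
    (h : ∫⁻ s, ‖φ s - c‖ₑ ^ 2 ∂P ≤ ENNReal.ofReal (σ ^ 2)) : MemLp φ 2 P := by
  have h1 : MemLp (fun s => φ s - c) 2 P := by
    refine ⟨hm.sub aestronglyMeasurable_const, ?_⟩
    rw [eLpNorm_lt_top_iff_lintegral_rpow_enorm_lt_top (by norm_num) (by norm_num)]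
    refine lt_of_le_of_lt ?_ (lt_of_le_of_lt h ENNReal.ofReal_lt_top)
    simp
  have h2 := h1.add (memLp_const c)
  convert h2 using 1
  ext s
  simp

lemma integral_norm_sub_sq_le_of_lintegral {P : Measure S} [IsFiniteMeasure P] {φ : S → V} {c : V}
    {σ : ℝ} (hm : AEStronglyMeasurable φ P)
    (h : ∫⁻ s, ‖φ s - c‖ₑ ^ 2 ∂P ≤ ENNReal.ofReal (σ ^ 2)) :
    ∫ s, ‖φ s - c‖ ^ 2 ∂P ≤ σ ^ 2 := by
  have hm2 : AEStronglyMeasurable (fun s => ‖φ s - c‖ ^ 2) P :=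
    (hm.sub aestronglyMeasurable_const).norm.pow 2
  rw [integral_eq_lintegral_of_nonneg_ae (Filter.Eventually.of_forall fun s => by positivity) hm2]
  refine ENNReal.toReal_le_of_le_ofReal (by positivity) (le_trans (le_of_eq ?_) h)
  refine lintegral_congr fun s => ?_
  rw [ENNReal.ofReal_pow (norm_nonneg _), ofReal_norm]

end Differentiation

/-! ### Lipschitz functions of two vector variables -/

section Lipschitz

variable {p q : ℕ} {V : Type*} [NormedAddCommGroup V] {L : ℝ} {h : Vec p → Vec q → V}

lemma LipschitzXY.norm_sub_sq_le (H : LipschitzXY L h) (x : Vec p) (y : Vec q) (x' : Vec p)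
    (y' : Vec q) :
    ‖h x y - h x' y'‖ ^ 2 ≤ L ^ 2 * (‖x - x'‖ ^ 2 + ‖y - y'‖ ^ 2) := by
  calc ‖h x y - h x' y'‖ ^ 2 ≤ (L * √(‖x - x'‖ ^ 2 + ‖y - y'‖ ^ 2)) ^ 2 := by
        gcongr
        exact H x y x' y'
    _ = _ := by rw [mul_pow, Real.sq_sqrt (by positivity)]

lemma LipschitzXY.norm_sub_le_left (H : LipschitzXY L h) (x x' : Vec p) (y : Vec q) :
    ‖h x y - h x' y‖ ≤ L * ‖x - x'‖ := by
  simpa using H x y x' y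

lemma LipschitzXY.norm_sub_le_right (H : LipschitzXY L h) (x : Vec p) (y y' : Vec q) :
    ‖h x y - h x y'‖ ≤ L * ‖y - y'‖ := by
  simpa using H x y x y'

/-- The product space carries the sup norm, so each component moves by less than 1; the Euclidean
bound √2 is rounded up to 2. -/
lemma LipschitzXY.norm_sub_le_ball (H : LipschitzXY L h) (hL : 0 ≤ L) {w w' : Vec p × Vec q}
    (hw : w ∈ Metric.ball w' 1) : ‖h w.1 w.2 - h w'.1 w'.2‖ ≤ L * 2 := by
  refine (H _ _ _ _).trans ?_
  gcongr
  rw [Metric.mem_ball, dist_eq_norm, Prod.norm_def, max_lt_iff] at hw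
  refine Real.sqrt_le_iff.2 ⟨by norm_num, ?_⟩
  have h1 := hw.1
  have h2 := hw.2
  simp only [Prod.fst_sub, Prod.snd_sub] at h1 h2
  nlinarith [norm_nonneg (w.1 - w'.1), norm_nonneg (w.2 - w'.2)]

lemma LipschitzXY.continuous (H : LipschitzXY L h) :
    Continuous fun w : Vec p × Vec q => h w.1 w.2 := by
  rw [continuous_iff_continuousAt]
  intro w
  rw [ContinuousAt, tendsto_iff_norm_sub_tendsto_zero]
  refine squeeze_zero (fun _ => norm_nonneg _) (fun w' => H w'.1 w'.2 w.1 w.2) ?_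
  have : Continuous fun w' : Vec p × Vec q => L * √(‖w'.1 - w.1‖ ^ 2 + ‖w'.2 - w.2‖ ^ 2) := by
    fun_prop
  simpa using this.tendsto w

lemma LipschitzXY.integral [NormedSpace ℝ V] {S : Type*} [MeasurableSpace S]
    {P : Measure S} [IsProbabilityMeasure P] {h : Vec p → Vec q → S → V}
    (H : ∀ s, LipschitzXY L fun x y => h x y s) (hi : ∀ x y, Integrable (h x y) P) :
    LipschitzXY L fun x y => ∫ s, h x y s ∂P := by
  intro x y x' y'
  simp only
  rw [← integral_sub (hi x y) (hi x' y')]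
  have := norm_integral_le_of_norm_le_const (μ := P)
    (Filter.Eventually.of_forall fun s => H s x y x' y')
  simpa using this

end Lipschitz



noncomputable section

namespace Problem

variable {m dx : ℕ} {dy : Fin m → ℕ} {Ξ Z : Fin m → Type*}
  [∀ i, MeasurableSpace (Ξ i)] [∀ i, MeasurableSpace (Z i)]

/-- All assumptions on the problem. -/
structure Standing (p : Problem m dx dy Ξ Z) (K : Consts) (D : ℕ) : Prop where
  dim : ∀ i, dy i ≤ D
  reg : p.Regular
  low : p.LowerLevel K
  sto : p.Stochastic K

variable (p : Problem m dx dy Ξ Z)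

/-! ### The averaged derivatives -/

/-- `∇ₓ f_i(x, y)`. -/
abbrev fxBar (i : Fin m) (x : Vec dx) (y : Vec (dy i)) : Vec dx := gradX (p.fBar i) x y

/-- `∇_y f_i(x, y)`. -/
abbrev fyBar (i : Fin m) (x : Vec dx) (y : Vec (dy i)) : Vec (dy i) := gradY (p.fBar i) x y

/-- `∇_y g_i(x, y)`. -/
abbrev gyBar (i : Fin m) (x : Vec dx) (y : Vec (dy i)) : Vec (dy i) := gradY (p.gBar i) x y

/-- `∇²_{xy} g_i(x, y)`. -/
abbrev gxyBar (i : Fin m) (x : Vec dx) (y : Vec (dy i)) : Vec (dy i) →L[ℝ] Vec dx :=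
  jacXY (p.gBar i) x y

/-- `∇²_{yy} g_i(x, y)`. -/
abbrev gyyBar (i : Fin m) (x : Vec dx) (y : Vec (dy i)) : Vec (dy i) →L[ℝ] Vec (dy i) :=
  hessYY (p.gBar i) x y

variable {p} {K : Consts} {D : ℕ} (h : p.Standing K D)

namespace Standing

include h

lemma probP (i : Fin m) : IsProbabilityMeasure (p.P i) := h.reg.probP i

lemma probQ (i : Fin m) : IsProbabilityMeasure (p.Q i) := h.reg.probQ i

lemma f_diffX (i : Fin m) (x : Vec dx) (y : Vec (dy i)) (ξ : Ξ i) :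
    DifferentiableAt ℝ (fun x' => p.f i x' y ξ) x :=
  DifferentiableAt.comp (f := fun x' => (x', y)) (g := fun w => p.f i w.1 w.2 ξ) x
    (h.reg.f_diff i ξ (x, y)) (hasFDerivAt_prodMk_left x y).differentiableAt

lemma f_diffY (i : Fin m) (x : Vec dx) (y : Vec (dy i)) (ξ : Ξ i) :
    DifferentiableAt ℝ (fun y' => p.f i x y' ξ) y :=
  DifferentiableAt.comp (f := fun y' => (x, y')) (g := fun w => p.f i w.1 w.2 ξ) y
    (h.reg.f_diff i ξ (x, y)) (hasFDerivAt_prodMk_right x y).differentiableAt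

lemma gy_diffX (i : Fin m) (x : Vec dx) (y : Vec (dy i)) (ζ : Z i) :
    DifferentiableAt ℝ (fun x' => p.gy i x' y ζ) x :=
  DifferentiableAt.comp (f := fun x' => (x', y)) (g := fun w => p.gy i w.1 w.2 ζ) x
    (h.reg.gy_diff i ζ (x, y)) (hasFDerivAt_prodMk_left x y).differentiableAt

lemma gy_diffY (i : Fin m) (x : Vec dx) (y : Vec (dy i)) (ζ : Z i) :
    DifferentiableAt ℝ (fun y' => p.gy i x y' ζ) y :=
  DifferentiableAt.comp (f := fun y' => (x, y')) (g := fun w => p.gy i w.1 w.2 ζ) y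
    (h.reg.gy_diff i ζ (x, y)) (hasFDerivAt_prodMk_right x y).differentiableAt

/-! Measurability of the stochastic derivatives. -/

lemma fx_meas (i : Fin m) (x : Vec dx) (y : Vec (dy i)) : Measurable (p.fx i x y) :=
  measurable_gradient_of_measurable (fun x' => h.reg.f_meas i x' y) (h.f_diffX i x y)

lemma fy_meas (i : Fin m) (x : Vec dx) (y : Vec (dy i)) : Measurable (p.fy i x y) :=
  measurable_gradient_of_measurable (fun y' => h.reg.f_meas i x y') (h.f_diffY i x y)

lemma gy_meas (i : Fin m) (x : Vec dx) (y : Vec (dy i)) : Measurable (p.gy i x y) :=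
  measurable_gradient_of_measurable (fun y' => h.reg.g_meas i x y')
    fun ζ => h.reg.g_diff i x ζ y

lemma gyx_meas (i : Fin m) (x : Vec dx) (y : Vec (dy i)) :
    Measurable fun ζ => fderiv ℝ (fun x' => p.gy i x' y ζ) x :=
  measurable_of_measurable_apply fun v =>
    measurable_fderiv_apply_of_measurable (fun x' => h.gy_meas i x' y) (h.gy_diffX i x y) v

lemma gxy_meas (i : Fin m) (x : Vec dx) (y : Vec (dy i)) : Measurable (p.gxy i x y) :=
  (LinearIsometryEquiv.continuous ContinuousLinearMap.adjoint).measurable.comp (h.gyx_meas i x y)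

lemma gyy_meas (i : Fin m) (x : Vec dx) (y : Vec (dy i)) : Measurable (p.gyy i x y) :=
  measurable_of_measurable_apply fun v =>
    measurable_fderiv_apply_of_measurable (fun y' => h.gy_meas i x y') (h.gy_diffY i x y) v

/-! Square integrability and boundedness. -/

lemma fx_memLp (i : Fin m) (x : Vec dx) (y : Vec (dy i)) : MemLp (p.fx i x y) 2 (p.P i) :=
  have := h.probP i
  memLp_two_of_lintegral_sub_le (h.fx_meas i x y).aestronglyMeasurable (h.sto.fx_var i x y)

lemma fy_memLp (i : Fin m) (x : Vec dx) (y : Vec (dy i)) : MemLp (p.fy i x y) 2 (p.P i) :=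
  have := h.probP i
  memLp_two_of_lintegral_sub_le (h.fy_meas i x y).aestronglyMeasurable (h.sto.fy_var i x y)

lemma gy_memLp (i : Fin m) (x : Vec dx) (y : Vec (dy i)) : MemLp (p.gy i x y) 2 (p.Q i) :=
  have := h.probQ i
  memLp_two_of_lintegral_sub_le (h.gy_meas i x y).aestronglyMeasurable (h.sto.gy_var i x y)

/-- The derivative of a Lipschitz map is bounded by its constant. Thus the second derivatives of g
are bounded for every sample, which keeps their products with square-integrable vectors square
integrable. -/
lemma norm_gyx_le (i : Fin m) (x : Vec dx) (y : Vec (dy i)) (ζ : Z i) :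
    ‖fderiv ℝ (fun x' => p.gy i x' y ζ) x‖ ≤ K.Lgy :=
  (h.gy_diffX i x y ζ).hasFDerivAt.le_of_lip' K.Lgy_nonneg
    (Filter.Eventually.of_forall fun x' => (h.sto.gy_lip i ζ).norm_sub_le_left x' x y)

lemma norm_gxy_le (i : Fin m) (x : Vec dx) (y : Vec (dy i)) (ζ : Z i) :
    ‖p.gxy i x y ζ‖ ≤ K.Lgy := by
  rw [gxy, jacXY, LinearIsometryEquiv.norm_map]
  exact h.norm_gyx_le i x y ζ

lemma norm_gyy_le (i : Fin m) (x : Vec dx) (y : Vec (dy i)) (ζ : Z i) :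
    ‖p.gyy i x y ζ‖ ≤ K.Lgy :=
  (h.gy_diffY i x y ζ).hasFDerivAt.le_of_lip' K.Lgy_nonneg
    (Filter.Eventually.of_forall fun y' => (h.sto.gy_lip i ζ).norm_sub_le_right x y' y)

lemma gyx_int (i : Fin m) (x : Vec dx) (y : Vec (dy i)) :
    Integrable (fun ζ => fderiv ℝ (fun x' => p.gy i x' y ζ) x) (p.Q i) :=
  have := h.probQ i
  Integrable.of_bound (h.gyx_meas i x y).aestronglyMeasurable K.Lgy
    (Filter.Eventually.of_forall fun ζ => h.norm_gyx_le i x y ζ)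

lemma gxy_memLp (i : Fin m) (x : Vec dx) (y : Vec (dy i)) : MemLp (p.gxy i x y) 2 (p.Q i) :=
  have := h.probQ i
  MemLp.of_bound (h.gxy_meas i x y).aestronglyMeasurable K.Lgy
    (Filter.Eventually.of_forall fun ζ => h.norm_gxy_le i x y ζ)

lemma gyy_memLp (i : Fin m) (x : Vec dx) (y : Vec (dy i)) : MemLp (p.gyy i x y) 2 (p.Q i) :=
  have := h.probQ i
  MemLp.of_bound (h.gyy_meas i x y).aestronglyMeasurable K.Lgy
    (Filter.Eventually.of_forall fun ζ => h.norm_gyy_le i x y ζ)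

lemma fx_int (i : Fin m) (x : Vec dx) (y : Vec (dy i)) : Integrable (p.fx i x y) (p.P i) :=
  have := h.probP i
  (h.fx_memLp i x y).integrable (by norm_num)

lemma fy_int (i : Fin m) (x : Vec dx) (y : Vec (dy i)) : Integrable (p.fy i x y) (p.P i) :=
  have := h.probP i
  (h.fy_memLp i x y).integrable (by norm_num)

lemma gy_int (i : Fin m) (x : Vec dx) (y : Vec (dy i)) : Integrable (p.gy i x y) (p.Q i) :=
  have := h.probQ i
  (h.gy_memLp i x y).integrable (by norm_num)

lemma gxy_int (i : Fin m) (x : Vec dx) (y : Vec (dy i)) : Integrable (p.gxy i x y) (p.Q i) :=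
  have := h.probQ i
  (h.gxy_memLp i x y).integrable (by norm_num)

lemma gyy_int (i : Fin m) (x : Vec dx) (y : Vec (dy i)) : Integrable (p.gyy i x y) (p.Q i) :=
  have := h.probQ i
  (h.gyy_memLp i x y).integrable (by norm_num)

/-! The expectations of the stochastic derivatives are the derivatives of the expectations. -/

lemma hasFDerivAt_f (i : Fin m) (ξ : Ξ i) (w : Vec dx × Vec (dy i)) :
    HasFDerivAt (fun w : Vec dx × Vec (dy i) => p.f i w.1 w.2 ξ)
      ((innerSL ℝ (p.fx i w.1 w.2 ξ)).comp (ContinuousLinearMap.fst ℝ _ _)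
        + (innerSL ℝ (p.fy i w.1 w.2 ξ)).comp (ContinuousLinearMap.snd ℝ _ _)) w := by
  refine (hasFDerivAt_prod_of_differentiableAt (h.reg.f_diff i ξ w)).congr_fderiv ?_
  dsimp only
  rw [(h.f_diffX i w.1 w.2 ξ).hasGradientAt.hasFDerivAt.fderiv,
    (h.f_diffY i w.1 w.2 ξ).hasGradientAt.hasFDerivAt.fderiv]
  rfl

/-- Differentiation under the integral: the Lipschitz constants of ∇ₓf and ∇_y f bound the
oscillation near w. The derivative is written through the linear maps A and B so that the integral
passes through them. -/
lemma hasFDerivAt_fBar_aux (i : Fin m) (w : Vec dx × Vec (dy i)) :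
    HasFDerivAt (fun w : Vec dx × Vec (dy i) => p.fBar i w.1 w.2)
      ((innerSL ℝ (∫ ξ, p.fx i w.1 w.2 ξ ∂(p.P i))).comp (ContinuousLinearMap.fst ℝ _ _)
        + (innerSL ℝ (∫ ξ, p.fy i w.1 w.2 ξ ∂(p.P i))).comp (ContinuousLinearMap.snd ℝ _ _)) w := by
  have := h.probP i
  let A : Vec dx →L[ℝ] (Vec dx × Vec (dy i) →L[ℝ] ℝ) :=
    ((ContinuousLinearMap.compL ℝ (Vec dx × Vec (dy i)) (Vec dx) ℝ).flip
      (ContinuousLinearMap.fst ℝ _ _)).comp (innerSL ℝ)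
  let B : Vec (dy i) →L[ℝ] (Vec dx × Vec (dy i) →L[ℝ] ℝ) :=
    ((ContinuousLinearMap.compL ℝ (Vec dx × Vec (dy i)) (Vec (dy i)) ℝ).flip
      (ContinuousLinearMap.snd ℝ _ _)).comp (innerSL ℝ)
  have hA := A.integrable_comp (h.fx_int i w.1 w.2)
  have hB := B.integrable_comp (h.fy_int i w.1 w.2)
  have key := hasFDerivAt_integral_of_bounded_oscillation (P := p.P i) (e₀ := w)
    (h := fun w ξ => p.f i w.1 w.2 ξ)
    (h' := fun w ξ => A (p.fx i w.1 w.2 ξ) + B (p.fy i w.1 w.2 ξ))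
    (C := ‖A‖ * (K.Lfx * 2) + ‖B‖ * (K.Lfy * 2)) (fun w => h.reg.f_int i w.1 w.2) (hA.add hB)
    (fun ξ w' hw' => ?_) (fun ξ w => h.hasFDerivAt_f i ξ w)
  · rw [integral_add hA hB, A.integral_comp_comm (h.fx_int i w.1 w.2),
      B.integral_comp_comm (h.fy_int i w.1 w.2)] at key
    exact key
  · rw [add_sub_add_comm, ← map_sub, ← map_sub]
    refine (norm_add_le _ _).trans (add_le_add ((A.le_opNorm _).trans ?_)
      ((B.le_opNorm _).trans ?_))
    · gcongr
      exact (h.sto.fx_lip i ξ).norm_sub_le_ball K.Lfx_nonneg hw'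
    · gcongr
      exact (h.sto.fy_lip i ξ).norm_sub_le_ball K.Lfy_nonneg hw'

lemma integral_fx (i : Fin m) (x : Vec dx) (y : Vec (dy i)) :
    ∫ ξ, p.fx i x y ξ ∂(p.P i) = p.fxBar i x y := by
  have h1 := HasFDerivAt.comp (g := fun w : Vec dx × Vec (dy i) => p.fBar i w.1 w.2)
    (f := fun x' => (x', y)) x
    (h.hasFDerivAt_fBar_aux i (x, y)) (hasFDerivAt_prodMk_left x y)
  have h2 : HasGradientAt (fun x' => p.fBar i x' y) (∫ ξ, p.fx i x y ξ ∂(p.P i)) x := by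
    rw [hasGradientAt_iff_hasFDerivAt]
    refine h1.congr_fderiv ?_
    ext v
    simp
  exact h2.gradient.symm

lemma integral_fy (i : Fin m) (x : Vec dx) (y : Vec (dy i)) :
    ∫ ξ, p.fy i x y ξ ∂(p.P i) = p.fyBar i x y := by
  have h1 := HasFDerivAt.comp (g := fun w : Vec dx × Vec (dy i) => p.fBar i w.1 w.2)
    (f := fun y' => (x, y')) y
    (h.hasFDerivAt_fBar_aux i (x, y)) (hasFDerivAt_prodMk_right x y)
  have h2 : HasGradientAt (fun y' => p.fBar i x y') (∫ ξ, p.fy i x y ξ ∂(p.P i)) y := by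
    rw [hasGradientAt_iff_hasFDerivAt]
    refine h1.congr_fderiv ?_
    ext v
    simp
  exact h2.gradient.symm

lemma hasFDerivAt_fBar (i : Fin m) (w : Vec dx × Vec (dy i)) :
    HasFDerivAt (fun w : Vec dx × Vec (dy i) => p.fBar i w.1 w.2)
      ((innerSL ℝ (p.fxBar i w.1 w.2)).comp (ContinuousLinearMap.fst ℝ _ _)
        + (innerSL ℝ (p.fyBar i w.1 w.2)).comp (ContinuousLinearMap.snd ℝ _ _)) w := by
  rw [← h.integral_fx, ← h.integral_fy]
  exact h.hasFDerivAt_fBar_aux i w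

/-- Only the y-derivative is taken, since g itself is not assumed differentiable in x. -/
lemma hasGradientAt_gBar (i : Fin m) (x : Vec dx) (y : Vec (dy i)) :
    HasGradientAt (p.gBar i x) (∫ ζ, p.gy i x y ζ ∂(p.Q i)) y := by
  have := h.probQ i
  have hint := (innerSL ℝ (E := Vec (dy i))).integrable_comp (h.gy_int i x y)
  rw [hasGradientAt_iff_hasFDerivAt]
  have key := hasFDerivAt_integral_of_bounded_oscillation (P := p.Q i) (e₀ := y)
    (h := fun y ζ => p.g i x y ζ)
    (h' := fun y ζ => innerSL ℝ (p.gy i x y ζ))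
    (C := K.Lgy * 2) (fun y => h.reg.g_int i x y) hint (fun ζ y' hy' => ?_)
    (fun ζ y => ((h.reg.g_diff i x ζ y).hasGradientAt).hasFDerivAt)
  · rw [(innerSL ℝ).integral_comp_comm (h.gy_int i x y)] at key
    exact key
  · rw [← map_sub, innerSL_apply_norm]
    refine ((h.sto.gy_lip i ζ).norm_sub_le_right x y' y).trans ?_
    have := K.Lgy_nonneg
    rw [Metric.mem_ball, dist_eq_norm] at hy'
    gcongr
    linarith

lemma integral_gy (i : Fin m) (x : Vec dx) (y : Vec (dy i)) :
    ∫ ζ, p.gy i x y ζ ∂(p.Q i) = p.gyBar i x y :=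
  (h.hasGradientAt_gBar i x y).gradient.symm

/-- The derivatives of ∇_y g are bounded for every sample, so their oscillation is at most twice the
bound. -/
lemma hasFDerivAt_gyBar_aux (i : Fin m) (w : Vec dx × Vec (dy i)) :
    HasFDerivAt (fun w : Vec dx × Vec (dy i) => p.gyBar i w.1 w.2)
      ((∫ ζ, fderiv ℝ (fun x' => p.gy i x' w.2 ζ) w.1 ∂(p.Q i)).comp
          (ContinuousLinearMap.fst ℝ _ _)
        + (∫ ζ, p.gyy i w.1 w.2 ζ ∂(p.Q i)).comp (ContinuousLinearMap.snd ℝ _ _)) w := by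
  have := h.probQ i
  let A : (Vec dx →L[ℝ] Vec (dy i)) →L[ℝ] (Vec dx × Vec (dy i) →L[ℝ] Vec (dy i)) :=
    (ContinuousLinearMap.compL ℝ (Vec dx × Vec (dy i)) (Vec dx) (Vec (dy i))).flip
      (ContinuousLinearMap.fst ℝ _ _)
  let B : (Vec (dy i) →L[ℝ] Vec (dy i)) →L[ℝ] (Vec dx × Vec (dy i) →L[ℝ] Vec (dy i)) :=
    (ContinuousLinearMap.compL ℝ (Vec dx × Vec (dy i)) (Vec (dy i)) (Vec (dy i))).flip
      (ContinuousLinearMap.snd ℝ _ _)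
  have hA := A.integrable_comp (h.gyx_int i w.1 w.2)
  have hB := B.integrable_comp (h.gyy_int i w.1 w.2)
  have hAb : ∀ (w : Vec dx × Vec (dy i)) ζ, ‖A (fderiv ℝ (fun x' => p.gy i x' w.2 ζ) w.1)‖
      ≤ ‖A‖ * K.Lgy := fun w ζ => (A.le_opNorm _).trans (by gcongr; exact h.norm_gyx_le i _ _ _)
  have hBb : ∀ (w : Vec dx × Vec (dy i)) ζ, ‖B (p.gyy i w.1 w.2 ζ)‖
      ≤ ‖B‖ * K.Lgy := fun w ζ => (B.le_opNorm _).trans (by gcongr; exact h.norm_gyy_le i _ _ _)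
  have key := hasFDerivAt_integral_of_bounded_oscillation (P := p.Q i) (e₀ := w)
    (h := fun w ζ => p.gy i w.1 w.2 ζ)
    (h' := fun w ζ => A (fderiv ℝ (fun x' => p.gy i x' w.2 ζ) w.1) + B (p.gyy i w.1 w.2 ζ))
    (C := (‖A‖ * K.Lgy + ‖B‖ * K.Lgy) + (‖A‖ * K.Lgy + ‖B‖ * K.Lgy))
    (fun w => h.gy_int i w.1 w.2) (hA.add hB) (fun ζ w' hw' => ?_)
    (fun ζ w => hasFDerivAt_prod_of_differentiableAt (h.reg.gy_diff i ζ w))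
  · rw [integral_add hA hB, A.integral_comp_comm (h.gyx_int i w.1 w.2),
      B.integral_comp_comm (h.gyy_int i w.1 w.2)] at key
    simp_rw [h.integral_gy] at key
    exact key
  · refine (norm_sub_le _ _).trans (add_le_add ?_ ?_) <;>
    exact (norm_add_le _ _).trans (add_le_add (hAb _ _) (hBb _ _))

lemma fderiv_gyBar_left (i : Fin m) (x : Vec dx) (y : Vec (dy i)) :
    fderiv ℝ (fun x' => p.gyBar i x' y) x = ∫ ζ, fderiv ℝ (fun x' => p.gy i x' y ζ) x ∂(p.Q i) := by
  have h1 := HasFDerivAt.comp (g := fun w : Vec dx × Vec (dy i) => p.gyBar i w.1 w.2)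
    (f := fun x' => (x', y)) x
    (h.hasFDerivAt_gyBar_aux i (x, y)) (hasFDerivAt_prodMk_left x y)
  refine h1.fderiv.trans ?_
  ext v
  simp

lemma integral_gxy (i : Fin m) (x : Vec dx) (y : Vec (dy i)) :
    ∫ ζ, p.gxy i x y ζ ∂(p.Q i) = p.gxyBar i x y := by
  rw [gxyBar, jacXY, h.fderiv_gyBar_left]
  exact (ContinuousLinearMap.adjoint (𝕜 := ℝ) (E := Vec dx)
    (F := Vec (dy i))).toContinuousLinearEquiv.toContinuousLinearMap.integral_comp_comm
      (h.gyx_int i x y)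

lemma integral_gyy (i : Fin m) (x : Vec dx) (y : Vec (dy i)) :
    ∫ ζ, p.gyy i x y ζ ∂(p.Q i) = p.gyyBar i x y := by
  have h1 := HasFDerivAt.comp (g := fun w : Vec dx × Vec (dy i) => p.gyBar i w.1 w.2)
    (f := fun y' => (x, y')) y
    (h.hasFDerivAt_gyBar_aux i (x, y)) (hasFDerivAt_prodMk_right x y)
  refine Eq.symm (h1.fderiv.trans ?_)
  ext v
  simp

lemma hasFDerivAt_gyBar (i : Fin m) (w : Vec dx × Vec (dy i)) :
    HasFDerivAt (fun w : Vec dx × Vec (dy i) => p.gyBar i w.1 w.2)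
      ((ContinuousLinearMap.adjoint (p.gxyBar i w.1 w.2)).comp (ContinuousLinearMap.fst ℝ _ _)
        + (p.gyyBar i w.1 w.2).comp (ContinuousLinearMap.snd ℝ _ _)) w := by
  rw [← h.integral_gyy, gxyBar, jacXY, ContinuousLinearMap.adjoint_adjoint, h.fderiv_gyBar_left]
  exact h.hasFDerivAt_gyBar_aux i w

/-! The derivatives of the expectations inherit the bounds. -/

lemma fxBar_lip (i : Fin m) : LipschitzXY K.Lfx (p.fxBar i) := by
  have := h.probP i
  convert LipschitzXY.integral (h.sto.fx_lip i) (h.fx_int i) using 3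
  exact (h.integral_fx i _ _).symm

lemma fyBar_lip (i : Fin m) : LipschitzXY K.Lfy (p.fyBar i) := by
  have := h.probP i
  convert LipschitzXY.integral (h.sto.fy_lip i) (h.fy_int i) using 3
  exact (h.integral_fy i _ _).symm

lemma gyBar_lip (i : Fin m) : LipschitzXY K.Lgy (p.gyBar i) := by
  have := h.probQ i
  convert LipschitzXY.integral (h.sto.gy_lip i) (h.gy_int i) using 3
  exact (h.integral_gy i _ _).symm

lemma gxyBar_lip (i : Fin m) : LipschitzXY K.Lgxy (p.gxyBar i) := by
  have := h.probQ i
  convert LipschitzXY.integral (h.sto.gxy_lip i) (h.gxy_int i) using 3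
  exact (h.integral_gxy i _ _).symm

lemma gyyBar_lip (i : Fin m) : LipschitzXY K.Lgyy (p.gyyBar i) := by
  have := h.probQ i
  convert LipschitzXY.integral (h.sto.gyy_lip i) (h.gyy_int i) using 3
  exact (h.integral_gyy i _ _).symm

lemma norm_gxyBar_le (i : Fin m) (x : Vec dx) (y : Vec (dy i)) : ‖p.gxyBar i x y‖ ≤ K.Lgy := by
  have := h.probQ i
  rw [← h.integral_gxy]
  simpa using norm_integral_le_of_norm_le_const (μ := p.Q i)
    (Filter.Eventually.of_forall fun ζ => h.norm_gxy_le i x y ζ)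

lemma norm_fyBar_le (i : Fin m) (x : Vec dx) (y : Vec (dy i)) : ‖p.fyBar i x y‖ ≤ K.Cfy :=
  (sq_le_sq₀ (norm_nonneg _) K.Cfy_nonneg).1 (h.sto.fy_bdd i x y)

lemma norm_fxBar_le (i : Fin m) (x : Vec dx) (y : Vec (dy i)) : ‖p.fxBar i x y‖ ≤ K.Cfx :=
  (sq_le_sq₀ (norm_nonneg _) K.Cfx_nonneg).1 (h.sto.fx_bdd i x y)

end Standing

end Problem


/-! ### Perturbation of the hyper-gradient -/

section Perturbation

variable {n d : ℕ} {lam : ℝ}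

/-- The factors u, A, X, v are exchanged one at a time. Only v, never v', multiplies the differences
of A and X, so in the stochastic setting only one second moment is needed. -/
lemma norm_hyper_sub_sq_le (hlam : 0 < lam) {X X' : Vec n →L[ℝ] Vec n} (hX : X ∈ geSet lam)
    (hX' : X' ∈ geSet lam) (A A' : Vec n →L[ℝ] Vec d) (u u' : Vec d) (v v' : Vec n) :
    ‖(u - A (X.inverse v)) - (u' - A' (X'.inverse v'))‖ ^ 2
      ≤ 4 * (‖u - u'‖ ^ 2 + ‖A - A'‖ ^ 2 * (lam⁻¹ * ‖v‖) ^ 2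
        + ‖A'‖ ^ 2 * (lam⁻¹ * lam⁻¹ * ‖X - X'‖ * ‖v‖) ^ 2
        + ‖A'‖ ^ 2 * (lam⁻¹ * ‖v - v'‖) ^ 2) := by
  have e : (u - A (X.inverse v)) - (u' - A' (X'.inverse v'))
      = (u - u') + (-((A - A') (X.inverse v))) + (-(A' (X.inverse v - X'.inverse v)))
        + (-(A' (X'.inverse (v - v')))) := by
    simp only [sub_apply, map_sub]
    abel
  rw [e]
  refine (norm_add_sq_le_four _ _ _ _).trans ?_
  rw [norm_neg, norm_neg, norm_neg]
  have h1 : ‖(A - A') (X.inverse v)‖ ≤ ‖A - A'‖ * (lam⁻¹ * ‖v‖) :=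
    ((A - A').le_opNorm _).trans (by gcongr; exact norm_inverse_apply_le hlam hX v)
  have h2 : ‖A' (X.inverse v - X'.inverse v)‖ ≤ ‖A'‖ * (lam⁻¹ * lam⁻¹ * ‖X - X'‖ * ‖v‖) :=
    (A'.le_opNorm _).trans (by gcongr; exact norm_inverse_sub_inverse_apply_le hlam hX hX' v)
  have h3 : ‖A' (X'.inverse (v - v'))‖ ≤ ‖A'‖ * (lam⁻¹ * ‖v - v'‖) :=
    (A'.le_opNorm _).trans (by gcongr; exact norm_inverse_apply_le hlam hX' _)
  rw [← mul_pow, ← mul_pow, ← mul_pow]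
  gcongr

end Perturbation

/-- Bound for the second moment of the stochastic gradients `∇_y f_i(x, y; ξ)`. -/
def Consts.fySecond (K : Consts) : ℝ := 2 * K.σ ^ 2 + 2 * K.Cfy ^ 2

/-- Lipschitz constant (for squared norms) of the hyper-gradient, if `∇_y f` has squared norm at
most `v`. -/
def Consts.hyperLipOf (K : Consts) (v : ℝ) : ℝ :=
  4 * (K.Lfx ^ 2 + (K.Lgxy ^ 2 * K.lam⁻¹ ^ 2 + K.Lgy ^ 2 * (K.lam⁻¹ * K.lam⁻¹) ^ 2) * v
    + K.Lgy ^ 2 * K.lam⁻¹ ^ 2 * K.Lfy ^ 2)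

/-- Mean-square Lipschitz constant of the stochastic hyper-gradient. -/
def Consts.hyperLip (K : Consts) : ℝ := K.hyperLipOf K.fySecond

lemma Consts.fySecond_nonneg (K : Consts) : 0 ≤ K.fySecond := by
  unfold Consts.fySecond
  positivity

lemma Consts.hyperLip_nonneg (K : Consts) : 0 ≤ K.hyperLip := by
  have := K.fySecond_nonneg
  unfold Consts.hyperLip Consts.hyperLipOf
  positivity

/-- Lipschitz constant of the lower-level solution maps. -/
def Consts.Ly (K : Consts) : ℝ := K.Lgy / K.lam

lemma Consts.Ly_nonneg (K : Consts) : 0 ≤ K.Ly := div_nonneg K.Lgy_nonneg K.lam_pos.le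

/-- Smoothness constant of the objective. -/
def Consts.LF (K : Consts) : ℝ := √(K.hyperLip * ((1 + K.Lgyy ^ 2) * (1 + K.Ly ^ 2))) + 1

lemma Consts.LF_pos (K : Consts) : 0 < K.LF := by
  unfold Consts.LF
  positivity

namespace Problem

variable {m dx : ℕ} {dy : Fin m → ℕ} {Ξ Z : Fin m → Type*}
  [∀ i, MeasurableSpace (Ξ i)] [∀ i, MeasurableSpace (Z i)]
  (p : Problem m dx dy Ξ Z)

/-- The mean of the stochastic hyper-gradient of block `i`. -/
def hyperMean (i : Fin m) (x : Vec dx) (y : Vec (dy i)) (H : Vec (dy i) →L[ℝ] Vec (dy i)) :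
    Vec dx :=
  p.fxBar i x y - p.gxyBar i x y (H.inverse (p.fyBar i x y))

variable {p} {K : Consts} {D : ℕ} (h : p.Standing K D)

namespace Standing

include h

/-! ### The lower-level solution map -/

/-- Add the strong convexity inequalities of (y, y') and (y', y). -/
lemma strong_monotone (i : Fin m) (x : Vec dx) (y y' : Vec (dy i)) :
    K.lam * ‖y - y'‖ ^ 2 ≤ inner ℝ (p.gyBar i x y - p.gyBar i x y') (y - y') := by
  have h1 := h.low.strong i x y y'
  have h2 := h.low.strong i x y' y
  have h3 : inner ℝ (gradY (p.gBar i) x y) (y' - y) = - inner ℝ (gradY (p.gBar i) x y) (y - y') := by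
    rw [← inner_neg_right, neg_sub]
  rw [h3, norm_sub_rev y' y] at h2
  rw [inner_sub_left]
  linarith

/-- By strong convexity at 0, the function exceeds its value at 0 outside the ball of radius
2‖∇g(0)‖/λ, so a minimiser on this compact ball is global. -/
lemma exists_isMin_gBar (i : Fin m) (x : Vec dx) :
    ∃ y, ∀ y', p.gBar i x y ≤ p.gBar i x y' := by
  have hlam := K.lam_pos
  have hc : Continuous (p.gBar i x) := continuous_iff_continuousAt.2 fun y =>
    (h.hasGradientAt_gBar i x y).hasFDerivAt.continuousAt
  set g₀ := p.gyBar i x 0 with hg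
  set r := 2 * ‖g₀‖ / K.lam with hr
  have hr0 : 0 ≤ r := by positivity
  obtain ⟨y, hy, hmin⟩ := (isCompact_closedBall (0 : Vec (dy i)) r).exists_isMinOn
    ⟨0, by simpa using hr0⟩ hc.continuousOn
  refine ⟨y, fun y' => ?_⟩
  by_cases hy' : y' ∈ Metric.closedBall (0 : Vec (dy i)) r
  · exact hmin hy'
  · have h0 : p.gBar i x y ≤ p.gBar i x 0 := hmin (by simpa using hr0)
    have h1 := h.low.strong i x y' 0
    rw [sub_zero] at h1
    have h2 := abs_le.1 (abs_real_inner_le_norm g₀ y')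
    rw [mem_closedBall_zero_iff, not_le, hr, div_lt_iff₀ hlam] at hy'
    have h3 : p.gBar i x 0 + inner ℝ g₀ y' + K.lam / 2 * ‖y'‖ ^ 2 ≤ p.gBar i x y' := h1
    have h4 : 0 ≤ ‖y'‖ * (‖y'‖ * K.lam - 2 * ‖g₀‖) :=
      mul_nonneg (norm_nonneg _) (by linarith)
    nlinarith [h2.1]

lemma gBar_yStar_le (i : Fin m) (x : Vec dx) (y : Vec (dy i)) :
    p.gBar i x (p.yStar i x) ≤ p.gBar i x y :=
  Classical.epsilon_spec (p := fun y => ∀ y', p.gBar i x y ≤ p.gBar i x y')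
    (h.exists_isMin_gBar i x) y

lemma gyBar_yStar (i : Fin m) (x : Vec dx) : p.gyBar i x (p.yStar i x) = 0 := by
  have h1 : IsLocalMin (p.gBar i x) (p.yStar i x) :=
    Filter.Eventually.of_forall (h.gBar_yStar_le i x)
  have h2 := h1.hasFDerivAt_eq_zero (h.hasGradientAt_gBar i x (p.yStar i x)).hasFDerivAt
  rw [h.integral_gy] at h2
  simpa using h2

/-- Strong monotonicity at x' bounds λ times the distance of the minimisers by ‖∇_y g(x', y_i(x))‖,
and this gradient vanishes when x' is replaced by x. -/
lemma norm_yStar_sub_le (i : Fin m) (x x' : Vec dx) :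
    ‖p.yStar i x - p.yStar i x'‖ ≤ K.Ly * ‖x - x'‖ := by
  have hlam := K.lam_pos
  have h1 := h.strong_monotone i x' (p.yStar i x) (p.yStar i x')
  rw [h.gyBar_yStar i x', sub_zero] at h1
  have h2 := (h.gyBar_lip i).norm_sub_le_left x' x (p.yStar i x)
  rw [h.gyBar_yStar i x, sub_zero, norm_sub_rev] at h2
  have h3 := (real_inner_le_norm (p.gyBar i x' (p.yStar i x)) (p.yStar i x - p.yStar i x'))
  set d := ‖p.yStar i x - p.yStar i x'‖
  have h4 : K.lam * d ^ 2 ≤ K.Lgy * ‖x - x'‖ * d :=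
    h1.trans (h3.trans (by gcongr))
  rw [Consts.Ly, div_mul_eq_mul_div, le_div_iff₀ hlam]
  by_cases hd : d = 0
  · rw [hd, zero_mul]
    exact mul_nonneg K.Lgy_nonneg (norm_nonneg _)
  · have hd0 : 0 < d := lt_of_le_of_ne (norm_nonneg _) (Ne.symm hd)
    nlinarith

lemma continuous_yStar (i : Fin m) : Continuous (p.yStar i) := by
  refine (LipschitzWith.of_dist_le_mul (K := ⟨K.Ly, K.Ly_nonneg⟩) fun x x' => ?_).continuous
  rw [dist_eq_norm, dist_eq_norm]
  exact h.norm_yStar_sub_le i x x'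

lemma hasFDerivAt_gyBar_right (i : Fin m) (x : Vec dx) (y : Vec (dy i)) :
    HasFDerivAt (p.gyBar i x) (p.gyyBar i x y) y := by
  have h1 := HasFDerivAt.comp (g := fun w : Vec dx × Vec (dy i) => p.gyBar i w.1 w.2)
    (f := fun y' => (x, y')) y (h.hasFDerivAt_gyBar i (x, y)) (hasFDerivAt_prodMk_right x y)
  refine h1.congr_fderiv ?_
  ext v
  simp

/-- Symmetry is that of second derivatives; the lower bound is strong monotonicity in the limit. -/
lemma gyyBar_mem_geSet (i : Fin m) (x : Vec dx) (y : Vec (dy i)) :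
    p.gyyBar i x y ∈ geSet K.lam := by
  constructor
  · rw [ContinuousLinearMap.isSelfAdjoint_iff_isSymmetric]
    intro u v
    have h1 : ∀ᶠ y' in nhds y, HasFDerivAt (p.gBar i x) (innerSL ℝ (p.gyBar i x y')) y' :=
      Filter.Eventually.of_forall fun y' => by
        have := (h.hasGradientAt_gBar i x y').hasFDerivAt
        rw [h.integral_gy] at this
        exact this
    have h2 : HasFDerivAt (fun y' => innerSL ℝ (p.gyBar i x y'))
        ((innerSL ℝ (E := Vec (dy i))).comp (p.gyyBar i x y)) y :=
      (innerSL ℝ (E := Vec (dy i))).hasFDerivAt.comp y (h.hasFDerivAt_gyBar_right i x y)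
    have h3 := second_derivative_symmetric_of_eventually h1 h2 u v
    simp only [ContinuousLinearMap.comp_apply, innerSL_apply_apply] at h3
    simp only [ContinuousLinearMap.coe_coe]
    rw [h3, real_inner_comm]
  · intro v
    -- The quadratic form at v is the limit of k⟨∇g(y + v/k) - ∇g(y), v⟩, and each term is at least
    -- λ‖v‖².
    have h1 := (h.hasFDerivAt_gyBar_right i x y).lim v (c := fun k : ℕ => (k : ℝ))
      (by simpa using tendsto_natCast_atTop_atTop (R := ℝ))
    have h2 := h1.inner (tendsto_const_nhds (x := v)) (𝕜 := ℝ)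
    refine ge_of_tendsto h2 ?_
    filter_upwards [Filter.eventually_ge_atTop 1] with k hk
    have hk0 : (0 : ℝ) < k := by exact_mod_cast hk
    have h3 := h.strong_monotone i x (y + (k : ℝ)⁻¹ • v) y
    rw [add_sub_cancel_left, norm_smul, inner_smul_right, norm_inv, Real.norm_natCast] at h3
    rw [inner_smul_left, conj_trivial]
    have h4 := mul_le_mul_of_nonneg_left h3 (sq_nonneg (k : ℝ))
    have e1 : (k : ℝ) ^ 2 * (K.lam * ((k : ℝ)⁻¹ * ‖v‖) ^ 2) = K.lam * ‖v‖ ^ 2 := by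
      field_simp
    have e2 : ∀ a : ℝ, (k : ℝ) ^ 2 * ((k : ℝ)⁻¹ * a) = k * a := fun a => by
      field_simp
    rw [e1, e2] at h4
    exact h4

/-- The derivative of the lower-level solution map. -/
lemma hasFDerivAt_yStar (i : Fin m) (x : Vec dx) :
    HasFDerivAt (p.yStar i) (-((p.gyyBar i x (p.yStar i x)).inverse.comp
      (ContinuousLinearMap.adjoint (p.gxyBar i x (p.yStar i x))))) x := by
  set X := p.gyyBar i x (p.yStar i x) with hX
  set A := ContinuousLinearMap.adjoint (p.gxyBar i x (p.yStar i x)) with hA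
  have hXm : X ∈ geSet K.lam := h.gyyBar_mem_geSet i x _
  have hd := h.hasFDerivAt_gyBar i (x, p.yStar i x)
  have hcont : Filter.Tendsto (fun x' => (x', p.yStar i x')) (nhds x)
      (nhds (x, p.yStar i x)) :=
    (continuous_id.prodMk (h.continuous_yStar i)).tendsto x
  -- The gradient vanishes at (x', y_i(x')) and at (x, y_i(x)), so its linearisation A(x' - x) +
  -- X(y_i(x') - y_i(x)) is itself a remainder term. The Lipschitz bound makes it o(x' - x), and
  -- applying X⁻¹ gives the derivative without an implicit function theorem.
  have h1 := hd.isLittleO.comp_tendsto hcont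
  have hO : (fun x' => ((x', p.yStar i x') - (x, p.yStar i x) : Vec dx × Vec (dy i)))
      =O[nhds x] fun x' => x' - x := by
    refine Asymptotics.IsBigO.of_bound (max 1 K.Ly) (Filter.Eventually.of_forall fun x' => ?_)
    rw [Prod.mk_sub_mk, Prod.norm_def]
    refine max_le ?_ ((h.norm_yStar_sub_le i x' x).trans ?_)
    · exact le_mul_of_one_le_left (norm_nonneg _) (le_max_left _ _)
    · gcongr
      exact le_max_right _ _
  have h2 := h1.trans_isBigO hO
  rw [hasFDerivAt_iff_isLittleO]
  have h3 := (X.inverse.isBigO_comp (fun x' => A (x' - x) + X (p.yStar i x' - p.yStar i x))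
    (nhds x)).trans_isLittleO (g := _) (h2.neg_left.congr_left fun x' => by
      simp only [Function.comp_apply, h.gyBar_yStar]
      simp [hX, hA])
  refine h3.congr_left fun x' => ?_
  rw [map_add, inverse_apply_of_mem_geSet K.lam_pos hXm]
  simp
  abel

/-! ### The hyper-gradient -/

lemma norm_hyperMean_sub_sq_le (i : Fin m) (x x' : Vec dx) (y y' : Vec (dy i))
    {H H' : Vec (dy i) →L[ℝ] Vec (dy i)} (hH : H ∈ geSet K.lam) (hH' : H' ∈ geSet K.lam) :
    ‖p.hyperMean i x y H - p.hyperMean i x' y' H'‖ ^ 2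
      ≤ K.hyperLip * (‖x - x'‖ ^ 2 + ‖y - y'‖ ^ 2 + ‖H - H'‖ ^ 2) := by
  have hl : 0 < K.lam⁻¹ := inv_pos.2 K.lam_pos
  -- Enlarging Cfy² to `fySecond` lets the same constant `hyperLip` serve the mean and the
  -- stochastic hyper-gradient.
  have hv : ‖p.fyBar i x y‖ ^ 2 ≤ K.fySecond := by
    have := h.sto.fy_bdd i x y
    unfold Consts.fySecond
    nlinarith [sq_nonneg K.σ, sq_nonneg K.Cfy]
  have h1 := (h.fxBar_lip i).norm_sub_sq_le x y x' y'
  have h2 := (h.fyBar_lip i).norm_sub_sq_le x y x' y'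
  have h3 := (h.gxyBar_lip i).norm_sub_sq_le x y x' y'
  have h4 : ‖p.gxyBar i x' y'‖ ^ 2 ≤ K.Lgy ^ 2 := by
    gcongr
    exact h.norm_gxyBar_le i x' y'
  set d := ‖x - x'‖ ^ 2 + ‖y - y'‖ ^ 2 with hd
  have hd0 : 0 ≤ d := by positivity
  refine (norm_hyper_sub_sq_le K.lam_pos hH hH' _ _ _ _ _ _).trans ?_
  simp only [mul_pow]
  calc _ ≤ 4 * (K.Lfx ^ 2 * d + K.Lgxy ^ 2 * d * (K.lam⁻¹ ^ 2 * K.fySecond)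
        + K.Lgy ^ 2 * (K.lam⁻¹ ^ 2 * K.lam⁻¹ ^ 2 * ‖H - H'‖ ^ 2 * K.fySecond)
        + K.Lgy ^ 2 * (K.lam⁻¹ ^ 2 * (K.Lfy ^ 2 * d))) := by gcongr
    _ ≤ K.hyperLip * (d + ‖H - H'‖ ^ 2) := by
        have hf := K.fySecond_nonneg
        have a1 : 0 ≤ K.Lfx ^ 2 * ‖H - H'‖ ^ 2 := by positivity
        have a2 : 0 ≤ K.Lgxy ^ 2 * K.lam⁻¹ ^ 2 * K.fySecond * ‖H - H'‖ ^ 2 := by positivity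
        have a3 : 0 ≤ K.Lgy ^ 2 * (K.lam⁻¹ * K.lam⁻¹) ^ 2 * K.fySecond * d := by positivity
        have a4 : 0 ≤ K.Lgy ^ 2 * K.lam⁻¹ ^ 2 * K.Lfy ^ 2 * ‖H - H'‖ ^ 2 := by positivity
        unfold Consts.hyperLip Consts.hyperLipOf
        nlinarith

/-- The gradient of the objective. -/
lemma hasGradientAt_F (x : Vec dx) : HasGradientAt p.F ((m : ℝ)⁻¹ • ∑ i,
    p.hyperMean i x (p.yStar i x) (p.gyyBar i x (p.yStar i x))) x := by
  have h1 : ∀ i, HasFDerivAt (fun x => p.fBar i x (p.yStar i x))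
      (innerSL ℝ (p.hyperMean i x (p.yStar i x) (p.gyyBar i x (p.yStar i x)))) x := fun i => by
    have h2 := HasFDerivAt.comp (g := fun w : Vec dx × Vec (dy i) => p.fBar i w.1 w.2)
      (f := fun x' => (x', p.yStar i x')) x (h.hasFDerivAt_fBar i (x, p.yStar i x))
      ((hasFDerivAt_id x).prodMk (h.hasFDerivAt_yStar i x))
    refine h2.congr_fderiv ?_
    have hXm := h.gyyBar_mem_geSet i x (p.yStar i x)
    set X := p.gyyBar i x (p.yStar i x)
    -- The inverse of a self-adjoint operator is self-adjoint; this moves H⁻¹ from the direction v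
    -- onto ∇_y f.
    have hsym : ∀ u v, inner ℝ (X.inverse u) v = inner ℝ u (X.inverse v) := fun u v => by
      have hs := (ContinuousLinearMap.isSelfAdjoint_iff_isSymmetric.1 hXm.1)
        (X.inverse u) (X.inverse v)
      simp only [ContinuousLinearMap.coe_coe, apply_inverse_of_mem_geSet K.lam_pos hXm] at hs
      exact hs.symm
    ext v
    simp only [hyperMean, innerSL_apply_apply, inner_sub_left, ContinuousLinearMap.comp_apply,
      add_apply, ContinuousLinearMap.prod_apply, ContinuousLinearMap.coe_fst',
      ContinuousLinearMap.coe_snd', neg_apply, inner_neg_right, ContinuousLinearMap.id_apply]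
    rw [← hsym, ContinuousLinearMap.adjoint_inner_right]
    ring
  have h3 := (HasFDerivAt.fun_sum (u := Finset.univ) fun i _ => h1 i).const_mul ((m : ℝ)⁻¹)
  rw [hasGradientAt_iff_hasFDerivAt]
  refine h3.congr_fderiv ?_
  ext v
  simp

lemma gradient_F (x : Vec dx) : gradient p.F x = (m : ℝ)⁻¹ • ∑ i,
    p.hyperMean i x (p.yStar i x) (p.gyyBar i x (p.yStar i x)) :=
  (h.hasGradientAt_F x).gradient

/-- `hyperMean` is Lipschitz in (x, y, H), and both the lower-level solution and the Hessian
evaluated there are Lipschitz in x. -/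
lemma norm_gradient_F_sub_le (x x' : Vec dx) :
    ‖gradient p.F x - gradient p.F x'‖ ≤ K.LF * ‖x - x'‖ := by
  rw [h.gradient_F, h.gradient_F, ← smul_sub, ← Finset.sum_sub_distrib]
  refine norm_avg_le (mul_nonneg K.LF_pos.le (norm_nonneg _)) fun i => ?_
  have h1 := h.norm_hyperMean_sub_sq_le i x x' (p.yStar i x) (p.yStar i x')
    (h.gyyBar_mem_geSet i x (p.yStar i x)) (h.gyyBar_mem_geSet i x' (p.yStar i x'))
  have h2 := (h.gyyBar_lip i).norm_sub_sq_le x (p.yStar i x) x' (p.yStar i x')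
  have h3 : ‖p.yStar i x - p.yStar i x'‖ ^ 2 ≤ K.Ly ^ 2 * ‖x - x'‖ ^ 2 := by
    rw [← mul_pow]
    gcongr
    exact h.norm_yStar_sub_le i x x'
  have h4 : ‖x - x'‖ ^ 2 + ‖p.yStar i x - p.yStar i x'‖ ^ 2
      + ‖p.gyyBar i x (p.yStar i x) - p.gyyBar i x' (p.yStar i x')‖ ^ 2
      ≤ ((1 + K.Lgyy ^ 2) * (1 + K.Ly ^ 2)) * ‖x - x'‖ ^ 2 := by
    nlinarith [mul_le_mul_of_nonneg_left h3 (sq_nonneg K.Lgyy)]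
  have h5 := h1.trans (mul_le_mul_of_nonneg_left h4 K.hyperLip_nonneg)
  rw [← mul_assoc] at h5
  have h6 := Real.le_sqrt_of_sq_le h5
  rw [Real.sqrt_mul (mul_nonneg K.hyperLip_nonneg (by positivity)),
    Real.sqrt_sq (norm_nonneg _)] at h6
  refine h6.trans ?_
  unfold Consts.LF
  nlinarith [norm_nonneg (x - x')]

lemma differentiable_F : Differentiable ℝ p.F := fun x =>
  (h.hasGradientAt_F x).hasFDerivAt.differentiableAt

lemma continuous_gradient_F : Continuous (gradient p.F) := by
  refine (LipschitzWith.of_dist_le_mul (K := ⟨K.LF, K.LF_pos.le⟩) fun x x' => ?_).continuous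
  rw [dist_eq_norm, dist_eq_norm]
  exact h.norm_gradient_F_sub_le x x'

end Standing

end Problem


/-! ### Upper bounds for expectations -/

section MeanLE

variable {W : Type*} [MeasurableSpace W]

/-- `f` has an integrable majorant with integral at most `c`. -/
def MeanLE (ν : Measure W) (f : W → ℝ) (c : ℝ) : Prop :=
  ∃ U : W → ℝ, (∀ w, f w ≤ U w) ∧ Integrable U ν ∧ ∫ w, U w ∂ν ≤ c

variable {ν : Measure W} {f g : W → ℝ} {c d : ℝ}

lemma MeanLE.of_integrable (hf : Integrable f ν) (hc : ∫ w, f w ∂ν ≤ c) : MeanLE ν f c :=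
  ⟨f, fun _ => le_rfl, hf, hc⟩

lemma MeanLE.mono (hf : MeanLE ν f c) (hcd : c ≤ d) : MeanLE ν f d := by
  obtain ⟨U, h1, h2, h3⟩ := hf
  exact ⟨U, h1, h2, h3.trans hcd⟩

lemma MeanLE.of_le (hg : MeanLE ν g c) (hfg : ∀ w, f w ≤ g w) : MeanLE ν f c := by
  obtain ⟨U, h1, h2, h3⟩ := hg
  exact ⟨U, fun w => (hfg w).trans (h1 w), h2, h3⟩

lemma MeanLE.add (hf : MeanLE ν f c) (hg : MeanLE ν g d) :
    MeanLE ν (fun w => f w + g w) (c + d) := by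
  obtain ⟨U, h1, h2, h3⟩ := hf
  obtain ⟨V, k1, k2, k3⟩ := hg
  refine ⟨fun w => U w + V w, fun w => add_le_add (h1 w) (k1 w), h2.add k2, ?_⟩
  rw [integral_add h2 k2]
  exact add_le_add h3 k3

lemma MeanLE.const_mul (hf : MeanLE ν f c) {a : ℝ} (ha : 0 ≤ a) :
    MeanLE ν (fun w => a * f w) (a * c) := by
  obtain ⟨U, h1, h2, h3⟩ := hf
  refine ⟨fun w => a * U w, fun w => mul_le_mul_of_nonneg_left (h1 w) ha, h2.const_mul a, ?_⟩
  rw [integral_const_mul]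
  exact mul_le_mul_of_nonneg_left h3 ha

lemma MeanLE.const [IsProbabilityMeasure ν] (c : ℝ) : MeanLE ν (fun _ => c) c :=
  MeanLE.of_integrable (integrable_const c) (by simp)

lemma MeanLE.sum {ι : Type*} (s : Finset ι) {f : ι → W → ℝ} {c : ι → ℝ}
    (hf : ∀ i ∈ s, MeanLE ν (f i) (c i)) :
    MeanLE ν (fun w => ∑ i ∈ s, f i w) (∑ i ∈ s, c i) := by
  choose! U h1 h2 h3 using hf
  refine ⟨fun w => ∑ i ∈ s, U i w, fun w => Finset.sum_le_sum fun i hi => h1 i hi w,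
    integrable_finsetSum _ h2, ?_⟩
  rw [integral_finsetSum _ h2]
  exact Finset.sum_le_sum h3

lemma MeanLE.comp_measurePreserving {W' : Type*} [MeasurableSpace W'] {ν' : Measure W'}
    {π : W' → W} (hf : MeanLE ν f c) (hπ : MeasurePreserving π ν' ν) :
    MeanLE ν' (fun w => f (π w)) c := by
  obtain ⟨U, h1, h2, h3⟩ := hf
  refine ⟨fun w => U (π w), fun w => h1 _, hπ.integrable_comp_of_integrable h2, ?_⟩
  rw [← integral_map hπ.measurable.aemeasurable (by rw [hπ.map_eq]; exact h2.1), hπ.map_eq]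
  exact h3

lemma MeanLE.lintegral_le (hf : MeanLE ν f c) (h0 : ∀ w, 0 ≤ f w) :
    ∫⁻ w, ENNReal.ofReal (f w) ∂ν ≤ ENNReal.ofReal c := by
  obtain ⟨U, h1, h2, h3⟩ := hf
  calc ∫⁻ w, ENNReal.ofReal (f w) ∂ν ≤ ∫⁻ w, ENNReal.ofReal (U w) ∂ν :=
        lintegral_mono fun w => ENNReal.ofReal_le_ofReal (h1 w)
    _ = ENNReal.ofReal (∫ w, U w ∂ν) :=
        (ofReal_integral_eq_lintegral_ofReal h2
          (Filter.Eventually.of_forall fun w => (h0 w).trans (h1 w))).symm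
    _ ≤ _ := ENNReal.ofReal_le_ofReal h3

end MeanLE

/-- Mini-batch variance as an upper bound for an expectation. -/
lemma meanLE_batchMean_sub {S V : Type*} [MeasurableSpace S] {P : Measure S}
    [IsProbabilityMeasure P] {b : ℕ} [NormedAddCommGroup V] [InnerProductSpace ℝ V] [CompleteSpace V]
    [MeasurableSpace V] [BorelSpace V] {φ : S → V} {c : V} {v : ℝ} (hφ : MemLp φ 2 P)
    (hm : Measurable φ) (hc : ∫ s, φ s ∂P = c) (hv : ∫ s, ‖φ s - c‖ ^ 2 ∂P ≤ v) (hb : 1 ≤ b) :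
    MeanLE (Measure.pi fun _ : Fin b => P) (fun w => ‖batchMean φ w - c‖ ^ 2) (v / b) := by
  subst hc
  have hb0 : (0 : ℝ) < b := by exact_mod_cast hb
  refine MeanLE.of_integrable
    (integrable_norm_sq ((memLp_batchMean hφ).sub (memLp_const _))) ?_
  refine (integral_norm_batchMean_sub_sq_le hφ hm hb).trans ?_
  rw [div_eq_inv_mul]
  gcongr

lemma batchMean_apply {S : Type*} {n d b : ℕ} (φ : S → Vec n →L[ℝ] Vec d) (w : Fin b → S)
    (v : Vec n) : batchMean φ w v = batchMean (fun s => φ s v) w := by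
  simp [batchMean]

/-- Second moment of a constant plus a combination of two centred random vectors. -/
lemma meanLE_const_add_comb {W V : Type*} [MeasurableSpace W] {ν : Measure W}
    [IsProbabilityMeasure ν] [NormedAddCommGroup V] [InnerProductSpace ℝ V] [CompleteSpace V]
    {N₁ N₂ : W → V} (m₁ : MemLp N₁ 2 ν) (m₂ : MemLp N₂ 2 ν) (z₁ : ∫ w, N₁ w ∂ν = 0)
    (z₂ : ∫ w, N₂ w ∂ν = 0) {v₁ v₂ : ℝ} (b₁ : ∫ w, ‖N₁ w‖ ^ 2 ∂ν ≤ v₁)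
    (b₂ : ∫ w, ‖N₂ w‖ ^ 2 ∂ν ≤ v₂) (a g : ℝ) (c : V) :
    MeanLE ν (fun w => ‖c + (a • N₁ w + g • N₂ w)‖ ^ 2)
      (‖c‖ ^ 2 + (2 * a ^ 2 * v₁ + 2 * g ^ 2 * v₂)) := by
  have m : MemLp (fun w => a • N₁ w + g • N₂ w) 2 ν := (m₁.const_smul a).add (m₂.const_smul g)
  have j₁ : Integrable (fun w => a • N₁ w) ν := (m₁.integrable (by norm_num)).smul a
  have j₂ : Integrable (fun w => g • N₂ w) ν := (m₂.integrable (by norm_num)).smul g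
  have z : ∫ w, (a • N₁ w + g • N₂ w) ∂ν = 0 := by
    rw [integral_add j₁ j₂, integral_smul, integral_smul, z₁, z₂]
    simp
  have hint : Integrable (fun w => ‖c + (a • N₁ w + g • N₂ w)‖ ^ 2) ν :=
    integrable_norm_sq ((memLp_const c).add m)
  refine MeanLE.of_integrable hint ?_
  rw [integral_norm_const_add_sq m z c]
  refine add_le_add le_rfl ?_
  have i₁ : Integrable (fun w => 2 * a ^ 2 * ‖N₁ w‖ ^ 2) ν := (integrable_norm_sq m₁).const_mul _
  have i₂ : Integrable (fun w => 2 * g ^ 2 * ‖N₂ w‖ ^ 2) ν := (integrable_norm_sq m₂).const_mul _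
  calc ∫ w, ‖a • N₁ w + g • N₂ w‖ ^ 2 ∂ν
      ≤ ∫ w, (2 * a ^ 2 * ‖N₁ w‖ ^ 2 + 2 * g ^ 2 * ‖N₂ w‖ ^ 2) ∂ν := by
        refine integral_mono (integrable_norm_sq m) (i₁.add i₂) fun w => ?_
        have := norm_add_sq_le_two (a • N₁ w) (g • N₂ w)
        rw [norm_smul, norm_smul, mul_pow, mul_pow, Real.norm_eq_abs, Real.norm_eq_abs, sq_abs,
          sq_abs] at this
        dsimp only
        linarith
    _ = 2 * a ^ 2 * ∫ w, ‖N₁ w‖ ^ 2 ∂ν + 2 * g ^ 2 * ∫ w, ‖N₂ w‖ ^ 2 ∂ν := by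
        rw [integral_add i₁ i₂, integral_const_mul, integral_const_mul]
    _ ≤ _ := by gcongr

lemma integral_sub_mean_eq_zero {W V : Type*} [MeasurableSpace W] {ν : Measure W}
    [IsProbabilityMeasure ν] [NormedAddCommGroup V] [NormedSpace ℝ V] [CompleteSpace V]
    {N : W → V} {c : V} (hN : Integrable N ν) (hc : ∫ w, N w ∂ν = c) :
    ∫ w, (N w - c) ∂ν = 0 := by
  rw [integral_sub hN (integrable_const c), hc]
  simp


/-! ### Averages over the blocks -/

section BlockMean

variable {m : ℕ}

/-- Average over all blocks. -/
def blockMean (a : Fin m → ℝ) : ℝ := (m : ℝ)⁻¹ * ∑ i, a i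

lemma blockMean_mono {a b : Fin m → ℝ} (h : ∀ i, a i ≤ b i) : blockMean a ≤ blockMean b :=
  mul_le_mul_of_nonneg_left (Finset.sum_le_sum fun i _ => h i) (by positivity)

lemma blockMean_nonneg {a : Fin m → ℝ} (h : ∀ i, 0 ≤ a i) : 0 ≤ blockMean a :=
  mul_nonneg (by positivity) (Finset.sum_nonneg fun i _ => h i)

lemma blockMean_add (a b : Fin m → ℝ) :
    blockMean (fun i => a i + b i) = blockMean a + blockMean b := by
  simp [blockMean, Finset.sum_add_distrib, mul_add]

lemma blockMean_mul (c : ℝ) (a : Fin m → ℝ) :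
    blockMean (fun i => c * a i) = c * blockMean a := by
  simp only [blockMean, ← Finset.mul_sum]
  ring

lemma blockMean_const (hm : 1 ≤ m) (c : ℝ) : blockMean (fun _ : Fin m => c) = c := by
  have hm0 : (m : ℝ) ≠ 0 := by positivity
  simp [blockMean, hm0]

lemma MeanLE.blockMean {W : Type*} [MeasurableSpace W] {ν : Measure W} {f : Fin m → W → ℝ}
    {c : Fin m → ℝ} (hf : ∀ i, MeanLE ν (f i) (c i)) :
    MeanLE ν (fun w => MBBO.blockMean fun i => f i w) (MBBO.blockMean c) :=
  (MeanLE.sum Finset.univ fun i _ => hf i).const_mul (by positivity)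

lemma norm_blockMean_sq_le {V : Type*} [NormedAddCommGroup V] [NormedSpace ℝ V] (hm : 1 ≤ m)
    (v : Fin m → V) : ‖(m : ℝ)⁻¹ • ∑ i, v i‖ ^ 2 ≤ blockMean fun i => ‖v i‖ ^ 2 :=
  norm_avg_sq_le Finset.univ v (by simp) hm

end BlockMean

/-- Variance of the hyper-gradient of a single sample. -/
def Consts.hyperVar (K : Consts) (D : ℕ) : ℝ :=
  3 * (K.σ ^ 2 + K.Lgy ^ 2 * K.lam⁻¹ ^ 2 * K.σ ^ 2 + K.lam⁻¹ ^ 2 * K.Cfy ^ 2 * (D * K.σ ^ 2))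

/-- Bound for the mean hyper-gradient. -/
def Consts.hyperBound (K : Consts) : ℝ := K.Cfx + K.Lgy * (K.lam⁻¹ * K.Cfy)

lemma Consts.hyperVar_nonneg (K : Consts) (D : ℕ) : 0 ≤ K.hyperVar D := by
  unfold Consts.hyperVar
  positivity

namespace Problem

variable {m dx : ℕ} {dy : Fin m → ℕ} {Ξ Z : Fin m → Type*}
  [∀ i, MeasurableSpace (Ξ i)] [∀ i, MeasurableSpace (Z i)]
  {p : Problem m dx dy Ξ Z} {K : Consts} {D : ℕ} (h : p.Standing K D)

namespace Standing

include h

lemma isProbabilityMeasure_batchLaw (b : ℕ) : IsProbabilityMeasure (batchLaw p b) := by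
  have := h.probP
  have := h.probQ
  unfold batchLaw
  infer_instance

lemma measurePreserving_batch_fst (b : ℕ) (i : Fin m) :
    MeasurePreserving (fun w : Batches Ξ Z b => w.1 i) (batchLaw p b)
      (Measure.pi fun _ => p.P i) := by
  have := h.probP
  have := h.probQ
  exact (measurePreserving_eval (fun i => Measure.pi fun _ : Fin b => p.P i) i).comp
    measurePreserving_fst

lemma measurePreserving_batch_snd (b : ℕ) (i : Fin m) :
    MeasurePreserving (fun w : Batches Ξ Z b => w.2 i) (batchLaw p b)
      (Measure.pi fun _ => p.Q i) := by
  have := h.probP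
  have := h.probQ
  exact (measurePreserving_eval (fun i => Measure.pi fun _ : Fin b => p.Q i) i).comp
    measurePreserving_snd

variable {b : ℕ}

lemma memLp_batch_fst {V : Type*} [NormedAddCommGroup V] [NormedSpace ℝ V] {r : ENNReal}
    {i : Fin m} {φ : Ξ i → V} (hφ : MemLp φ r (p.P i)) :
    MemLp (fun w : Batches Ξ Z b => batchMean φ (w.1 i)) r (batchLaw p b) :=
  have := h.probP i
  (memLp_batchMean hφ).comp_measurePreserving (h.measurePreserving_batch_fst b i)

lemma memLp_batch_snd {V : Type*} [NormedAddCommGroup V] [NormedSpace ℝ V] {r : ENNReal}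
    {i : Fin m} {φ : Z i → V} (hφ : MemLp φ r (p.Q i)) :
    MemLp (fun w : Batches Ξ Z b => batchMean φ (w.2 i)) r (batchLaw p b) :=
  have := h.probQ i
  (memLp_batchMean hφ).comp_measurePreserving (h.measurePreserving_batch_snd b i)

lemma meanLE_fx (hb : 1 ≤ b) (i : Fin m) (x : Vec dx) (y : Vec (dy i)) :
    MeanLE (batchLaw p b) (fun w => ‖batchMean (p.fx i x y) (w.1 i) - p.fxBar i x y‖ ^ 2)
      (K.σ ^ 2 / b) :=
  have := h.probP i
  (meanLE_batchMean_sub (h.fx_memLp i x y) (h.fx_meas i x y) (h.integral_fx i x y)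
    (integral_norm_sub_sq_le_of_lintegral (h.fx_meas i x y).aestronglyMeasurable
      (h.sto.fx_var i x y)) hb).comp_measurePreserving (h.measurePreserving_batch_fst b i)

lemma meanLE_fy (hb : 1 ≤ b) (i : Fin m) (x : Vec dx) (y : Vec (dy i)) :
    MeanLE (batchLaw p b) (fun w => ‖batchMean (p.fy i x y) (w.1 i) - p.fyBar i x y‖ ^ 2)
      (K.σ ^ 2 / b) :=
  have := h.probP i
  (meanLE_batchMean_sub (h.fy_memLp i x y) (h.fy_meas i x y) (h.integral_fy i x y)
    (integral_norm_sub_sq_le_of_lintegral (h.fy_meas i x y).aestronglyMeasurable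
      (h.sto.fy_var i x y)) hb).comp_measurePreserving (h.measurePreserving_batch_fst b i)

/-- The factor 1/b rests on orthogonality, which the spectral norm does not offer. Applying the
matrix to a fixed vector moves the question to a Hilbert space. -/
lemma meanLE_gxy_apply (hb : 1 ≤ b) (i : Fin m) (x : Vec dx) (y : Vec (dy i)) {v : Vec (dy i)}
    (hv : ‖v‖ ≤ 1) :
    MeanLE (batchLaw p b)
      (fun w => ‖(batchMean (p.gxy i x y) (w.2 i) - p.gxyBar i x y) v‖ ^ 2) (K.σ ^ 2 / b) := by
  have := h.probQ i
  have h1 : MemLp (fun ζ => p.gxy i x y ζ v) 2 (p.Q i) :=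
    (ContinuousLinearMap.apply ℝ (Vec dx) v).comp_memLp' (h.gxy_memLp i x y)
  have h2 : Measurable fun ζ => p.gxy i x y ζ v :=
    (ContinuousLinearMap.apply ℝ (Vec dx) v).continuous.measurable.comp (h.gxy_meas i x y)
  have h3 : ∫ ζ, p.gxy i x y ζ v ∂(p.Q i) = p.gxyBar i x y v := by
    rw [← h.integral_gxy, ContinuousLinearMap.integral_apply (h.gxy_int i x y)]
  have h4 : ∫ ζ, ‖p.gxy i x y ζ v - p.gxyBar i x y v‖ ^ 2 ∂(p.Q i) ≤ K.σ ^ 2 := by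
    refine le_trans ?_ (integral_norm_sub_sq_le_of_lintegral
      (h.gxy_meas i x y).aestronglyMeasurable (h.sto.gxy_var i x y))
    refine integral_mono (integrable_norm_sq (h1.sub (memLp_const _)))
      (integrable_norm_sq ((h.gxy_memLp i x y).sub (memLp_const _))) fun ζ => ?_
    have h5 := (p.gxy i x y ζ - p.gxyBar i x y).le_opNorm v
    rw [sub_apply] at h5
    dsimp only
    gcongr
    exact h5.trans (mul_le_of_le_one_right (norm_nonneg _) hv)
  refine ((meanLE_batchMean_sub h1 h2 h3 h4 hb).comp_measurePreserving
    (h.measurePreserving_batch_snd b i)).of_le fun w => ?_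
  rw [sub_apply, batchMean_apply]

/-! ### The stochastic hyper-gradient -/

/-- Deviation of the stochastic hyper-gradient from its mean, uniformly in the matrix. -/
lemma exists_hyperGrad_bound (hb : 1 ≤ b) (i : Fin m) (x : Vec dx) (y : Vec (dy i)) :
    ∃ e : Batches Ξ Z b → ℝ, MeanLE (batchLaw p b) e (K.hyperVar D / b) ∧
      ∀ (w : Batches Ξ Z b) (H : Vec (dy i) →L[ℝ] Vec (dy i)), H ∈ geSet K.lam →
        ‖hyperGrad p i x y H w - p.hyperMean i x y H‖ ^ 2 ≤ e w := by
  have hl : 0 < K.lam⁻¹ := inv_pos.2 K.lam_pos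
  have hb0 : (0 : ℝ) < b := by exact_mod_cast hb
  -- The majorant must not depend on H: at the start H is computed from the same lower-level
  -- mini-batch that enters the hyper-gradient. In the splitting below H⁻¹ contributes only the
  -- bound λ⁻¹, and the spectral norm of the noise in ∇²_xy g is bounded by its columns, at most D
  -- of them.
  refine ⟨fun w => 3 * (‖batchMean (p.fx i x y) (w.1 i) - p.fxBar i x y‖ ^ 2
    + K.Lgy ^ 2 * K.lam⁻¹ ^ 2 * ‖batchMean (p.fy i x y) (w.1 i) - p.fyBar i x y‖ ^ 2
    + K.lam⁻¹ ^ 2 * K.Cfy ^ 2 * ∑ k, ‖(batchMean (p.gxy i x y) (w.2 i) - p.gxyBar i x y)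
      (EuclideanSpace.single k 1)‖ ^ 2), ?_, ?_⟩
  · have h1 := h.meanLE_fx hb i x y
    have h2 := (h.meanLE_fy hb i x y).const_mul (a := K.Lgy ^ 2 * K.lam⁻¹ ^ 2) (by positivity)
    have h3 := (MeanLE.sum Finset.univ fun k _ => h.meanLE_gxy_apply hb i x y
      (v := EuclideanSpace.single k 1) (by simp)).const_mul (a := K.lam⁻¹ ^ 2 * K.Cfy ^ 2)
        (by positivity)
    refine (((h1.add h2).add h3).const_mul (a := 3) (by norm_num)).mono ?_
    have hd : (dy i : ℝ) ≤ D := by exact_mod_cast h.dim i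
    rw [Finset.sum_const, Finset.card_univ, Fintype.card_fin, nsmul_eq_mul]
    calc _ ≤ 3 * (K.σ ^ 2 / b + K.Lgy ^ 2 * K.lam⁻¹ ^ 2 * (K.σ ^ 2 / b)
          + K.lam⁻¹ ^ 2 * K.Cfy ^ 2 * (D * (K.σ ^ 2 / b))) := by gcongr
      _ = _ := by unfold Consts.hyperVar; ring
  · intro w H hH
    dsimp only
    set u := batchMean (p.fx i x y) (w.1 i)
    set v := batchMean (p.fy i x y) (w.1 i)
    set A := batchMean (p.gxy i x y) (w.2 i)
    have hA : ‖A‖ ≤ K.Lgy := norm_batchMean_le hb (h.norm_gxy_le i x y) _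
    have e : hyperGrad p i x y H w - p.hyperMean i x y H
        = (u - p.fxBar i x y) + -(A (H.inverse (v - p.fyBar i x y)))
          + -((A - p.gxyBar i x y) (H.inverse (p.fyBar i x y))) := by
      simp only [hyperGrad, hyperMean, map_sub, sub_apply]
      abel
    rw [e]
    refine (norm_add_sq_le_three _ _ _).trans ?_
    rw [norm_neg, norm_neg]
    have h1 : ‖A (H.inverse (v - p.fyBar i x y))‖ ≤ K.Lgy * (K.lam⁻¹ * ‖v - p.fyBar i x y‖) :=
      (A.le_opNorm _).trans (mul_le_mul hA (norm_inverse_apply_le K.lam_pos hH _)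
        (norm_nonneg _) K.Lgy_nonneg)
    have h2 : ‖(A - p.gxyBar i x y) (H.inverse (p.fyBar i x y))‖
        ≤ ‖A - p.gxyBar i x y‖ * (K.lam⁻¹ * K.Cfy) :=
      (ContinuousLinearMap.le_opNorm _ _).trans (by
        gcongr
        exact (norm_inverse_apply_le K.lam_pos hH _).trans (by
          gcongr
          exact h.norm_fyBar_le i x y))
    have h3 := norm_sq_le_sum_single (A - p.gxyBar i x y)
    have h1' : ‖A (H.inverse (v - p.fyBar i x y))‖ ^ 2
        ≤ K.Lgy ^ 2 * K.lam⁻¹ ^ 2 * ‖v - p.fyBar i x y‖ ^ 2 := by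
      rw [← mul_pow, ← mul_pow, mul_assoc]
      gcongr
    have h2' : ‖(A - p.gxyBar i x y) (H.inverse (p.fyBar i x y))‖ ^ 2
        ≤ K.lam⁻¹ ^ 2 * K.Cfy ^ 2 * ∑ k, ‖(A - p.gxyBar i x y) (EuclideanSpace.single k 1)‖ ^ 2 := by
      calc _ ≤ (‖A - p.gxyBar i x y‖ * (K.lam⁻¹ * K.Cfy)) ^ 2 := by gcongr
        _ = K.lam⁻¹ ^ 2 * K.Cfy ^ 2 * ‖A - p.gxyBar i x y‖ ^ 2 := by ring
        _ ≤ _ := by gcongr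
    gcongr

/-- The matrix factor is bounded for every sample, so the product inherits square integrability from
the vector factor. -/
lemma hyperGrad_memLp (hb : 1 ≤ b) (i : Fin m) (x : Vec dx) (y : Vec (dy i))
    {H : Vec (dy i) →L[ℝ] Vec (dy i)} (hH : H ∈ geSet K.lam) :
    MemLp (hyperGrad p i x y H : Batches Ξ Z b → Vec dx) 2 (batchLaw p b) := by
  have h1 := h.memLp_batch_fst (b := b) (h.fx_memLp i x y)
  have h2 := h.memLp_batch_fst (b := b) (h.fy_memLp i x y)
  have h3 := h.memLp_batch_snd (b := b) (h.gxy_memLp i x y)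
  refine h1.sub ?_
  have h4 : MemLp (fun w : Batches Ξ Z b => H.inverse (batchMean (p.fy i x y) (w.1 i))) 2
      (batchLaw p b) := H.inverse.comp_memLp' h2
  refine h4.of_le_mul (c := K.Lgy) ?_ (Filter.Eventually.of_forall fun w => ?_)
  · exact isBoundedBilinearMap_apply.continuous.comp_aestronglyMeasurable (h3.1.prodMk h4.1)
  · exact (ContinuousLinearMap.le_opNorm _ _).trans (by
      gcongr
      exact norm_batchMean_le hb (h.norm_gxy_le i x y) _)

/-- For fixed H the matrix comes from the lower-level batch and the vector from the upper-level
batch. These are independent, so the expectation of the product is the product of the expectations.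
-/
lemma integral_hyperGrad (hb : 1 ≤ b) (i : Fin m) (x : Vec dx) (y : Vec (dy i))
    {H : Vec (dy i) →L[ℝ] Vec (dy i)} (hH : H ∈ geSet K.lam) :
    ∫ w : Batches Ξ Z b, hyperGrad p i x y H w ∂(batchLaw p b) = p.hyperMean i x y H := by
  have := h.probP
  have := h.probQ
  have hprob := h.isProbabilityMeasure_batchLaw b
  have h1 := (h.memLp_batch_fst (b := b) (h.fx_memLp i x y)).integrable (by norm_num)
  have hG := (h.hyperGrad_memLp (b := b) hb i x y hH).integrable (by norm_num)
  have e1 : ∫ w : Batches Ξ Z b, batchMean (p.fx i x y) (w.1 i) ∂(batchLaw p b)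
      = p.fxBar i x y := by
    have hmp := h.measurePreserving_batch_fst b i
    have hm := memLp_batchMean (b := b) (h.fx_memLp i x y)
    rw [← integral_map (φ := fun w : Batches Ξ Z b => w.1 i) hmp.measurable.aemeasurable
      (by rw [hmp.map_eq]; exact hm.1), hmp.map_eq, integral_batchMean (h.fx_int i x y) hb,
      h.integral_fx]
  have hf1 : Integrable (fun w : (i : Fin m) → Fin b → Ξ i => batchMean (p.fy i x y) (w i))
      (Measure.pi fun i => Measure.pi fun _ : Fin b => p.P i) :=
    ((memLp_batchMean (h.fy_memLp i x y)).comp_measurePreserving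
      (measurePreserving_eval (fun i => Measure.pi fun _ : Fin b => p.P i) i)).integrable
        (by norm_num)
  have hf2 : Integrable (fun w : (i : Fin m) → Fin b → Z i => batchMean (p.gxy i x y) (w i))
      (Measure.pi fun i => Measure.pi fun _ : Fin b => p.Q i) :=
    ((memLp_batchMean (h.gxy_memLp i x y)).comp_measurePreserving
      (measurePreserving_eval (fun i => Measure.pi fun _ : Fin b => p.Q i) i)).integrable
        (by norm_num)
  have hi1 : ∫ w : (i : Fin m) → Fin b → Ξ i, batchMean (p.fy i x y) (w i)
      ∂(Measure.pi fun i => Measure.pi fun _ : Fin b => p.P i) = p.fyBar i x y := by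
    have hmp := measurePreserving_eval (fun i => Measure.pi fun _ : Fin b => p.P i) i
    have hm := memLp_batchMean (b := b) (h.fy_memLp i x y)
    rw [← integral_map (φ := fun w : (i : Fin m) → Fin b → Ξ i => w i) hmp.measurable.aemeasurable
      (by erw [hmp.map_eq]; exact hm.1)]
    erw [hmp.map_eq]
    rw [integral_batchMean (h.fy_int i x y) hb, h.integral_fy]
  have hi2 : ∫ w : (i : Fin m) → Fin b → Z i, batchMean (p.gxy i x y) (w i)
      ∂(Measure.pi fun i => Measure.pi fun _ : Fin b => p.Q i) = p.gxyBar i x y := by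
    have hmp := measurePreserving_eval (fun i => Measure.pi fun _ : Fin b => p.Q i) i
    have hm := memLp_batchMean (b := b) (h.gxy_memLp i x y)
    rw [← integral_map (φ := fun w : (i : Fin m) → Fin b → Z i => w i) hmp.measurable.aemeasurable
      (by erw [hmp.map_eq]; exact hm.1)]
    erw [hmp.map_eq]
    rw [integral_batchMean (h.gxy_int i x y) hb, h.integral_gxy]
  have e2 : ∫ w : Batches Ξ Z b, batchMean (p.gxy i x y) (w.2 i)
      (H.inverse (batchMean (p.fy i x y) (w.1 i))) ∂(batchLaw p b)
      = p.gxyBar i x y (H.inverse (p.fyBar i x y)) := by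
    have := integral_prod_bilin (((ContinuousLinearMap.apply ℝ (Vec dx)).comp H.inverse) :
      Vec (dy i) →L[ℝ] (Vec (dy i) →L[ℝ] Vec dx) →L[ℝ] Vec dx) hf1 hf2
    rw [hi1, hi2] at this
    exact this
  have h2 : Integrable (fun w : Batches Ξ Z b => batchMean (p.gxy i x y) (w.2 i)
      (H.inverse (batchMean (p.fy i x y) (w.1 i)))) (batchLaw p b) := by
    refine (h1.sub hG).congr (Filter.Eventually.of_forall fun w => ?_)
    simp [hyperGrad]
  unfold hyperGrad
  rw [integral_sub h1 h2, e1, e2, hyperMean]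

lemma norm_hyperMean_le (i : Fin m) (x : Vec dx) (y : Vec (dy i))
    {H : Vec (dy i) →L[ℝ] Vec (dy i)} (hH : H ∈ geSet K.lam) :
    ‖p.hyperMean i x y H‖ ≤ K.hyperBound := by
  have hl : 0 < K.lam⁻¹ := inv_pos.2 K.lam_pos
  refine (norm_sub_le _ _).trans (add_le_add (h.norm_fxBar_le i x y)
    ((ContinuousLinearMap.le_opNorm _ _).trans ?_))
  refine mul_le_mul (h.norm_gxyBar_le i x y) ((norm_inverse_apply_le K.lam_pos hH _).trans ?_)
    (norm_nonneg _) K.Lgy_nonneg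
  gcongr
  exact h.norm_fyBar_le i x y

lemma meanLE_norm_fy_sq (hb : 1 ≤ b) (i : Fin m) (x : Vec dx) (y : Vec (dy i)) :
    MeanLE (batchLaw p b) (fun w => ‖batchMean (p.fy i x y) (w.1 i)‖ ^ 2) K.fySecond := by
  have := h.isProbabilityMeasure_batchLaw b
  have hb0 : (1 : ℝ) ≤ b := by exact_mod_cast hb
  have h1 := (h.meanLE_fy hb i x y).const_mul (a := 2) (by norm_num)
  refine ((h1.add (MeanLE.const (2 * K.Cfy ^ 2))).mono ?_).of_le fun w => ?_
  · have : K.σ ^ 2 / b ≤ K.σ ^ 2 := div_le_self (by positivity) hb0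
    unfold Consts.fySecond
    linarith
  · have h2 := norm_add_sq_le_two (batchMean (p.fy i x y) (w.1 i) - p.fyBar i x y) (p.fyBar i x y)
    rw [sub_add_cancel] at h2
    linarith [h.sto.fy_bdd i x y]

/-- Mean-square Lipschitz continuity of the stochastic hyper-gradient. -/
lemma meanLE_hyperGrad_sub (hb : 1 ≤ b) (i : Fin m) (x x' : Vec dx) (y y' : Vec (dy i))
    {H H' : Vec (dy i) →L[ℝ] Vec (dy i)} (hH : H ∈ geSet K.lam) (hH' : H' ∈ geSet K.lam) :
    MeanLE (batchLaw p b) (fun w => ‖hyperGrad p i x y H w - hyperGrad p i x' y' H' w‖ ^ 2)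
      (K.hyperLip * (‖x - x'‖ ^ 2 + ‖y - y'‖ ^ 2 + ‖H - H'‖ ^ 2)) := by
  have hprob := h.isProbabilityMeasure_batchLaw b
  have hl : 0 < K.lam⁻¹ := inv_pos.2 K.lam_pos
  set d := ‖x - x'‖ ^ 2 + ‖y - y'‖ ^ 2 with hd
  have hd0 : 0 ≤ d := by positivity
  set r := ‖H - H'‖ ^ 2 with hr
  have hr0 : 0 ≤ r := by positivity
  -- The only unbounded random quantity is the batch mean of ∇_y f at (x, y), which enters through
  -- its second moment; everything else is bounded or Lipschitz for every sample.
  have h1 := ((h.meanLE_norm_fy_sq hb i x y).const_mul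
    (a := 4 * (K.Lgxy ^ 2 * d * K.lam⁻¹ ^ 2 + K.Lgy ^ 2 * (K.lam⁻¹ ^ 2 * K.lam⁻¹ ^ 2 * r)))
    (by positivity)).add (MeanLE.const (4 * (K.Lfx ^ 2 * d
      + K.Lgy ^ 2 * (K.lam⁻¹ ^ 2 * (K.Lfy ^ 2 * d)))))
  refine (h1.mono ?_).of_le fun w => ?_
  · have hf := K.fySecond_nonneg
    have a1 : 0 ≤ K.Lfx ^ 2 * r := by positivity
    have a2 : 0 ≤ K.Lgxy ^ 2 * K.lam⁻¹ ^ 2 * K.fySecond * r := by positivity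
    have a3 : 0 ≤ K.Lgy ^ 2 * (K.lam⁻¹ * K.lam⁻¹) ^ 2 * K.fySecond * d := by positivity
    have a4 : 0 ≤ K.Lgy ^ 2 * K.lam⁻¹ ^ 2 * K.Lfy ^ 2 * r := by positivity
    unfold Consts.hyperLip Consts.hyperLipOf
    nlinarith
  · refine (norm_hyper_sub_sq_le K.lam_pos hH hH' _ _ _ _ _ _).trans ?_
    have k1 : ‖batchMean (p.fx i x y) (w.1 i) - batchMean (p.fx i x' y') (w.1 i)‖
        ≤ K.Lfx * √d := by
      rw [batchMean_sub]
      exact norm_batchMean_le hb (fun ξ => h.sto.fx_lip i ξ x y x' y') _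
    have k2 : ‖batchMean (p.fy i x y) (w.1 i) - batchMean (p.fy i x' y') (w.1 i)‖
        ≤ K.Lfy * √d := by
      rw [batchMean_sub]
      exact norm_batchMean_le hb (fun ξ => h.sto.fy_lip i ξ x y x' y') _
    have k3 : ‖batchMean (p.gxy i x y) (w.2 i) - batchMean (p.gxy i x' y') (w.2 i)‖
        ≤ K.Lgxy * √d := by
      rw [batchMean_sub]
      exact norm_batchMean_le hb (fun ζ => h.sto.gxy_lip i ζ x y x' y') _
    have k4 : ‖batchMean (p.gxy i x' y') (w.2 i)‖ ≤ K.Lgy :=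
      norm_batchMean_le hb (h.norm_gxy_le i x' y') _
    have k1' := pow_le_pow_left₀ (norm_nonneg _) k1 2
    have k2' := pow_le_pow_left₀ (norm_nonneg _) k2 2
    have k3' := pow_le_pow_left₀ (norm_nonneg _) k3 2
    have k4' := pow_le_pow_left₀ (norm_nonneg _) k4 2
    rw [mul_pow, Real.sq_sqrt hd0] at k1' k2' k3'
    simp only [mul_pow]
    calc _ ≤ 4 * (K.Lfx ^ 2 * d
          + K.Lgxy ^ 2 * d * (K.lam⁻¹ ^ 2 * ‖batchMean (p.fy i x y) (w.1 i)‖ ^ 2)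
          + K.Lgy ^ 2 * (K.lam⁻¹ ^ 2 * K.lam⁻¹ ^ 2 * r * ‖batchMean (p.fy i x y) (w.1 i)‖ ^ 2)
          + K.Lgy ^ 2 * (K.lam⁻¹ ^ 2 * (K.Lfy ^ 2 * d))) := by gcongr
      _ = _ := by ring

end Standing

end Problem


/-! ### The variance-reduced estimator of a single block -/

section Estimator

variable {S V : Type*} [MeasurableSpace S] {P : Measure S} [IsProbabilityMeasure P]
  [NormedAddCommGroup V] [InnerProductSpace ℝ V] [CompleteSpace V] [MeasurableSpace V]
  [BorelSpace V] {φ φ' : S → V} {v ℓ a g : ℝ} {b : ℕ}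

lemma norm_batchMean_sub_sq_le (hℓ : ∀ s, ‖φ s - φ' s‖ ^ 2 ≤ ℓ) (hb : 1 ≤ b) (w : Fin b → S) :
    ‖batchMean φ w - batchMean φ' w‖ ^ 2 ≤ ℓ := by
  have hs : Nonempty S := ⟨w ⟨0, hb⟩⟩
  have hℓ0 : 0 ≤ ℓ := (sq_nonneg _).trans (hℓ (Classical.arbitrary S))
  rw [batchMean_sub]
  have := norm_batchMean_le hb (φ := fun s => φ s - φ' s) (fun s => Real.le_sqrt_of_sq_le (hℓ s)) w
  calc _ ≤ (√ℓ) ^ 2 := by gcongr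
    _ = ℓ := Real.sq_sqrt hℓ0

/-- Second moment of the updated estimation error of a sampled block. -/
lemma meanLE_estimator (hφ : MemLp φ 2 P) (hφ' : MemLp φ' 2 P) (hm : Measurable φ)
    (hv : ∫ s, ‖φ s - ∫ s, φ s ∂P‖ ^ 2 ∂P ≤ v) (hℓ : ∀ s, ‖φ s - φ' s‖ ^ 2 ≤ ℓ) (hb : 1 ≤ b)
    (a g : ℝ) (s : V) :
    MeanLE (Measure.pi fun _ : Fin b => P)
      (fun w => ‖(1 - a) • s + a • batchMean φ w + g • (batchMean φ w - batchMean φ' w)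
        - ∫ s, φ s ∂P‖ ^ 2)
      (‖(1 - a) • (s - ∫ s, φ' s ∂P) + (g - (1 - a)) • (∫ s, φ s ∂P - ∫ s, φ' s ∂P)‖ ^ 2
        + (2 * a ^ 2 * (v / b) + 2 * g ^ 2 * ℓ)) := by
  have hb0 : (0 : ℝ) < b := by exact_mod_cast hb
  set c := ∫ s, φ s ∂P with hc
  set c' := ∫ s, φ' s ∂P with hc'
  set π : Measure (Fin b → S) := Measure.pi fun _ => P with hπ
  have hM := memLp_batchMean (b := b) hφ
  have hM' := memLp_batchMean (b := b) hφ'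
  have hi := hM.integrable (q := 2) (by norm_num)
  have hi' := hM'.integrable (q := 2) (by norm_num)
  have e := integral_batchMean (hφ.integrable (by norm_num)) hb
  have e' := integral_batchMean (hφ'.integrable (by norm_num)) hb
  have e12 : ∫ w, (batchMean φ w - batchMean φ' w) ∂π = c - c' := by
    rw [integral_sub hi hi', e, e']
  have b1 : ∫ w, ‖batchMean φ w - c‖ ^ 2 ∂π ≤ v / b := by
    refine (integral_norm_batchMean_sub_sq_le hφ hm hb).trans ?_
    rw [div_eq_inv_mul]
    gcongr
  -- Both gradients use the same samples, so their difference is small whenever the points are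
  -- close; a further factor 1/b is not needed.
  have b2 : ∫ w, ‖(batchMean φ w - batchMean φ' w) - (c - c')‖ ^ 2 ∂π ≤ ℓ := by
    have h1 := integral_norm_sub_mean_sq_le (hM.sub hM')
    simp only [Pi.sub_apply] at h1
    rw [e12] at h1
    refine h1.trans ?_
    have hint : Integrable (fun w => ‖batchMean φ w - batchMean φ' w‖ ^ 2) π :=
      integrable_norm_sq (hM.sub hM')
    exact (integral_mono hint (integrable_const ℓ)
      fun w => norm_batchMean_sub_sq_le hℓ hb w).trans (by simp)
  -- The new error is a deterministic part plus a times the centred sample noise plus g times the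
  -- centred noise of the difference.
  refine (meanLE_const_add_comb (hM.sub (memLp_const c)) ((hM.sub hM').sub (memLp_const (c - c')))
    (integral_sub_mean_eq_zero hi e) (integral_sub_mean_eq_zero (hi.sub hi') e12) b1 b2 a g
    ((1 - a) • (s - c') + (g - (1 - a)) • (c - c'))).of_le fun w => le_of_eq ?_
  congr 2
  simp only [Pi.sub_apply]
  module

/-- Second moment of the displacement of the estimator of a sampled block. -/
lemma meanLE_estimator_move (hφ : MemLp φ 2 P) (hm : Measurable φ)
    (hv : ∫ s, ‖φ s - ∫ s, φ s ∂P‖ ^ 2 ∂P ≤ v) (hℓ : ∀ s, ‖φ s - φ' s‖ ^ 2 ≤ ℓ) {c' : V}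
    (hc' : ‖∫ s, φ s ∂P - c'‖ ^ 2 ≤ ℓ) (hb : 1 ≤ b) (a g : ℝ) (s : V) :
    MeanLE (Measure.pi fun _ : Fin b => P)
      (fun w => ‖(1 - a) • s + a • batchMean φ w + g • (batchMean φ w - batchMean φ' w)
        - s‖ ^ 2)
      (4 * (a ^ 2 * ‖s - c'‖ ^ 2 + a ^ 2 * ℓ + g ^ 2 * ℓ) + 4 * a ^ 2 * (v / b)) := by
  set c := ∫ s, φ s ∂P with hc
  have h1 := (meanLE_batchMean_sub (b := b) hφ hm hc.symm hv hb).const_mul (a := 4 * a ^ 2)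
    (by positivity)
  refine ((MeanLE.const (4 * (a ^ 2 * ‖s - c'‖ ^ 2 + a ^ 2 * ℓ + g ^ 2 * ℓ))).add h1).of_le
    fun w => ?_
  have e : (1 - a) • s + a • batchMean φ w + g • (batchMean φ w - batchMean φ' w) - s
      = a • (c' - s) + a • (c - c') + a • (batchMean φ w - c)
        + g • (batchMean φ w - batchMean φ' w) := by module
  rw [e]
  refine (norm_add_sq_le_four _ _ _ _).trans ?_
  have h2 := norm_batchMean_sub_sq_le hℓ hb w
  simp only [norm_smul, mul_pow, Real.norm_eq_abs, sq_abs, norm_sub_rev c' s]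
  have k1 := mul_le_mul_of_nonneg_left hc' (sq_nonneg a)
  have k2 := mul_le_mul_of_nonneg_left h2 (sq_nonneg g)
  linarith

/-- With the parameter `msvrGamma`, the cross terms of sampled and idle blocks cancel. -/
lemma estimator_contraction {m I : ℕ} (hI1 : 1 ≤ I) (hI : I ≤ m) (ha : 0 ≤ a) (ha2 : a ≤ 1 / 2)
    (e d : V) (hd : ‖d‖ ^ 2 ≤ ℓ) (r : ℝ) :
    (I / m : ℝ) * (‖(1 - a) • e + (msvrGamma m I a - (1 - a)) • d‖ ^ 2
        + (2 * a ^ 2 * r + 2 * msvrGamma m I a ^ 2 * ℓ)) + (1 - I / m) * ‖e - d‖ ^ 2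
      ≤ (1 - I / m * a) * ‖e‖ ^ 2 + 2 * (I / m) * a ^ 2 * r + 13 * ℓ / (I / m) := by
  have hI0 : (0 : ℝ) < I := by exact_mod_cast hI1
  have hm0 : (0 : ℝ) < m := by exact_mod_cast hI1.trans hI
  have hIm : (I : ℝ) ≤ m := by exact_mod_cast hI
  set q : ℝ := I / m with hq
  have hq0 : 0 < q := by positivity
  have hq1 : q ≤ 1 := (div_le_one hm0).2 hIm
  have ha1 : 0 < 1 - a := by linarith
  have hℓ0 : 0 ≤ ℓ := (sq_nonneg _).trans hd
  -- The excess of `msvrGamma` over 1 - a; it is characterised by q(1 - a)k = 1 - q.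
  set k : ℝ := (1 - q) / (q * (1 - a)) with hk
  have hg : msvrGamma m I a = k + (1 - a) := by
    rw [msvrGamma, hk, hq]
    congr 1
    field_simp
  have hk0 : 0 ≤ k := div_nonneg (by linarith) (by positivity)
  have hqk : q * (1 - a) * k = 1 - q := by
    rw [hk]
    field_simp
  have hk2 : q * k ≤ 2 * (1 - q) := by nlinarith [mul_nonneg hq0.le hk0]
  have hg2 : q * (k + (1 - a)) ≤ 2 := by nlinarith
  have hg0 : 0 ≤ k + (1 - a) := by linarith
  rw [hg, add_sub_cancel_right, norm_add_sq_real, norm_sub_sq_real, norm_smul, norm_smul,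
    inner_smul_left, inner_smul_right, conj_trivial, Real.norm_of_nonneg ha1.le,
    Real.norm_of_nonneg hk0]
  set E := ‖e‖
  set X := inner ℝ e d
  set Y := ‖d‖
  have h1 : q * k ^ 2 * Y ^ 2 ≤ 4 * ℓ / q := by
    rw [le_div_iff₀ hq0]
    have : (q * k) ^ 2 ≤ 4 := by nlinarith [mul_nonneg hq0.le hk0]
    calc q * k ^ 2 * Y ^ 2 * q = (q * k) ^ 2 * Y ^ 2 := by ring
      _ ≤ 4 * ℓ := by gcongr
  have h2 : q * (2 * (k + (1 - a)) ^ 2 * ℓ) ≤ 8 * ℓ / q := by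
    rw [le_div_iff₀ hq0]
    have : (q * (k + (1 - a))) ^ 2 ≤ 4 := by nlinarith [mul_nonneg hq0.le hg0]
    calc q * (2 * (k + (1 - a)) ^ 2 * ℓ) * q = 2 * ((q * (k + (1 - a))) ^ 2 * ℓ) := by ring
      _ ≤ 2 * (4 * ℓ) := by gcongr
      _ = _ := by ring
  have h3 : (1 - q) * Y ^ 2 ≤ ℓ / q := by
    rw [le_div_iff₀ hq0]
    have : (1 - q) * q ≤ 1 := by nlinarith
    have h0 : 0 ≤ (1 - q) * q := mul_nonneg (by linarith) hq0.le
    calc (1 - q) * Y ^ 2 * q = ((1 - q) * q) * Y ^ 2 := by ring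
      _ ≤ 1 * ℓ := by gcongr
      _ = ℓ := one_mul ℓ
  -- The cross term of a sampled block, weighted by q, is the opposite of that of an idle block,
  -- weighted by 1 - q. The squares left over contribute 4 + 8 + 1 = 13.
  have h4 : q * (2 * ((1 - a) * (k * X))) = 2 * (1 - q) * X := by
    rw [← hqk]
    ring
  have h5 : (q * (1 - a) ^ 2 + (1 - q)) * E ^ 2 ≤ (1 - q * a) * E ^ 2 := by
    gcongr
    nlinarith [mul_nonneg hq0.le ha]
  have h6 : 13 * ℓ / q = 4 * ℓ / q + 8 * ℓ / q + ℓ / q := by ring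
  rw [h6]
  nlinarith

end Estimator


namespace Problem

variable {m dx : ℕ} {dy : Fin m → ℕ} {Ξ Z : Fin m → Type*}
  [∀ i, MeasurableSpace (Ξ i)] [∀ i, MeasurableSpace (Z i)]
  (p : Problem m dx dy Ξ Z)

/-! ### The error measures of a state -/

/-- Error of the estimators `s` of `∇_y g_i`. -/
def errS (st : State dx dy) : ℝ :=
  blockMean fun i => ‖st.s i - p.gyBar i st.xPrev (st.yPrev i)‖ ^ 2

/-- Error of the estimators `H` of `∇²_{yy} g_i`. -/
def errH (st : State dx dy) : ℝ :=
  blockMean fun i => frobSq (st.H i - p.gyyBar i st.xPrev (st.yPrev i))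

/-- The mean hyper-gradient, averaged over the blocks. -/
def hyperAvg (x : Vec dx) (y : (i : Fin m) → Vec (dy i))
    (H : (i : Fin m) → Vec (dy i) →L[ℝ] Vec (dy i)) : Vec dx :=
  (m : ℝ)⁻¹ • ∑ i, p.hyperMean i x (y i) (H i)

/-- Error of the estimator `z` of the hyper-gradient. -/
def errZ (st : State dx dy) : ℝ := ‖st.z - p.hyperAvg st.xPrev st.yPrev st.HPrev‖ ^ 2

/-- Error of the lower-level variables. -/
def errY (st : State dx dy) : ℝ := blockMean fun i => ‖st.y i - p.yStar i st.x‖ ^ 2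

end Problem

namespace State

variable {m dx : ℕ} {dy : Fin m → ℕ}

/-- Squared length of the last step in `x`. -/
def moveX (st : State dx dy) : ℝ := ‖st.x - st.xPrev‖ ^ 2

/-- Mean squared length of the last step in `y`. -/
def moveY (st : State dx dy) : ℝ := blockMean fun i => ‖st.y i - st.yPrev i‖ ^ 2

/-- Mean squared length of the last step in `H`. -/
def moveH (st : State dx dy) : ℝ := blockMean fun i => ‖st.H i - st.HPrev i‖ ^ 2

/-- All Hessian estimators are bounded below by `lam`. -/
def Valid (lam : ℝ) (st : State dx dy) : Prop :=
  (∀ i, st.H i ∈ geSet lam) ∧ ∀ i, st.HPrev i ∈ geSet lam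

lemma moveX_nonneg (st : State dx dy) : 0 ≤ st.moveX := by unfold moveX; positivity

lemma moveY_nonneg (st : State dx dy) : 0 ≤ st.moveY :=
  blockMean_nonneg fun i => by positivity

lemma moveH_nonneg (st : State dx dy) : 0 ≤ st.moveH :=
  blockMean_nonneg fun i => by positivity

lemma blockMean_move (hm : 1 ≤ m) (st : State dx dy) :
    blockMean (fun i => ‖st.x - st.xPrev‖ ^ 2 + ‖st.y i - st.yPrev i‖ ^ 2)
      = st.moveX + st.moveY := by
  rw [blockMean_add, blockMean_const hm]
  rfl

end State

namespace Problem

variable {m dx : ℕ} {dy : Fin m → ℕ} {Ξ Z : Fin m → Type*}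
  [∀ i, MeasurableSpace (Ξ i)] [∀ i, MeasurableSpace (Z i)]
  {p : Problem m dx dy Ξ Z}

lemma errS_nonneg (st : State dx dy) : 0 ≤ p.errS st := blockMean_nonneg fun i => by positivity

lemma errH_nonneg (st : State dx dy) : 0 ≤ p.errH st := blockMean_nonneg fun i => frobSq_nonneg _

lemma errZ_nonneg (st : State dx dy) : 0 ≤ p.errZ st := by unfold errZ; positivity

lemma errY_nonneg (st : State dx dy) : 0 ≤ p.errY st := blockMean_nonneg fun i => by positivity

variable {K : Consts} {D : ℕ} (h : p.Standing K D) {b I : ℕ}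

namespace Standing

include h

lemma isProbabilityMeasure_iterLaw (hI : I ≤ m) : IsProbabilityMeasure (iterLaw p I b) := by
  have := h.isProbabilityMeasure_batchLaw b
  have := isProbabilityMeasure_blockLaw hI
  unfold iterLaw
  infer_instance

/-- Expectation of a quantity that changes only if its block is sampled. -/
lemma meanLE_ite_mem (hI1 : 1 ≤ I) (hI : I ≤ m) (i : Fin m) {ψ : Batches Ξ Z b → ℝ} {c₁ c₂ : ℝ}
    (hψ : MeanLE (batchLaw p b) ψ c₁) :
    MeanLE (iterLaw p I b) (fun w => if i ∈ w.1 then ψ w.2 else c₂)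
      ((I / m : ℝ) * c₁ + (1 - I / m) * c₂) := by
  have := h.isProbabilityMeasure_batchLaw b
  obtain ⟨U, h1, h2, h3⟩ := hψ
  obtain ⟨k1, k2⟩ := integral_ite_mem_else (batchLaw p b) hI1 hI i h2 c₂
  refine ⟨fun w => if i ∈ w.1 then U w.2 else c₂, fun w => ?_, k1, k2.trans_le ?_⟩
  · dsimp only
    split_ifs
    exacts [h1 _, le_rfl]
  · gcongr

lemma gy_sub_sq_le (i : Fin m) (x x' : Vec dx) (y y' : Vec (dy i)) (ζ : Z i) :
    ‖p.gy i x y ζ - p.gy i x' y' ζ‖ ^ 2 ≤ K.Lgy ^ 2 * (‖x - x'‖ ^ 2 + ‖y - y'‖ ^ 2) :=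
  (h.sto.gy_lip i ζ).norm_sub_sq_le x y x' y'

/-- After the step the estimators refer to the point (x, y) at which they were sampled. So a sampled
block follows the estimator recursion, while an idle block keeps s and has its target displaced;
`estimator_contraction` averages the two cases. -/
lemma meanLE_errS (hb : 1 ≤ b) (hI1 : 1 ≤ I) (hI : I ≤ m) {c : Steps} (ha : 0 ≤ c.α)
    (ha2 : c.α ≤ 1 / 2) (st : State dx dy) :
    MeanLE (iterLaw p I b) (fun w => p.errS (step p K.lam I c w st))
      ((1 - I / m * c.α) * p.errS st + 2 * (I / m) * c.α ^ 2 * (K.σ ^ 2 / b)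
        + 13 * K.Lgy ^ 2 / (I / m) * (st.moveX + st.moveY)) := by
  have hm := hI1.trans hI
  have hblock : ∀ i, MeanLE (iterLaw p I b)
      (fun w => ‖(step p K.lam I c w st).s i - p.gyBar i st.x (st.y i)‖ ^ 2)
      ((1 - I / m * c.α) * ‖st.s i - p.gyBar i st.xPrev (st.yPrev i)‖ ^ 2
        + 2 * (I / m) * c.α ^ 2 * (K.σ ^ 2 / b)
        + 13 * K.Lgy ^ 2 / (I / m) * (‖st.x - st.xPrev‖ ^ 2 + ‖st.y i - st.yPrev i‖ ^ 2)) := by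
    intro i
    have := h.probQ i
    have hv := integral_norm_sub_sq_le_of_lintegral (h.gy_meas i st.x (st.y i)).aestronglyMeasurable
      (h.sto.gy_var i st.x (st.y i))
    have e1 := h.integral_gy i st.x (st.y i)
    have e2 := h.integral_gy i st.xPrev (st.yPrev i)
    have h1 := meanLE_estimator (b := b) (v := K.σ ^ 2) (h.gy_memLp i st.x (st.y i))
      (h.gy_memLp i st.xPrev (st.yPrev i)) (h.gy_meas i st.x (st.y i)) (by rw [e1]; exact hv)
      (h.gy_sub_sq_le i st.x st.xPrev (st.y i) (st.yPrev i)) hb c.α (msvrGamma m I c.α) (st.s i)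
    rw [e1, e2] at h1
    have h2 := h.meanLE_ite_mem hI1 hI i (c₂ := ‖st.s i - p.gyBar i st.x (st.y i)‖ ^ 2)
      (h1.comp_measurePreserving (h.measurePreserving_batch_snd b i))
    refine (h2.mono ?_).of_le fun w => le_of_eq ?_
    · have h3 := estimator_contraction hI1 hI ha ha2
        (st.s i - p.gyBar i st.xPrev (st.yPrev i))
        (p.gyBar i st.x (st.y i) - p.gyBar i st.xPrev (st.yPrev i))
        ((h.gyBar_lip i).norm_sub_sq_le st.x (st.y i) st.xPrev (st.yPrev i)) (K.σ ^ 2 / b)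
      rw [sub_sub_sub_cancel_right] at h3
      refine h3.trans (le_of_eq ?_)
      ring
    · simp only [step]
      split_ifs <;> rfl
  refine ((MeanLE.blockMean hblock).mono (le_of_eq ?_)).of_le fun w => le_rfl
  rw [blockMean_add, blockMean_add, blockMean_mul, blockMean_const hm, blockMean_mul,
    st.blockMean_move hm]
  rfl

omit h in
lemma batchMean_entries {S : Type*} {n : ℕ} (φ : S → Vec n →L[ℝ] Vec n) (w : Fin b → S) :
    batchMean (fun s => entries n (φ s)) w = entries n (batchMean φ w) := by
  simp [batchMean]

lemma entries_gyy_memLp (i : Fin m) (x : Vec dx) (y : Vec (dy i)) :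
    MemLp (fun ζ => entries (dy i) (p.gyy i x y ζ)) 2 (p.Q i) :=
  (entries (dy i)).toContinuousLinearMap.comp_memLp' (h.gyy_memLp i x y)

lemma entries_gyy_meas (i : Fin m) (x : Vec dx) (y : Vec (dy i)) :
    Measurable fun ζ => entries (dy i) (p.gyy i x y ζ) :=
  (entries (dy i)).toContinuousLinearMap.continuous.measurable.comp (h.gyy_meas i x y)

lemma integral_entries_gyy (i : Fin m) (x : Vec dx) (y : Vec (dy i)) :
    ∫ ζ, entries (dy i) (p.gyy i x y ζ) ∂(p.Q i) = entries (dy i) (p.gyyBar i x y) := by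
  rw [← h.integral_gyy]
  exact (entries (dy i)).toContinuousLinearMap.integral_comp_comm (h.gyy_int i x y)

/-- The factor D is the price of passing from the spectral norm of the variance assumption to the
Frobenius norm. -/
lemma integral_entries_gyy_sub_le (i : Fin m) (x : Vec dx) (y : Vec (dy i)) :
    ∫ ζ, ‖entries (dy i) (p.gyy i x y ζ) - entries (dy i) (p.gyyBar i x y)‖ ^ 2 ∂(p.Q i)
      ≤ D * K.σ ^ 2 := by
  have := h.probQ i
  have h1 := integral_norm_sub_sq_le_of_lintegral (h.gyy_meas i x y).aestronglyMeasurable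
    (h.sto.gyy_var i x y)
  have i1 : Integrable (fun ζ => ‖p.gyy i x y ζ - p.gyyBar i x y‖ ^ 2) (p.Q i) :=
    integrable_norm_sq ((h.gyy_memLp i x y).sub (memLp_const _))
  calc _ ≤ ∫ ζ, D * ‖p.gyy i x y ζ - p.gyyBar i x y‖ ^ 2 ∂(p.Q i) := by
        refine integral_mono (integrable_norm_sq ((h.entries_gyy_memLp i x y).sub
          (memLp_const _))) (i1.const_mul _) fun ζ => ?_
        dsimp only
        rw [← map_sub, norm_entries_sq]
        exact frobSq_le (h.dim i) _
    _ ≤ _ := by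
        rw [integral_const_mul]
        gcongr

lemma entries_gyy_sub_sq_le (i : Fin m) (x x' : Vec dx) (y y' : Vec (dy i)) (ζ : Z i) :
    ‖entries (dy i) (p.gyy i x y ζ) - entries (dy i) (p.gyy i x' y' ζ)‖ ^ 2
      ≤ D * K.Lgyy ^ 2 * (‖x - x'‖ ^ 2 + ‖y - y'‖ ^ 2) := by
  rw [← map_sub, norm_entries_sq, mul_assoc]
  refine (frobSq_le (h.dim i) _).trans ?_
  gcongr
  exact (h.sto.gyy_lip i ζ).norm_sub_sq_le x y x' y'

lemma entries_gyyBar_sub_sq_le (i : Fin m) (x x' : Vec dx) (y y' : Vec (dy i)) :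
    ‖entries (dy i) (p.gyyBar i x y) - entries (dy i) (p.gyyBar i x' y')‖ ^ 2
      ≤ D * K.Lgyy ^ 2 * (‖x - x'‖ ^ 2 + ‖y - y'‖ ^ 2) := by
  rw [← map_sub, norm_entries_sq, mul_assoc]
  refine (frobSq_le (h.dim i) _).trans ?_
  gcongr
  exact (h.gyyBar_lip i).norm_sub_sq_le x y x' y'

/-- The recursion of `meanLE_errS` for the matrix entries; the projection comes last and only
decreases the Frobenius distance to the true Hessian. -/
lemma meanLE_errH (hb : 1 ≤ b) (hI1 : 1 ≤ I) (hI : I ≤ m) {c : Steps} (ha : 0 ≤ c.αb)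
    (ha2 : c.αb ≤ 1 / 2) (st : State dx dy) :
    MeanLE (iterLaw p I b) (fun w => p.errH (step p K.lam I c w st))
      ((1 - I / m * c.αb) * p.errH st + 2 * (I / m) * c.αb ^ 2 * (D * K.σ ^ 2 / b)
        + 13 * (D * K.Lgyy ^ 2) / (I / m) * (st.moveX + st.moveY)) := by
  have hm := hI1.trans hI
  have hblock : ∀ i, MeanLE (iterLaw p I b)
      (fun w => frobSq ((step p K.lam I c w st).H i - p.gyyBar i st.x (st.y i)))
      ((1 - I / m * c.αb) * frobSq (st.H i - p.gyyBar i st.xPrev (st.yPrev i))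
        + 2 * (I / m) * c.αb ^ 2 * (D * K.σ ^ 2 / b)
        + 13 * (D * K.Lgyy ^ 2) / (I / m)
          * (‖st.x - st.xPrev‖ ^ 2 + ‖st.y i - st.yPrev i‖ ^ 2)) := by
    intro i
    have := h.probQ i
    have hv := h.integral_entries_gyy_sub_le i st.x (st.y i)
    have e1 := h.integral_entries_gyy i st.x (st.y i)
    have e2 := h.integral_entries_gyy i st.xPrev (st.yPrev i)
    have h1 := meanLE_estimator (b := b) (v := D * K.σ ^ 2) (h.entries_gyy_memLp i st.x (st.y i))
      (h.entries_gyy_memLp i st.xPrev (st.yPrev i)) (h.entries_gyy_meas i st.x (st.y i))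
      (by rw [e1]; exact hv)
      (h.entries_gyy_sub_sq_le i st.x st.xPrev (st.y i) (st.yPrev i)) hb c.αb
      (msvrGamma m I c.αb) (entries _ (st.H i))
    rw [e1, e2] at h1
    have h2 := h.meanLE_ite_mem hI1 hI i (c₂ := frobSq (st.H i - p.gyyBar i st.x (st.y i)))
      (h1.comp_measurePreserving (h.measurePreserving_batch_snd b i))
    refine (h2.mono ?_).of_le fun w => ?_
    · have h3 := estimator_contraction hI1 hI ha ha2
        (entries _ (st.H i) - entries _ (p.gyyBar i st.xPrev (st.yPrev i)))
        (entries _ (p.gyyBar i st.x (st.y i)) - entries _ (p.gyyBar i st.xPrev (st.yPrev i)))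
        (h.entries_gyyBar_sub_sq_le i st.x st.xPrev (st.y i) (st.yPrev i)) (D * K.σ ^ 2 / b)
      rw [sub_sub_sub_cancel_right, ← norm_entries_sq, ← norm_entries_sq, map_sub, map_sub] at *
      refine h3.trans (le_of_eq ?_)
      ring
    · simp only [step]
      split_ifs
      · refine (frobSq_proj_sub_le K.lam _ (h.gyyBar_mem_geSet i st.x (st.y i))).trans
          (le_of_eq ?_)
        rw [← norm_entries_sq]
        simp only [batchMean_entries, map_sub, map_add, map_smul]
      · exact le_rfl
  refine ((MeanLE.blockMean hblock).mono (le_of_eq ?_)).of_le fun w => le_rfl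
  rw [blockMean_add, blockMean_add, blockMean_mul, blockMean_const hm, blockMean_mul,
    st.blockMean_move hm]
  rfl

omit h in
-- The parameter is of order m/I, so q γ is bounded by 2; a sampled block applies γ only with
-- probability q.
lemma msvrGamma_sq_le (hI1 : 1 ≤ I) (hI : I ≤ m) {a : ℝ} (ha : 0 ≤ a) (ha2 : a ≤ 1 / 2) :
    (I / m : ℝ) * msvrGamma m I a ^ 2 ≤ 4 / (I / m) := by
  have hI0 : (0 : ℝ) < I := by exact_mod_cast hI1
  have hm0 : (0 : ℝ) < m := by exact_mod_cast hI1.trans hI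
  have hIm : (I : ℝ) ≤ m := by exact_mod_cast hI
  have ha1 : 0 < 1 - a := by linarith
  set q : ℝ := I / m with hq
  have hq0 : 0 < q := by positivity
  have hq1 : q ≤ 1 := (div_le_one hm0).2 hIm
  have h0 : 0 ≤ msvrGamma m I a :=
    add_nonneg (div_nonneg (by linarith) (by positivity)) ha1.le
  have h1 : q * msvrGamma m I a ≤ 2 := by
    have e : q * msvrGamma m I a = (1 - q) / (1 - a) + q * (1 - a) := by
      rw [msvrGamma, hq]
      field_simp
    have h2 : (1 - q) / (1 - a) ≤ 2 * (1 - q) := by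
      rw [div_le_iff₀ ha1]
      nlinarith
    rw [e]
    nlinarith
  rw [le_div_iff₀ hq0]
  nlinarith [mul_nonneg hq0.le h0]

/-- Only sampled blocks move. The current H lies in the set, so the projected displacement is at
most the unprojected one; the movement thus has order qᾱ² times error and noise, and 1/q times the
last steps in x and y. -/
lemma meanLE_moveH (hb : 1 ≤ b) (hI1 : 1 ≤ I) (hI : I ≤ m) {c : Steps} (ha : 0 ≤ c.αb)
    (ha2 : c.αb ≤ 1 / 2) {st : State dx dy} (hst : st.Valid K.lam) :
    MeanLE (iterLaw p I b) (fun w => (step p K.lam I c w st).moveH)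
      (4 * (I / m) * c.αb ^ 2 * (p.errH st + D * K.σ ^ 2 / b)
        + 20 * (D * K.Lgyy ^ 2) / (I / m) * (st.moveX + st.moveY)) := by
  have hm := hI1.trans hI
  have hI0 : (0 : ℝ) < I := by exact_mod_cast hI1
  have hm0 : (0 : ℝ) < m := by exact_mod_cast hm
  have hq1 : (I / m : ℝ) ≤ 1 := (div_le_one hm0).2 (by exact_mod_cast hI)
  have hq0 : (0 : ℝ) < I / m := by positivity
  have hγ := msvrGamma_sq_le hI1 hI ha ha2
  have hblock : ∀ i, MeanLE (iterLaw p I b)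
      (fun w => ‖(step p K.lam I c w st).H i - st.H i‖ ^ 2)
      (4 * (I / m) * c.αb ^ 2 * frobSq (st.H i - p.gyyBar i st.xPrev (st.yPrev i))
        + 4 * (I / m) * c.αb ^ 2 * (D * K.σ ^ 2 / b)
        + 20 * (D * K.Lgyy ^ 2) / (I / m)
          * (‖st.x - st.xPrev‖ ^ 2 + ‖st.y i - st.yPrev i‖ ^ 2)) := by
    intro i
    have := h.probQ i
    have hv := h.integral_entries_gyy_sub_le i st.x (st.y i)
    have e1 := h.integral_entries_gyy i st.x (st.y i)
    set ℓ := D * K.Lgyy ^ 2 * (‖st.x - st.xPrev‖ ^ 2 + ‖st.y i - st.yPrev i‖ ^ 2) with hℓ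
    have hℓ0 : 0 ≤ ℓ := by positivity
    have h1 := meanLE_estimator_move (b := b) (v := D * K.σ ^ 2) (h.entries_gyy_memLp i st.x (st.y i))
      (h.entries_gyy_meas i st.x (st.y i)) (by rw [e1]; exact hv)
      (h.entries_gyy_sub_sq_le i st.x st.xPrev (st.y i) (st.yPrev i))
      (by rw [e1]; exact h.entries_gyyBar_sub_sq_le i st.x st.xPrev (st.y i) (st.yPrev i)) hb c.αb
      (msvrGamma m I c.αb) (entries _ (st.H i))
    rw [← map_sub, norm_entries_sq, ← hℓ] at h1
    have h2 := h.meanLE_ite_mem hI1 hI i (c₂ := 0)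
      (h1.comp_measurePreserving (h.measurePreserving_batch_snd b i))
    refine (h2.mono ?_).of_le fun w => ?_
    · have k1 : (I / m : ℝ) * (c.αb ^ 2 * ℓ) ≤ ℓ / (I / m) := by
        rw [le_div_iff₀ hq0]
        have : (I / m : ℝ) * c.αb ^ 2 * (I / m) ≤ 1 := by
          have a1 : c.αb ^ 2 ≤ 1 := by nlinarith
          calc (I / m : ℝ) * c.αb ^ 2 * (I / m) ≤ 1 * 1 * 1 := by gcongr
            _ = 1 := by norm_num
        nlinarith
      have k2 : (I / m : ℝ) * (msvrGamma m I c.αb ^ 2 * ℓ) ≤ 4 * (ℓ / (I / m)) := by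
        calc _ = ((I / m : ℝ) * msvrGamma m I c.αb ^ 2) * ℓ := by ring
          _ ≤ 4 / (I / m) * ℓ := by gcongr
          _ = _ := by ring
      have k3 : 20 * (D * K.Lgyy ^ 2) / (I / m)
          * (‖st.x - st.xPrev‖ ^ 2 + ‖st.y i - st.yPrev i‖ ^ 2) = 20 * (ℓ / (I / m)) := by
        rw [hℓ]
        ring
      rw [k3]
      linarith
    · simp only [step]
      split_ifs
      · refine (norm_sq_le_frobSq _).trans
          ((frobSq_proj_sub_le K.lam _ (hst.1 i)).trans (le_of_eq ?_))
        rw [← norm_entries_sq]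
        simp only [batchMean_entries, map_sub, map_add, map_smul]
      · simp
  refine ((MeanLE.blockMean hblock).mono (le_of_eq ?_)).of_le fun w => le_rfl
  rw [blockMean_add, blockMean_add, blockMean_mul, blockMean_const hm, blockMean_mul,
    st.blockMean_move hm, errH]
  ring

end Standing

end Problem


/-- A gradient step for a strongly monotone Lipschitz field `g` with an inexact direction `s`,
followed by a move of the target from `v - y` to `v - y'`. -/
lemma norm_inexact_step_sq_le {V : Type*} [NormedAddCommGroup V] [InnerProductSpace ℝ V]
    {v g s r : V} {a lam L : ℝ} (ha : 0 < a) (hlam : 0 < lam) (hmono : lam * ‖v‖ ^ 2 ≤ inner ℝ g v)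
    (hlip : ‖g‖ ≤ L * ‖v‖) (h1 : a * L ^ 2 ≤ lam) (h2 : a * lam ≤ 1) :
    ‖v - a • s + r‖ ^ 2 ≤ (1 - a * lam / 2) * ‖v‖ ^ 2 + 13 / 2 * a / lam * ‖s - g‖ ^ 2
      + 6 / (a * lam) * ‖r‖ ^ 2 := by
  -- Young's inequality is used twice with this parameter. The exact gradient step contracts by 1 -
  -- 4t, and (1 + t)²(1 - 4t) ≤ 1 - 2t.
  set t := a * lam / 4 with ht
  have ht0 : 0 < t := by positivity
  have ht1 : t ≤ 1 / 4 := by linarith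
  have k1 := norm_add_sq_le_young (v - a • s) r ht0
  have k2 := norm_add_sq_le_young (v - a • g) (-(a • (s - g))) ht0
  rw [show v - a • g + -(a • (s - g)) = v - a • s by module, norm_neg, norm_smul, mul_pow,
    Real.norm_eq_abs, sq_abs] at k2
  have k3 : ‖v - a • g‖ ^ 2 ≤ (1 - 4 * t) * ‖v‖ ^ 2 := by
    rw [norm_sub_sq_real, inner_smul_right, norm_smul, mul_pow, Real.norm_eq_abs, sq_abs,
      real_inner_comm]
    have k4 : ‖g‖ ^ 2 ≤ L ^ 2 * ‖v‖ ^ 2 := by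
      rw [← mul_pow]
      gcongr
    have k5 : a ^ 2 * ‖g‖ ^ 2 ≤ a * lam * ‖v‖ ^ 2 := by
      calc a ^ 2 * ‖g‖ ^ 2 ≤ a ^ 2 * (L ^ 2 * ‖v‖ ^ 2) := by gcongr
        _ = a * (a * L ^ 2) * ‖v‖ ^ 2 := by ring
        _ ≤ a * lam * ‖v‖ ^ 2 := by gcongr
    have k6 := mul_le_mul_of_nonneg_left hmono ha.le
    have e : 4 * t = a * lam := by rw [ht]; ring
    rw [e]
    linarith
  have hinv : 1 / t = 4 / (a * lam) := by rw [ht]; field_simp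
  have e1 : 1 + 1 / t ≤ 6 / (a * lam) := by
    have : 1 ≤ 1 / (a * lam) := by rw [le_div_iff₀ (by positivity)]; linarith
    have e : 6 / (a * lam) = 6 * (1 / (a * lam)) := by ring
    have e' : 4 / (a * lam) = 4 * (1 / (a * lam)) := by ring
    rw [hinv, e, e']
    linarith
  have e2 : (1 + t) * ((1 + 1 / t) * a ^ 2) ≤ 13 / 2 * a / lam := by
    have e : (1 + t) * ((1 + 1 / t) * a ^ 2) * t = (1 + t) ^ 2 * a ^ 2 := by
      field_simp
      ring
    have h3 : (1 + t) ^ 2 ≤ 13 / 8 := by nlinarith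
    have h4 : 13 / 2 * a / lam * t = 13 / 8 * a ^ 2 := by rw [ht]; field_simp; ring
    refine le_of_mul_le_mul_right ?_ ht0
    rw [e, h4]
    gcongr
  have e3 : (1 + t) * ((1 + t) * (1 - 4 * t)) ≤ 1 - a * lam / 2 := by
    have : a * lam / 2 = 2 * t := by rw [ht]; ring
    rw [this]
    nlinarith [pow_pos ht0 2, pow_pos ht0 3]
  calc ‖v - a • s + r‖ ^ 2
      ≤ (1 + t) * ((1 + t) * ((1 - 4 * t) * ‖v‖ ^ 2) + (1 + 1 / t) * (a ^ 2 * ‖s - g‖ ^ 2))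
        + (1 + 1 / t) * ‖r‖ ^ 2 := by
        refine k1.trans ?_
        gcongr
        refine k2.trans ?_
        gcongr
    _ = (1 + t) * ((1 + t) * (1 - 4 * t)) * ‖v‖ ^ 2 + (1 + t) * ((1 + 1 / t) * a ^ 2) * ‖s - g‖ ^ 2
        + (1 + 1 / t) * ‖r‖ ^ 2 := by ring
    _ ≤ _ := by gcongr

/-! ### Estimates for one iteration of the algorithm -/

namespace Problem

variable {m dx : ℕ} {dy : Fin m → ℕ} {Ξ Z : Fin m → Type*}
  [∀ i, MeasurableSpace (Ξ i)] [∀ i, MeasurableSpace (Z i)]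
  {p : Problem m dx dy Ξ Z} {K : Consts} {D : ℕ} (h : p.Standing K D) {b I : ℕ}

namespace Standing

include h

/-- Variance of the sampled hyper-gradient. -/
lemma integral_hyperGrad_sub_sq_le (hb : 1 ≤ b) (i : Fin m) (x : Vec dx) (y : Vec (dy i))
    {H : Vec (dy i) →L[ℝ] Vec (dy i)} (hH : H ∈ geSet K.lam) :
    ∫ w : Batches Ξ Z b, ‖hyperGrad p i x y H w - p.hyperMean i x y H‖ ^ 2 ∂(batchLaw p b)
      ≤ K.hyperVar D / b := by
  have := h.isProbabilityMeasure_batchLaw b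
  obtain ⟨e, ⟨U, h1, h2, h3⟩, h4⟩ := h.exists_hyperGrad_bound hb i x y
  refine le_trans ?_ h3
  exact integral_mono (integrable_norm_sq ((h.hyperGrad_memLp hb i x y hH).sub (memLp_const _))) h2
    fun w => (h4 w H hH).trans (h1 w)

/-- Mean-square Lipschitz continuity of the stochastic hyper-gradient, as an integral. -/
lemma integral_hyperGrad_sub_hyperGrad_sq_le (hb : 1 ≤ b) (i : Fin m) (x x' : Vec dx)
    (y y' : Vec (dy i)) {H H' : Vec (dy i) →L[ℝ] Vec (dy i)} (hH : H ∈ geSet K.lam)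
    (hH' : H' ∈ geSet K.lam) :
    ∫ w : Batches Ξ Z b, ‖hyperGrad p i x y H w - hyperGrad p i x' y' H' w‖ ^ 2 ∂(batchLaw p b)
      ≤ K.hyperLip * (‖x - x'‖ ^ 2 + ‖y - y'‖ ^ 2 + ‖H - H'‖ ^ 2) := by
  obtain ⟨U, h1, h2, h3⟩ := h.meanLE_hyperGrad_sub hb i x x' y y' hH hH'
  refine le_trans ?_ h3
  exact integral_mono (integrable_norm_sq ((h.hyperGrad_memLp hb i x y hH).sub
    (h.hyperGrad_memLp hb i x' y' hH'))) h2 h1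

/-- Both hyper-gradients use the same samples, so the noise entering with coefficient 1 - β is that
of their difference and is bounded by the movement; the full variance enters only with β². -/
lemma meanLE_errZ (hb : 1 ≤ b) (hI1 : 1 ≤ I) (hI : I ≤ m) {c : Steps} (h0 : 0 ≤ c.β)
    (h1 : c.β ≤ 1) {st : State dx dy} (hst : st.Valid K.lam) :
    MeanLE (iterLaw p I b) (fun w => p.errZ (step p K.lam I c w st))
      ((1 - c.β) * p.errZ st
        + 2 * c.β ^ 2 * (2 * (K.hyperVar D / b)
          + 2 * ((if I < m then 1 / (I : ℝ) else 0) * K.hyperBound ^ 2))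
        + 2 * (K.hyperLip * (st.moveX + st.moveY + st.moveH))) := by
  have hm := hI1.trans hI
  have := h.isProbabilityMeasure_batchLaw b
  have hprob := h.isProbabilityMeasure_iterLaw (b := b) hI
  set u : Fin m → Batches Ξ Z b → Vec dx := fun i w => hyperGrad p i st.x (st.y i) (st.H i) w
    with hu
  set u' : Fin m → Batches Ξ Z b → Vec dx :=
    fun i w => hyperGrad p i st.xPrev (st.yPrev i) (st.HPrev i) w with hu'
  have mu : ∀ i, MemLp (u i) 2 (batchLaw p b) := fun i => h.hyperGrad_memLp hb i _ _ (hst.1 i)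
  have mu' : ∀ i, MemLp (u' i) 2 (batchLaw p b) := fun i => h.hyperGrad_memLp hb i _ _ (hst.2 i)
  have eu : ∀ i, ∫ w, u i w ∂(batchLaw p b) = p.hyperMean i st.x (st.y i) (st.H i) :=
    fun i => h.integral_hyperGrad hb i _ _ (hst.1 i)
  have eu' : ∀ i, ∫ w, u' i w ∂(batchLaw p b)
      = p.hyperMean i st.xPrev (st.yPrev i) (st.HPrev i) :=
    fun i => h.integral_hyperGrad hb i _ _ (hst.2 i)
  set G : IterSample Ξ Z b → Vec dx := fun w => (I : ℝ)⁻¹ • ∑ i ∈ w.1, u i w.2 with hG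
  set G' : IterSample Ξ Z b → Vec dx := fun w => (I : ℝ)⁻¹ • ∑ i ∈ w.1, u' i w.2 with hG'
  set c₁ := p.hyperAvg st.x st.y st.H with hc₁
  set c₂ := p.hyperAvg st.xPrev st.yPrev st.HPrev with hc₂
  have mG : MemLp G 2 (iterLaw p I b) := memLp_blockAvg (batchLaw p b) hI mu
  have mG' : MemLp G' 2 (iterLaw p I b) := memLp_blockAvg (batchLaw p b) hI mu'
  have eG : ∫ w, G w ∂(iterLaw p I b) = c₁ := by
    refine (integral_blockAvg (batchLaw p b) hI1 hI fun i => (mu i).integrable (by norm_num)).trans ?_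
    simp only [eu]
    rfl
  have eG' : ∫ w, G' w ∂(iterLaw p I b) = c₂ := by
    refine (integral_blockAvg (batchLaw p b) hI1 hI fun i => (mu' i).integrable (by norm_num)).trans ?_
    simp only [eu']
    rfl
  have eD : ∫ w, (G w - G' w) ∂(iterLaw p I b) = c₁ - c₂ := by
    rw [integral_sub (mG.integrable (by norm_num)) (mG'.integrable (by norm_num)), eG, eG']
  have b₁ : ∫ w, ‖G w - c₁‖ ^ 2 ∂(iterLaw p I b) ≤ 2 * (K.hyperVar D / b)
      + 2 * ((if I < m then 1 / (I : ℝ) else 0) * K.hyperBound ^ 2) := by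
    have k := integral_norm_blockAvg_sub_mean_sq_le (batchLaw p b) hI1 hI mu
      (c := K.hyperBound ^ 2) (v := K.hyperVar D / b)
      (fun i => by
        rw [eu]
        exact pow_le_pow_left₀ (norm_nonneg _) (h.norm_hyperMean_le i _ _ (hst.1 i)) 2)
      (fun i => by
        rw [eu]
        exact h.integral_hyperGrad_sub_sq_le hb i _ _ (hst.1 i))
    simp only [eu] at k
    exact k
  have b₂ : ∫ w, ‖(G w - G' w) - (c₁ - c₂)‖ ^ 2 ∂(iterLaw p I b)
      ≤ K.hyperLip * (st.moveX + st.moveY + st.moveH) := by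
    have k := integral_norm_sub_mean_sq_le (mG.sub mG')
    simp only [Pi.sub_apply] at k
    rw [eD] at k
    refine k.trans ?_
    have k2 := integral_norm_blockAvg_sq_le (batchLaw p b) hI1 hI fun i => (mu i).sub (mu' i)
    have e : ∀ w : IterSample Ξ Z b, G w - G' w = (I : ℝ)⁻¹ • ∑ i ∈ w.1, (u i - u' i) w.2 :=
      fun w => by simp [hG, hG', Finset.sum_sub_distrib, smul_sub]
    simp only [e]
    refine k2.trans ?_
    have e3 : K.hyperLip * (st.moveX + st.moveY + st.moveH) = blockMean fun i =>
        K.hyperLip * (‖st.x - st.xPrev‖ ^ 2 + ‖st.y i - st.yPrev i‖ ^ 2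
          + ‖st.H i - st.HPrev i‖ ^ 2) := by
      rw [blockMean_mul, blockMean_add, st.blockMean_move hm]
      rfl
    rw [e3]
    exact blockMean_mono fun i =>
      h.integral_hyperGrad_sub_hyperGrad_sq_le hb i _ _ _ _ (hst.1 i) (hst.2 i)
  -- The new error is (1 - β) times the old one plus β times the centred G plus 1 - β times the
  -- centred G - G'.
  have key := meanLE_const_add_comb (mG.sub (memLp_const c₁))
    ((mG.sub mG').sub (memLp_const (c₁ - c₂)))
    (integral_sub_mean_eq_zero (mG.integrable (by norm_num)) eG)
    (integral_sub_mean_eq_zero ((mG.sub mG').integrable (by norm_num)) eD) b₁ b₂ c.β (1 - c.β)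
    ((1 - c.β) • (st.z - c₂))
  refine (key.mono ?_).of_le fun w => le_of_eq ?_
  · rw [norm_smul, mul_pow, Real.norm_eq_abs, sq_abs]
    have hz : ‖st.z - c₂‖ ^ 2 = p.errZ st := rfl
    have n1 := errZ_nonneg (p := p) st
    have n2 : 0 ≤ K.hyperLip * (st.moveX + st.moveY + st.moveH) :=
      mul_nonneg K.hyperLip_nonneg
        (add_nonneg (add_nonneg st.moveX_nonneg st.moveY_nonneg) st.moveH_nonneg)
    have n3 : (1 - c.β) ^ 2 ≤ 1 - c.β := by nlinarith
    have n4 : (1 - c.β) ^ 2 ≤ 1 := by nlinarith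
    rw [hz]
    nlinarith [mul_le_mul_of_nonneg_right n3 n1, mul_le_mul_of_nonneg_right n4 n2]
  · simp only [errZ, step, Pi.sub_apply]
    congr 2
    change (1 - c.β) • (st.z - G' w) + G w - c₁ = _
    module

/-! ### Deterministic estimates for one iteration -/

omit h in
lemma step_valid {c : Steps} {w : IterSample Ξ Z b} {st : State dx dy} (hst : st.Valid K.lam) :
    (step p K.lam I c w st).Valid K.lam := by
  refine ⟨fun i => ?_, hst.1⟩
  simp only [step]
  split_ifs
  exacts [proj_mem_geSet _ _, hst.1 i]

omit h in
lemma step_moveX {c : Steps} {w : IterSample Ξ Z b} {st : State dx dy} :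
    (step p K.lam I c w st).moveX = c.η ^ 2 * ‖(step p K.lam I c w st).z‖ ^ 2 := by
  have e : (step p K.lam I c w st).x - (step p K.lam I c w st).xPrev
      = -(c.η • (step p K.lam I c w st).z) := by
    simp only [step]
    abel
  rw [State.moveX, e, norm_neg, norm_smul, mul_pow, Real.norm_eq_abs, sq_abs]

lemma norm_s_sub_gyBar_sq_le (st : State dx dy) (i : Fin m) :
    ‖st.s i - p.gyBar i st.x (st.y i)‖ ^ 2
      ≤ 2 * ‖st.s i - p.gyBar i st.xPrev (st.yPrev i)‖ ^ 2
        + 2 * (K.Lgy ^ 2 * (‖st.x - st.xPrev‖ ^ 2 + ‖st.y i - st.yPrev i‖ ^ 2)) := by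
  have k1 := norm_sub_sq_le_two (st.s i - p.gyBar i st.xPrev (st.yPrev i))
    (p.gyBar i st.x (st.y i) - p.gyBar i st.xPrev (st.yPrev i))
  rw [sub_sub_sub_cancel_right] at k1
  linarith [(h.gyBar_lip i).norm_sub_sq_le st.x (st.y i) st.xPrev (st.yPrev i)]

lemma norm_gyBar_le (i : Fin m) (x : Vec dx) (y : Vec (dy i)) :
    ‖p.gyBar i x y‖ ≤ K.Lg * ‖y - p.yStar i x‖ := by
  have := h.low.smooth i x y (p.yStar i x)
  have e : gradY (p.gBar i) x (p.yStar i x) = 0 := h.gyBar_yStar i x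
  rwa [e, sub_zero] at this

/-- One inexact gradient step for each block; the displacement r is that of the target y_i(x), of
size at most Ly times the step in x. -/
lemma errY_step_le (hm : 1 ≤ m) {c : Steps} (ha : 0 < c.τ * c.τt)
    (h1 : c.τ * c.τt * K.Lg ^ 2 ≤ K.lam) (h2 : c.τ * c.τt * K.lam ≤ 1) (w : IterSample Ξ Z b)
    (st : State dx dy) :
    p.errY (step p K.lam I c w st) ≤ (1 - c.τ * c.τt * K.lam / 2) * p.errY st
      + 13 * (c.τ * c.τt) / K.lam * (p.errS st + K.Lgy ^ 2 * (st.moveX + st.moveY))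
      + 6 * K.Ly ^ 2 / (c.τ * c.τt * K.lam) * (step p K.lam I c w st).moveX := by
  set a := c.τ * c.τt
  have hlam := K.lam_pos
  set st' := step p K.lam I c w st with hst'
  have hblock : ∀ i, ‖st'.y i - p.yStar i st'.x‖ ^ 2
      ≤ (1 - a * K.lam / 2) * ‖st.y i - p.yStar i st.x‖ ^ 2
        + 13 * a / K.lam * (‖st.s i - p.gyBar i st.xPrev (st.yPrev i)‖ ^ 2
          + K.Lgy ^ 2 * (‖st.x - st.xPrev‖ ^ 2 + ‖st.y i - st.yPrev i‖ ^ 2))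
        + 6 * K.Ly ^ 2 / (a * K.lam) * st'.moveX := by
    intro i
    have k0 : K.lam * ‖st.y i - p.yStar i st.x‖ ^ 2
        ≤ inner ℝ (p.gyBar i st.x (st.y i)) (st.y i - p.yStar i st.x) := by
      have := h.strong_monotone i st.x (st.y i) (p.yStar i st.x)
      rwa [h.gyBar_yStar, sub_zero] at this
    have k1 := norm_inexact_step_sq_le (v := st.y i - p.yStar i st.x)
      (g := p.gyBar i st.x (st.y i)) (s := st.s i) (r := p.yStar i st.x - p.yStar i st'.x)
      ha hlam k0 (h.norm_gyBar_le i st.x (st.y i)) h1 h2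
    have e : st'.y i - p.yStar i st'.x = st.y i - p.yStar i st.x - a • st.s i
        + (p.yStar i st.x - p.yStar i st'.x) := by
      have : st'.y i = st.y i - a • st.s i := rfl
      rw [this]
      abel
    rw [e]
    refine k1.trans ?_
    have k2 := h.norm_s_sub_gyBar_sq_le st i
    have k3 : ‖p.yStar i st.x - p.yStar i st'.x‖ ^ 2 ≤ K.Ly ^ 2 * st'.moveX := by
      have := pow_le_pow_left₀ (norm_nonneg _) (h.norm_yStar_sub_le i st.x st'.x) 2
      rw [mul_pow, norm_sub_rev st.x] at this
      exact this
    have k4 : 6 / (a * K.lam) * ‖p.yStar i st.x - p.yStar i st'.x‖ ^ 2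
        ≤ 6 / (a * K.lam) * (K.Ly ^ 2 * st'.moveX) := by gcongr
    have k5 := mul_le_mul_of_nonneg_left k2 (show 0 ≤ 13 / 2 * a / K.lam by positivity)
    have e1 : 6 / (a * K.lam) * (K.Ly ^ 2 * st'.moveX)
      = 6 * K.Ly ^ 2 / (a * K.lam) * st'.moveX := by ring
    have e2 : 13 * a / K.lam = 2 * (13 / 2 * a / K.lam) := by ring
    rw [e2]
    linarith
  refine (blockMean_mono hblock).trans (le_of_eq ?_)
  rw [blockMean_add, blockMean_add, blockMean_mul, blockMean_mul, blockMean_add, blockMean_mul,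
    st.blockMean_move hm, blockMean_const hm]
  rfl

/-- The direction s splits into its estimation error, the drift of the gradient since the last
point, and the current gradient, which is at most Lg times the distance to the minimiser. -/
lemma moveY_step_le (hm : 1 ≤ m) {c : Steps} (w : IterSample Ξ Z b) (st : State dx dy) :
    (step p K.lam I c w st).moveY ≤ 3 * (c.τ * c.τt) ^ 2
      * (p.errS st + K.Lgy ^ 2 * (st.moveX + st.moveY) + K.Lg ^ 2 * p.errY st) := by
  set a := c.τ * c.τt
  have hblock : ∀ i, ‖(step p K.lam I c w st).y i - (step p K.lam I c w st).yPrev i‖ ^ 2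
      ≤ 3 * a ^ 2 * (‖st.s i - p.gyBar i st.xPrev (st.yPrev i)‖ ^ 2
          + K.Lgy ^ 2 * (‖st.x - st.xPrev‖ ^ 2 + ‖st.y i - st.yPrev i‖ ^ 2)
          + K.Lg ^ 2 * ‖st.y i - p.yStar i st.x‖ ^ 2) := by
    intro i
    have e : (step p K.lam I c w st).y i - (step p K.lam I c w st).yPrev i = -(a • st.s i) := by
      simp only [step]
      abel
    rw [e, norm_neg, norm_smul, mul_pow, Real.norm_eq_abs, sq_abs]
    have k1 := norm_add_sq_le_three (st.s i - p.gyBar i st.xPrev (st.yPrev i))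
      (-(p.gyBar i st.x (st.y i) - p.gyBar i st.xPrev (st.yPrev i))) (p.gyBar i st.x (st.y i))
    rw [norm_neg, show st.s i - p.gyBar i st.xPrev (st.yPrev i)
      + -(p.gyBar i st.x (st.y i) - p.gyBar i st.xPrev (st.yPrev i)) + p.gyBar i st.x (st.y i)
      = st.s i by abel] at k1
    have k2 := (h.gyBar_lip i).norm_sub_sq_le st.x (st.y i) st.xPrev (st.yPrev i)
    have k3 := pow_le_pow_left₀ (norm_nonneg _) (h.norm_gyBar_le i st.x (st.y i)) 2
    rw [mul_pow] at k3
    have k4 : ‖st.s i‖ ^ 2 ≤ 3 * (‖st.s i - p.gyBar i st.xPrev (st.yPrev i)‖ ^ 2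
          + K.Lgy ^ 2 * (‖st.x - st.xPrev‖ ^ 2 + ‖st.y i - st.yPrev i‖ ^ 2)
          + K.Lg ^ 2 * ‖st.y i - p.yStar i st.x‖ ^ 2) := by linarith
    have k5 := mul_le_mul_of_nonneg_left k4 (sq_nonneg a)
    linarith
  refine (blockMean_mono hblock).trans (le_of_eq ?_)
  rw [blockMean_mul, blockMean_add, blockMean_add, blockMean_mul, blockMean_mul,
    st.blockMean_move hm]
  rfl

/-- The mean value inequality on the segment; the usual factor 1/2 in the quadratic term is given
away. -/
lemma F_le_of_gradient (x x' : Vec dx) :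
    p.F x' ≤ p.F x + inner ℝ (gradient p.F x) (x' - x) + K.LF * ‖x' - x‖ ^ 2 := by
  have hd : ∀ u, HasGradientAt p.F (gradient p.F u) u := fun u =>
    (h.differentiable_F u).hasGradientAt
  have key := Convex.norm_image_sub_le_of_norm_hasFDerivWithin_le' (𝕜 := ℝ) (f := p.F)
    (f' := fun u => innerSL ℝ (gradient p.F u)) (s := segment ℝ x x')
    (φ := innerSL ℝ (gradient p.F x)) (C := K.LF * ‖x' - x‖)
    (fun u _ => (hd u).hasFDerivAt.hasFDerivWithinAt) (fun u hu => ?_) (convex_segment x x')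
    (left_mem_segment ℝ x x') (right_mem_segment ℝ x x')
  · have := (le_abs_self _).trans key
    rw [innerSL_apply_apply] at this
    nlinarith
  · rw [← map_sub, innerSL_apply_norm]
    refine (h.norm_gradient_F_sub_le u x).trans ?_
    have := K.LF_pos
    gcongr
    obtain ⟨t, ⟨ht0, ht1⟩, rfl⟩ := (segment_eq_image' ℝ x x' ▸ hu)
    simp only [add_sub_cancel_left, norm_smul, Real.norm_of_nonneg ht0]
    exact mul_le_of_le_one_left (norm_nonneg _) ht1

/-- Descent of the objective in one iteration. -/
lemma F_step_le {c : Steps} (hη : 0 < c.η) (hηL : c.η * K.LF ≤ 1 / 4) (w : IterSample Ξ Z b)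
    (st : State dx dy) :
    p.F (step p K.lam I c w st).x ≤ p.F st.x - c.η / 2 * ‖gradient p.F st.x‖ ^ 2
      + c.η / 2 * ‖(step p K.lam I c w st).z - gradient p.F st.x‖ ^ 2
      - c.η / 4 * ‖(step p K.lam I c w st).z‖ ^ 2 := by
  set z := (step p K.lam I c w st).z with hz
  set g := gradient p.F st.x
  have k1 := h.F_le_of_gradient st.x (step p K.lam I c w st).x
  have e : (step p K.lam I c w st).x - st.x = -(c.η • z) := by
    have : (step p K.lam I c w st).x = st.x - c.η • z := rfl
    rw [this]
    abel
  rw [e, norm_neg, norm_smul, inner_neg_right, inner_smul_right, mul_pow, Real.norm_eq_abs,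
    sq_abs] at k1
  -- Polarisation turns -η⟨∇F, z⟩ into the three squares, and half of the negative ‖z‖² term absorbs
  -- the quadratic remainder.
  have k2 := norm_sub_sq_real z g
  rw [real_inner_comm] at k2
  have k3 : K.LF * (c.η ^ 2 * ‖z‖ ^ 2) ≤ c.η / 4 * ‖z‖ ^ 2 := by
    have : c.η * (c.η * K.LF) ≤ c.η * (1 / 4) := by gcongr
    nlinarith [sq_nonneg ‖z‖]
  rw [k2]
  linarith

/-- Error of the search direction. -/
lemma norm_z_sub_gradient_sq_le (hm : 1 ≤ m) {c : Steps} (w : IterSample Ξ Z b)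
    {st : State dx dy} (hst : st.Valid K.lam) :
    ‖(step p K.lam I c w st).z - gradient p.F st.x‖ ^ 2
      ≤ 2 * p.errZ (step p K.lam I c w st) + 2 * (K.hyperLip * (p.errY st
        + 3 * (p.errH st + K.Lgyy ^ 2 * (st.moveX + st.moveY) + K.Lgyy ^ 2 * p.errY st))) := by
  have k1 := norm_add_sq_le_two ((step p K.lam I c w st).z - p.hyperAvg st.x st.y st.H)
    (p.hyperAvg st.x st.y st.H - gradient p.F st.x)
  rw [sub_add_sub_cancel] at k1
  refine k1.trans (add_le_add le_rfl (mul_le_mul_of_nonneg_left ?_ (by norm_num)))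
  have hblock : ∀ i, ‖p.hyperMean i st.x (st.y i) (st.H i)
      - p.hyperMean i st.x (p.yStar i st.x) (p.gyyBar i st.x (p.yStar i st.x))‖ ^ 2
      ≤ K.hyperLip * (‖st.y i - p.yStar i st.x‖ ^ 2
        + 3 * (frobSq (st.H i - p.gyyBar i st.xPrev (st.yPrev i))
          + K.Lgyy ^ 2 * (‖st.x - st.xPrev‖ ^ 2 + ‖st.y i - st.yPrev i‖ ^ 2)
          + K.Lgyy ^ 2 * ‖st.y i - p.yStar i st.x‖ ^ 2)) := by
    intro i
    refine (h.norm_hyperMean_sub_sq_le i st.x st.x (st.y i) (p.yStar i st.x) (hst.1 i)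
      (h.gyyBar_mem_geSet i _ _)).trans ?_
    have hL := K.hyperLip_nonneg
    refine mul_le_mul_of_nonneg_left ?_ hL
    -- H is compared with the Hessian at y_i(x) through its own target at the previous point and
    -- through the Hessian at the current y.
    have k2 := norm_add_sq_le_three (st.H i - p.gyyBar i st.xPrev (st.yPrev i))
      (-(p.gyyBar i st.x (st.y i) - p.gyyBar i st.xPrev (st.yPrev i)))
      (p.gyyBar i st.x (st.y i) - p.gyyBar i st.x (p.yStar i st.x))
    rw [norm_neg, show st.H i - p.gyyBar i st.xPrev (st.yPrev i)
      + -(p.gyyBar i st.x (st.y i) - p.gyyBar i st.xPrev (st.yPrev i))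
      + (p.gyyBar i st.x (st.y i) - p.gyyBar i st.x (p.yStar i st.x))
      = st.H i - p.gyyBar i st.x (p.yStar i st.x) by abel] at k2
    have k3 := (h.gyyBar_lip i).norm_sub_sq_le st.x (st.y i) st.xPrev (st.yPrev i)
    have k4 := (h.gyyBar_lip i).norm_sub_sq_le st.x (st.y i) st.x (p.yStar i st.x)
    have k5 := norm_sq_le_frobSq (st.H i - p.gyyBar i st.xPrev (st.yPrev i))
    rw [sub_self, norm_zero] at k4 ⊢
    linarith
  have e : p.hyperAvg st.x st.y st.H - gradient p.F st.x
      = (m : ℝ)⁻¹ • ∑ i, (p.hyperMean i st.x (st.y i) (st.H i)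
        - p.hyperMean i st.x (p.yStar i st.x) (p.gyyBar i st.x (p.yStar i st.x))) := by
    rw [h.gradient_F, hyperAvg, Finset.sum_sub_distrib, smul_sub]
  rw [e]
  refine (norm_blockMean_sq_le hm _).trans ((blockMean_mono hblock).trans (le_of_eq ?_))
  rw [blockMean_mul, blockMean_add, blockMean_mul, blockMean_add, blockMean_add, blockMean_mul,
    blockMean_mul, st.blockMean_move hm]
  rfl

end Standing

end Problem


/-! ### The potential -/

namespace Consts

variable (K : Consts) (D : ℕ) (θ : ℝ)

/-- Weight of the error of the lower-level variables. -/
def wY : ℝ := 2 / K.lam * (K.hyperLip * (1 + 3 * K.Lgyy ^ 2) + 3 * K.Lg ^ 2)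

/-- Weight of the error of the Hessian estimators. -/
def wH : ℝ := 3 * K.hyperLip + 16 * K.hyperLip / θ

/-- Weight of the error of the lower-level gradient estimators. -/
def wS : ℝ := 13 * K.wY / K.lam + 3

/-- Bound for the influence of the length of a step. -/
def moveConst : ℝ :=
  3 * K.hyperLip * K.Lgyy ^ 2 + 4 * K.hyperLip + 80 * K.hyperLip * (D * K.Lgyy ^ 2)
    + 13 * K.wH θ * (D * K.Lgyy ^ 2) + 13 * K.wS * K.Lgy ^ 2 + 13 * K.wY * K.Lgy ^ 2 / K.lam
    + 3 * K.Lgy ^ 2 + (K.Lg ^ 2 / K.lam) ^ 2 + K.lam ^ 2 + 1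

/-- Lower bound for `a² / η²`, where `a` is the step size in `y` and `η` the one in `x`. -/
def ratioConst : ℝ := 8 + 48 * K.wY * K.Ly ^ 2 / K.lam

/-- Bound for the influence of the sampling noise. -/
def noiseConst : ℝ :=
  2 * K.wS * K.σ ^ 2 + 2 * K.wH θ * (D * K.σ ^ 2) + 16 * K.hyperLip * (D * K.σ ^ 2) / θ
    + 8 * (K.hyperVar D + K.hyperBound ^ 2) + 1

lemma wY_nonneg : 0 ≤ K.wY := by
  have := K.hyperLip_nonneg
  have := K.lam_pos
  unfold wY
  positivity

lemma wS_nonneg : 0 ≤ K.wS := by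
  have := K.wY_nonneg
  have := K.lam_pos
  unfold wS
  positivity

variable {θ}

lemma wH_nonneg (hθ : 0 < θ) : 0 ≤ K.wH θ := by
  have := K.hyperLip_nonneg
  unfold wH
  positivity

lemma moveConst_pos (hθ : 0 < θ) : 0 < K.moveConst D θ := by
  have := K.hyperLip_nonneg
  have := K.wY_nonneg
  have := K.wS_nonneg
  have := K.wH_nonneg hθ
  have := K.lam_pos
  unfold moveConst
  positivity

lemma ratioConst_pos : 0 < K.ratioConst := by
  have := K.wY_nonneg
  have := K.lam_pos
  unfold ratioConst
  positivity

lemma noiseConst_pos (hθ : 0 < θ) : 0 < K.noiseConst D θ := by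
  have := K.hyperLip_nonneg
  have := K.wS_nonneg
  have := K.wH_nonneg hθ
  have := K.hyperVar_nonneg D
  unfold noiseConst
  positivity

end Consts

/-- The relations between the step sizes used by the descent estimate. -/
structure Steps.Balanced (c : Steps) (K : Consts) (D : ℕ) (θ : ℝ) (m I : ℕ) : Prop where
  θ_pos : 0 < θ
  I_pos : 1 ≤ I
  I_le : I ≤ m
  α_pos : 0 < c.α
  α_le : c.α ≤ 1 / 2
  αb_pos : 0 < c.αb
  αb_le : c.αb ≤ 1 / 2
  β_pos : 0 < c.β
  β_le : c.β ≤ 1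
  αb_le_β : θ * c.αb ≤ c.β
  a_pos : 0 < c.τ * c.τt
  η_pos : 0 < c.η
  η_le : c.η * K.LF ≤ 1 / 4
  move_α : K.moveConst D θ * (c.τ * c.τt) ^ 2 ≤ (I / m : ℝ) ^ 2 * c.α
  move_αb : K.moveConst D θ * (c.τ * c.τt) ^ 2 ≤ (I / m : ℝ) ^ 2 * c.αb
  move_β : K.moveConst D θ * (c.τ * c.τt) ^ 2 ≤ (I / m : ℝ) ^ 2 * c.β
  ratio : K.ratioConst * c.η ^ 2 ≤ (c.τ * c.τt) ^ 2

/-! ### Consequences of the balance between step sizes -/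

namespace Steps.Balanced

variable {c : Steps} {K : Consts} {D : ℕ} {θ : ℝ} {m I : ℕ} (hc : c.Balanced K D θ m I)

include hc

lemma q_pos : (0 : ℝ) < I / m := by
  have hI0 : (0 : ℝ) < I := by exact_mod_cast hc.I_pos
  have hm0 : (0 : ℝ) < m := by exact_mod_cast hc.I_pos.trans hc.I_le
  positivity

lemma q_le : (I / m : ℝ) ≤ 1 := by
  have hm0 : (0 : ℝ) < m := by exact_mod_cast hc.I_pos.trans hc.I_le
  exact (div_le_one hm0).2 (by exact_mod_cast hc.I_le)

lemma moveConst_mul_le : K.moveConst D θ * (c.τ * c.τt) ^ 2 ≤ 1 := by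
  refine hc.move_β.trans ?_
  have := hc.q_pos
  have := hc.β_pos
  calc (I / m : ℝ) ^ 2 * c.β ≤ 1 ^ 2 * 1 := by
        gcongr
        exacts [hc.q_le, hc.β_le]
    _ = 1 := by norm_num

/-- `moveConst` contains the summand (Lg²/λ)² precisely for this. Together with `a_mul_lam_le`,
which uses its summand λ², it supplies the step restrictions of the inner gradient step. -/
lemma a_mul_Lg_sq_le : c.τ * c.τt * K.Lg ^ 2 ≤ K.lam := by
  have hl := K.lam_pos
  have h1 := hc.moveConst_mul_le
  have h2 : (K.Lg ^ 2 / K.lam) ^ 2 ≤ K.moveConst D θ := by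
    have := K.hyperLip_nonneg
    have := K.wY_nonneg
    have := K.wS_nonneg
    have := K.wH_nonneg hc.θ_pos
    rw [← sub_nonneg]
    unfold Consts.moveConst
    ring_nf
    positivity
  have h3 : (c.τ * c.τt * (K.Lg ^ 2 / K.lam)) ^ 2 ≤ 1 := by
    rw [mul_pow, mul_comm]
    exact (mul_le_mul_of_nonneg_right h2 (sq_nonneg _)).trans h1
  have h4 := (abs_le_of_sq_le_sq' (a := c.τ * c.τt * (K.Lg ^ 2 / K.lam)) (b := 1) (by simpa using h3)
    (by norm_num)).2
  rwa [← mul_div_assoc, div_le_one hl] at h4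

lemma a_mul_lam_le : c.τ * c.τt * K.lam ≤ 1 := by
  have hl := K.lam_pos
  have h1 := hc.moveConst_mul_le
  have h2 : K.lam ^ 2 ≤ K.moveConst D θ := by
    have := K.hyperLip_nonneg
    have := K.wY_nonneg
    have := K.wS_nonneg
    have := K.wH_nonneg hc.θ_pos
    rw [← sub_nonneg]
    unfold Consts.moveConst
    ring_nf
    positivity
  have h3 : (c.τ * c.τt * K.lam) ^ 2 ≤ 1 := by
    rw [mul_pow, mul_comm]
    exact (mul_le_mul_of_nonneg_right h2 (sq_nonneg _)).trans h1
  exact (abs_le_of_sq_le_sq' (a := c.τ * c.τt * K.lam) (b := 1) (by simpa using h3)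
    (by norm_num)).2

end Steps.Balanced

/-- The noise level of one iteration, relative to the step size `η`. -/
def noise (K : Consts) (D : ℕ) (θ : ℝ) (m I b : ℕ) (c : Steps) : ℝ :=
  2 * K.wS * c.α * (K.σ ^ 2 / b) + 2 * K.wH θ * c.αb * (D * K.σ ^ 2 / b)
    + 16 * K.hyperLip / θ * c.αb * (D * K.σ ^ 2 / b)
    + 8 * c.β * (K.hyperVar D / b + (if I < m then 1 / (I : ℝ) else 0) * K.hyperBound ^ 2)

namespace Problem

variable {m dx : ℕ} {dy : Fin m → ℕ} {Ξ Z : Fin m → Type*}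
  [∀ i, MeasurableSpace (Ξ i)] [∀ i, MeasurableSpace (Z i)]

/-- The potential of a state: objective gap plus weighted errors and step lengths. -/
def potential (p : Problem m dx dy Ξ Z) (K : Consts) (θ : ℝ) (I : ℕ) (c : Steps) (low : ℝ)
    (st : State dx dy) : ℝ :=
  p.F st.x - low + K.wS * c.η / (I / m * c.α) * p.errS st
    + K.wH θ * c.η / (I / m * c.αb) * p.errH st + c.η / c.β * p.errZ st
    + K.wY * c.η / (c.τ * c.τt) * p.errY st + 1 / (8 * c.η) * st.moveX
    + c.η / (c.τ * c.τt) ^ 2 * st.moveY + 4 * K.hyperLip * c.η / c.β * st.moveH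

variable {p : Problem m dx dy Ξ Z} {K : Consts} {D : ℕ} (h : p.Standing K D) {b I : ℕ}

lemma potential_nonneg {θ : ℝ} {c : Steps} (hc : c.Balanced K D θ m I) {low : ℝ}
    (hlow : ∀ x, low ≤ p.F x) (st : State dx dy) : 0 ≤ p.potential K θ I c low st := by
  have := hlow st.x
  have hq := hc.q_pos
  have := hc.α_pos
  have := hc.αb_pos
  have := hc.β_pos
  have := hc.a_pos
  have := hc.η_pos
  have := K.wS_nonneg
  have := K.wY_nonneg
  have := K.wH_nonneg hc.θ_pos
  have := K.hyperLip_nonneg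
  have := errS_nonneg (p := p) st
  have := errH_nonneg (p := p) st
  have := errZ_nonneg (p := p) st
  have := errY_nonneg (p := p) st
  have := st.moveX_nonneg
  have := st.moveY_nonneg
  have := st.moveH_nonneg
  have : 0 ≤ p.F st.x - low := by linarith
  unfold potential
  positivity

namespace Standing

include h

/-- Bound for the potential after one iteration by quantities with known expectation. -/
lemma potential_step_le {θ : ℝ} {c : Steps} (hc : c.Balanced K D θ m I) (low : ℝ)
    {st : State dx dy} (hst : st.Valid K.lam) (w : IterSample Ξ Z b) :
    p.potential K θ I c low (step p K.lam I c w st)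
      ≤ p.F st.x - low - c.η / 2 * ‖gradient p.F st.x‖ ^ 2
        + c.η * (K.hyperLip * (p.errY st + 3 * (p.errH st + K.Lgyy ^ 2 * (st.moveX + st.moveY)
          + K.Lgyy ^ 2 * p.errY st)))
        + K.wY * c.η * ((1 / (c.τ * c.τt) - K.lam / 2) * p.errY st
          + 13 / K.lam * (p.errS st + K.Lgy ^ 2 * (st.moveX + st.moveY)))
        + 3 * c.η * (p.errS st + K.Lgy ^ 2 * (st.moveX + st.moveY) + K.Lg ^ 2 * p.errY st)
        + (K.wS * c.η / (I / m * c.α) * p.errS (step p K.lam I c w st)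
          + K.wH θ * c.η / (I / m * c.αb) * p.errH (step p K.lam I c w st)
          + (c.η / c.β + c.η) * p.errZ (step p K.lam I c w st)
          + 4 * K.hyperLip * c.η / c.β * (step p K.lam I c w st).moveH) := by
  have hm := hc.I_pos.trans hc.I_le
  have hl := K.lam_pos
  have ha := hc.a_pos
  have hη := hc.η_pos
  have hwY := K.wY_nonneg
  have f1 := h.F_step_le (I := I) hη hc.η_le w st
  have f2 := mul_le_mul_of_nonneg_left (h.norm_z_sub_gradient_sq_le (I := I) (c := c) hm w hst)
    (show 0 ≤ c.η / 2 by positivity)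
  have f3 := mul_le_mul_of_nonneg_left
    (h.errY_step_le (I := I) hm ha hc.a_mul_Lg_sq_le hc.a_mul_lam_le w st)
    (show 0 ≤ K.wY * c.η / (c.τ * c.τt) by positivity)
  have f4 := mul_le_mul_of_nonneg_left (h.moveY_step_le (I := I) hm (c := c) w st)
    (show 0 ≤ c.η / (c.τ * c.τt) ^ 2 by positivity)
  have f5 := step_moveX (p := p) (K := K) (I := I) (c := c) (w := w) (st := st)
  set st' := step p K.lam I c w st
  set a := c.τ * c.τt with haa
  -- This negative term of the descent is the budget for the new step in x. It covers the weight
  -- 1/(8η) in the potential and the drift of y_i(x), the latter by `ratioConst`.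
  have f6 : c.η / 4 * ‖st'.z‖ ^ 2 = 1 / (4 * c.η) * st'.moveX := by
    rw [f5]
    field_simp
  have f7 : 1 / (8 * c.η) + K.wY * c.η / a * (6 * K.Ly ^ 2 / (a * K.lam)) ≤ 1 / (4 * c.η) := by
    have r := hc.ratio
    rw [← haa] at r
    have r2 : 48 * K.wY * K.Ly ^ 2 / K.lam * c.η ^ 2 ≤ a ^ 2 := by
      unfold Consts.ratioConst at r
      nlinarith [sq_nonneg c.η]
    have e1 : 1 / (4 * c.η) = 1 / (8 * c.η) + 1 / (8 * c.η) := by field_simp; norm_num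
    have e2 : K.wY * c.η / a * (6 * K.Ly ^ 2 / (a * K.lam))
        = (48 * K.wY * K.Ly ^ 2 / K.lam * c.η ^ 2) * (1 / (8 * c.η * a ^ 2)) := by
      field_simp
      ring
    have e3 : 1 / (8 * c.η) = a ^ 2 * (1 / (8 * c.η * a ^ 2)) := by field_simp
    rw [e1]
    refine add_le_add le_rfl ?_
    rw [e2, e3]
    gcongr
  have f8 := mul_le_mul_of_nonneg_right f7 st'.moveX_nonneg
  have f9 : K.wY * c.η / a * ((1 - a * K.lam / 2) * p.errY st
      + 13 * a / K.lam * (p.errS st + K.Lgy ^ 2 * (st.moveX + st.moveY)))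
      = K.wY * c.η * ((1 / a - K.lam / 2) * p.errY st
          + 13 / K.lam * (p.errS st + K.Lgy ^ 2 * (st.moveX + st.moveY))) := by
    field_simp
  have f10 : c.η / a ^ 2 * (3 * a ^ 2
      * (p.errS st + K.Lgy ^ 2 * (st.moveX + st.moveY) + K.Lg ^ 2 * p.errY st))
      = 3 * c.η * (p.errS st + K.Lgy ^ 2 * (st.moveX + st.moveY) + K.Lg ^ 2 * p.errY st) := by
    field_simp
  unfold potential
  rw [mul_add, f9] at f3
  rw [f10] at f4
  rw [← haa]
  linarith

set_option maxHeartbeats 1000000 in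
/-- Expected descent of the potential. -/
lemma meanLE_potential (hb : 1 ≤ b) {θ : ℝ} {c : Steps} (hc : c.Balanced K D θ m I) (low : ℝ)
    {st : State dx dy} (hst : st.Valid K.lam) :
    MeanLE (iterLaw p I b) (fun w => p.potential K θ I c low (step p K.lam I c w st))
      (p.potential K θ I c low st - c.η / 2 * ‖gradient p.F st.x‖ ^ 2
        + c.η * noise K D θ m I b c) := by
  have hprob := h.isProbabilityMeasure_iterLaw (b := b) hc.I_le
  have hq := hc.q_pos
  have hq1 := hc.q_le
  have hα := hc.α_pos
  have hαb := hc.αb_pos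
  have hβ := hc.β_pos
  have ha := hc.a_pos
  have hη := hc.η_pos
  have hθ := hc.θ_pos
  have hl := K.lam_pos
  have hwS := K.wS_nonneg
  have hwY := K.wY_nonneg
  have hwH := K.wH_nonneg hθ
  have hL := K.hyperLip_nonneg
  have hS := errS_nonneg (p := p) st
  have hH := errH_nonneg (p := p) st
  have hZ := errZ_nonneg (p := p) st
  have hM : 0 ≤ st.moveX + st.moveY := add_nonneg st.moveX_nonneg st.moveY_nonneg
  have hDH := st.moveH_nonneg
  have hV := K.hyperVar_nonneg D
  have hind : (0 : ℝ) ≤ if I < m then 1 / (I : ℝ) else 0 := by split_ifs <;> positivity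
  have m1 := (h.meanLE_errS hb hc.I_pos hc.I_le hα.le hc.α_le st).const_mul
    (a := K.wS * c.η / (I / m * c.α)) (by positivity)
  have m2 := (h.meanLE_errH hb hc.I_pos hc.I_le hαb.le hc.αb_le st).const_mul
    (a := K.wH θ * c.η / (I / m * c.αb)) (by positivity)
  have m3 := (h.meanLE_errZ hb hc.I_pos hc.I_le hβ.le hc.β_le hst).const_mul
    (a := c.η / c.β + c.η) (by positivity)
  have m4 := (h.meanLE_moveH hb hc.I_pos hc.I_le hαb.le hc.αb_le hst).const_mul
    (a := 4 * K.hyperLip * c.η / c.β) (by positivity)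
  refine (((MeanLE.const _).add (((m1.add m2).add m3).add m4)).mono ?_).of_le fun w =>
    h.potential_step_le hc low hst w
  set q : ℝ := I / m with hqq
  set M := st.moveX + st.moveY with hMM
  set a := c.τ * c.τt with haa
  set η := c.η
  set L := K.hyperLip
  set s2 := K.σ ^ 2 / b with hs2
  set h2 := D * K.σ ^ 2 / b with hh2
  set nz := 2 * (K.hyperVar D / b) + 2 * ((if I < m then 1 / (I : ℝ) else 0) * K.hyperBound ^ 2)
    with hnz
  have hs20 : 0 ≤ s2 := by positivity
  have hh20 : 0 ≤ h2 := by positivity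
  have hnz0 : 0 ≤ nz := by positivity
  -- each weighted expectation, up to the terms that are absorbed
  have e1 : K.wS * η / (q * c.α) * ((1 - q * c.α) * p.errS st + 2 * q * c.α ^ 2 * s2
      + 13 * K.Lgy ^ 2 / q * M) = K.wS * η / (q * c.α) * p.errS st - K.wS * η * p.errS st
        + η * (2 * K.wS * c.α * s2) + η * (13 * K.wS * K.Lgy ^ 2) * (M / (q ^ 2 * c.α)) := by
    field_simp
  have e2 : K.wH θ * η / (q * c.αb) * ((1 - q * c.αb) * p.errH st + 2 * q * c.αb ^ 2 * h2
      + 13 * (D * K.Lgyy ^ 2) / q * M) = K.wH θ * η / (q * c.αb) * p.errH st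
        - K.wH θ * η * p.errH st + η * (2 * K.wH θ * c.αb * h2)
        + η * (13 * K.wH θ * (D * K.Lgyy ^ 2)) * (M / (q ^ 2 * c.αb)) := by
    field_simp
  -- The weight η/β + η contains the error of the search direction, and (η/β + η)(1 - β) ≤ η/β still
  -- closes. The movement of H appears with 4Lη/β, which is its weight in the potential.
  have e3 : (η / c.β + η) * ((1 - c.β) * p.errZ st + 2 * c.β ^ 2 * nz
      + 2 * (L * (M + st.moveH))) ≤ η / c.β * p.errZ st + η * (4 * c.β * nz)
        + η * (4 * L) * (M / (q ^ 2 * c.β)) + 4 * L * η / c.β * st.moveH := by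
    have i1 : (η / c.β + η) * (1 - c.β) ≤ η / c.β := by
      have : (η / c.β + η) * (1 - c.β) = η / c.β - η * c.β := by field_simp; ring
      rw [this]
      exact sub_le_self _ (mul_pos hη hβ).le
    have i2 : η / c.β + η ≤ 2 * (η / c.β) := by
      have : η ≤ η / c.β := by
        rw [le_div_iff₀ hβ]
        exact mul_le_of_le_one_right hη.le hc.β_le
      linarith
    have i3 : M / c.β ≤ M / (q ^ 2 * c.β) := by
      gcongr
      exact mul_le_of_le_one_left hβ.le (pow_le_one₀ hq.le hq1)
    have j1 := mul_le_mul_of_nonneg_right i1 hZ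
    have j2 := mul_le_mul_of_nonneg_right i2 (show 0 ≤ 2 * c.β ^ 2 * nz by positivity)
    have j3 := mul_le_mul_of_nonneg_right i2 (show 0 ≤ 2 * (L * (M + st.moveH)) by positivity)
    have j4 := mul_le_mul_of_nonneg_left i3 (show 0 ≤ η * (4 * L) by positivity)
    have k2 : 2 * (η / c.β) * (2 * c.β ^ 2 * nz) = η * (4 * c.β * nz) := by field_simp; ring
    have k3 : 2 * (η / c.β) * (2 * (L * (M + st.moveH)))
        = η * (4 * L) * (M / c.β) + 4 * L * η / c.β * st.moveH := by field_simp; ring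
    rw [k2] at j2
    rw [k3] at j3
    linarith
  -- Here θᾱ ≤ β is needed: the new movement of H returns at most 16L/θ times η times the error of
  -- H, which is the second summand of `wH`.
  have e4 : 4 * L * η / c.β * (4 * q * c.αb ^ 2 * (p.errH st + h2)
      + 20 * (D * K.Lgyy ^ 2) / q * M) ≤ η * (16 * L / θ) * p.errH st
        + η * (16 * L / θ * c.αb * h2) + η * (80 * L * (D * K.Lgyy ^ 2)) * (M / (q ^ 2 * c.β)) := by
    have i1 : c.αb / c.β ≤ 1 / θ := by
      rw [div_le_div_iff₀ hβ hθ]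
      linarith [hc.αb_le_β]
    have i2 : q * (c.αb / c.β) * c.αb ≤ 1 / θ * c.αb := by
      calc q * (c.αb / c.β) * c.αb ≤ 1 * (1 / θ) * c.αb := by gcongr
        _ = _ := by ring
    have i3 : 1 / θ * c.αb ≤ 1 / θ := by
      refine mul_le_of_le_one_right (by positivity) ?_
      linarith [hc.αb_le]
    have i4 : M / (q * c.β) ≤ M / (q ^ 2 * c.β) := by
      gcongr
      exact pow_le_of_le_one hq.le hq1 (by norm_num)
    have j1 := mul_le_mul_of_nonneg_left (i2.trans i3)
      (show 0 ≤ η * (16 * L) * p.errH st by positivity)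
    have j2 := mul_le_mul_of_nonneg_left i2 (show 0 ≤ η * (16 * L) * h2 by positivity)
    have j3 := mul_le_mul_of_nonneg_left i4
      (show 0 ≤ η * (80 * L * (D * K.Lgyy ^ 2)) by positivity)
    have k1 : 4 * L * η / c.β * (4 * q * c.αb ^ 2 * (p.errH st + h2)
      + 20 * (D * K.Lgyy ^ 2) / q * M) = η * (16 * L) * p.errH st * (q * (c.αb / c.β) * c.αb)
        + η * (16 * L) * h2 * (q * (c.αb / c.β) * c.αb)
        + η * (80 * L * (D * K.Lgyy ^ 2)) * (M / (q * c.β)) := by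
      field_simp
      ring
    have k2 : η * (16 * L) * p.errH st * (1 / θ) = η * (16 * L / θ) * p.errH st := by ring
    have k3 : η * (16 * L) * h2 * (1 / θ * c.αb) = η * (16 * L / θ * c.αb * h2) := by ring
    rw [k1, ← k2, ← k3]
    linarith
  -- the step lengths are absorbed
  have hC := K.moveConst_pos D hθ
  have g0 : ∀ r : ℝ, 0 < r → K.moveConst D θ * a ^ 2 ≤ q ^ 2 * r →
      M / (q ^ 2 * r) ≤ M / (K.moveConst D θ * a ^ 2) := fun r hr hle => by gcongr
  set Q := M / (K.moveConst D θ * a ^ 2) with hQ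
  have g1 := g0 _ hα hc.move_α
  have g2 := g0 _ hαb hc.move_αb
  have g3 := g0 _ hβ hc.move_β
  have g4 : M ≤ Q := by
    rw [hQ, le_div_iff₀ (by positivity)]
    exact mul_le_of_le_one_right hM hc.moveConst_mul_le
  have l1 := mul_le_mul_of_nonneg_left g1 (show 0 ≤ η * (13 * K.wS * K.Lgy ^ 2) by positivity)
  have l2 := mul_le_mul_of_nonneg_left g2
    (show 0 ≤ η * (13 * K.wH θ * (D * K.Lgyy ^ 2)) by positivity)
  have l3 := mul_le_mul_of_nonneg_left g3 (show 0 ≤ η * (4 * L) by positivity)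
  have l4 := mul_le_mul_of_nonneg_left g3
    (show 0 ≤ η * (80 * L * (D * K.Lgyy ^ 2)) by positivity)
  have l5 := mul_le_mul_of_nonneg_left g4 (show 0 ≤ η * (3 * L * K.Lgyy ^ 2) by positivity)
  have l6 := mul_le_mul_of_nonneg_left g4
    (show 0 ≤ η * (13 * K.wY * K.Lgy ^ 2 / K.lam) by positivity)
  have l7 := mul_le_mul_of_nonneg_left g4 (show 0 ≤ η * (3 * K.Lgy ^ 2) by positivity)
  have hQ0 : 0 ≤ Q := by positivity
  have l8 : 0 ≤ η * ((K.Lg ^ 2 / K.lam) ^ 2 + K.lam ^ 2 + 1) * Q := by positivity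
  -- All movement terms together are at most η · `moveConst` · Q, and this is what the movement
  -- weights of the old potential provide, since 8η² ≤ a².
  have g5 : η * K.moveConst D θ * Q = η / a ^ 2 * M := by
    rw [hQ]
    field_simp
  have g6 : η / a ^ 2 * M ≤ 1 / (8 * η) * st.moveX + η / a ^ 2 * st.moveY := by
    have r := hc.ratio
    rw [← haa] at r
    have r2 : 8 * η ^ 2 ≤ a ^ 2 := by
      have : (8 : ℝ) ≤ K.ratioConst := by
        unfold Consts.ratioConst
        have : 0 ≤ 48 * K.wY * K.Ly ^ 2 / K.lam := by positivity
        linarith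
      exact (mul_le_mul_of_nonneg_right this (sq_nonneg _)).trans r
    have r3 : η / a ^ 2 ≤ 1 / (8 * η) := by
      rw [div_le_div_iff₀ (by positivity) (by positivity)]
      linarith
    rw [hMM, mul_add]
    have := mul_le_mul_of_nonneg_right r3 st.moveX_nonneg
    linarith
  have g7 : η * K.moveConst D θ * Q = η * (3 * L * K.Lgyy ^ 2) * Q + η * (4 * L) * Q
      + η * (80 * L * (D * K.Lgyy ^ 2)) * Q + η * (13 * K.wH θ * (D * K.Lgyy ^ 2)) * Q
      + η * (13 * K.wS * K.Lgy ^ 2) * Q + η * (13 * K.wY * K.Lgy ^ 2 / K.lam) * Q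
      + η * (3 * K.Lgy ^ 2) * Q + η * ((K.Lg ^ 2 / K.lam) ^ 2 + K.lam ^ 2 + 1) * Q := by
    unfold Consts.moveConst
    ring
  -- the errors are absorbed
  have d1 : K.wY * η * (K.lam / 2 * p.errY st)
      = η * (L * (1 + 3 * K.Lgyy ^ 2) + 3 * K.Lg ^ 2) * p.errY st := by
    unfold Consts.wY
    field_simp
    ring
  have d2 : K.wH θ * η * p.errH st = 3 * η * L * p.errH st + η * (16 * L / θ) * p.errH st := by
    unfold Consts.wH
    ring
  have d3 : K.wS * η * p.errS st = K.wY * η * (13 / K.lam * p.errS st) + 3 * η * p.errS st := by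
    unfold Consts.wS
    ring
  have d4 : η * noise K D θ m I b c = η * (2 * K.wS * c.α * s2) + η * (2 * K.wH θ * c.αb * h2)
      + η * (16 * L / θ * c.αb * h2) + η * (4 * c.β * nz) := by
    unfold noise
    rw [hnz]
    ring
  have d5 : K.wY * η * (13 / K.lam * (K.Lgy ^ 2 * M)) = η * (13 * K.wY * K.Lgy ^ 2 / K.lam) * M := by
    ring
  have d6 : K.wY * η / a * p.errY st = K.wY * η * (1 / a * p.errY st) := by ring
  unfold potential
  rw [d4, e1, e2, ← haa, d6]
  linarith

end Standing

end Problem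


/-! ### Measurability of the iteration -/

lemma measurable_apply_clm {X : Type*} [MeasurableSpace X] {n d : ℕ} {A : X → Vec n →L[ℝ] Vec d}
    {v : X → Vec n} (hA : Measurable A) (hv : Measurable v) : Measurable fun x => A x (v x) :=
  (isBoundedBilinearMap_apply (𝕜 := ℝ) (E := Vec n) (F := Vec d)).continuous.measurable.comp
    (hA.prodMk hv)

lemma measurable_batchMean_comp {X S V : Type*} [MeasurableSpace X] [MeasurableSpace S]
    [NormedAddCommGroup V] [NormedSpace ℝ V] [MeasurableSpace V] [BorelSpace V]
    [SecondCountableTopology V] {P Q b : ℕ} {φ : Vec P → Vec Q → S → V}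
    (hc : ∀ s, Continuous fun u : Vec P × Vec Q => φ u.1 u.2 s)
    (hm : ∀ x y, Measurable (φ x y)) {x : X → Vec P} {y : X → Vec Q} {w : X → Fin b → S}
    (hx : Measurable x) (hy : Measurable y) (hw : Measurable w) :
    Measurable fun a => batchMean (φ (x a) (y a)) (w a) := by
  have h1 : Measurable (Function.uncurry fun (u : Vec P × Vec Q) s => φ u.1 u.2 s) :=
    measurable_uncurry_of_continuous_of_measurable hc fun u => hm u.1 u.2
  unfold batchMean
  refine Measurable.const_smul (Finset.measurable_fun_sum _ fun k _ => ?_) _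
  exact h1.comp ((hx.prodMk hy).prodMk ((measurable_pi_apply k).comp hw))

lemma measurable_sum_mem {X V : Type*} [MeasurableSpace X] [NormedAddCommGroup V]
    [NormedSpace ℝ V] [MeasurableSpace V] [BorelSpace V] [SecondCountableTopology V] {m : ℕ}
    {S : X → Finset (Fin m)} (hS : Measurable S) {f : Fin m → X → V} (hf : ∀ i, Measurable (f i)) :
    Measurable fun x => ∑ i ∈ S x, f i x := by
  classical
  have e : (fun x => ∑ i ∈ S x, f i x) = fun x => ∑ i, if i ∈ S x then f i x else 0 := by
    ext1 x
    rw [← Finset.sum_filter]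
    simp
  rw [e]
  refine Finset.measurable_fun_sum _ fun i _ => Measurable.ite ?_ (hf i) measurable_const
  exact hS (MeasurableSet.of_discrete (s := {T : Finset (Fin m) | i ∈ T}))

/-- A random state all of whose components are measurable. -/
structure State.Meas {X : Type*} [MeasurableSpace X] {m dx : ℕ} {dy : Fin m → ℕ}
    (r : X → State dx dy) : Prop where
  x : Measurable fun a => (r a).x
  xPrev : Measurable fun a => (r a).xPrev
  y : ∀ i, Measurable fun a => (r a).y i
  yPrev : ∀ i, Measurable fun a => (r a).yPrev i
  s : ∀ i, Measurable fun a => (r a).s i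
  H : ∀ i, Measurable fun a => (r a).H i
  HPrev : ∀ i, Measurable fun a => (r a).HPrev i
  z : Measurable fun a => (r a).z

lemma State.Meas.comp {X Y : Type*} [MeasurableSpace X] [MeasurableSpace Y] {m dx : ℕ}
    {dy : Fin m → ℕ} {r : X → State dx dy} (hr : State.Meas r) {f : Y → X} (hf : Measurable f) :
    State.Meas fun a => r (f a) :=
  ⟨hr.x.comp hf, hr.xPrev.comp hf, fun i => (hr.y i).comp hf, fun i => (hr.yPrev i).comp hf,
    fun i => (hr.s i).comp hf, fun i => (hr.H i).comp hf, fun i => (hr.HPrev i).comp hf,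
    hr.z.comp hf⟩

namespace Problem

variable {m dx : ℕ} {dy : Fin m → ℕ} {Ξ Z : Fin m → Type*}
  [∀ i, MeasurableSpace (Ξ i)] [∀ i, MeasurableSpace (Z i)]
  {p : Problem m dx dy Ξ Z} {K : Consts} {D : ℕ} (h : p.Standing K D) {b I : ℕ}
  {X : Type*} [MeasurableSpace X]

namespace Standing

include h

lemma measurable_batchMean_gy {i : Fin m} {x : X → Vec dx} {y : X → Vec (dy i)}
    {w : X → Batches Ξ Z b} (hx : Measurable x) (hy : Measurable y) (hw : Measurable w) :
    Measurable fun a => batchMean (p.gy i (x a) (y a)) ((w a).2 i) :=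
  measurable_batchMean_comp (fun ζ => (h.sto.gy_lip i ζ).continuous) (h.gy_meas i) hx hy
    ((measurable_pi_apply i).comp hw.snd)

lemma measurable_batchMean_gyy {i : Fin m} {x : X → Vec dx} {y : X → Vec (dy i)}
    {w : X → Batches Ξ Z b} (hx : Measurable x) (hy : Measurable y) (hw : Measurable w) :
    Measurable fun a => batchMean (p.gyy i (x a) (y a)) ((w a).2 i) :=
  measurable_batchMean_comp (fun ζ => (h.sto.gyy_lip i ζ).continuous) (h.gyy_meas i) hx hy
    ((measurable_pi_apply i).comp hw.snd)

lemma measurable_hyperGrad {i : Fin m} {x : X → Vec dx} {y : X → Vec (dy i)}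
    {H : X → Vec (dy i) →L[ℝ] Vec (dy i)} {w : X → Batches Ξ Z b} (hx : Measurable x)
    (hy : Measurable y) (hH : Measurable H) (hw : Measurable w) :
    Measurable fun a => hyperGrad p i (x a) (y a) (H a) (w a) := by
  have w1 : Measurable fun a => (w a).1 i := (measurable_pi_apply i).comp hw.fst
  have w2 : Measurable fun a => (w a).2 i := (measurable_pi_apply i).comp hw.snd
  exact (measurable_batchMean_comp (fun ξ => (h.sto.fx_lip i ξ).continuous) (h.fx_meas i) hx hy
    w1).fun_sub (measurable_apply_clm
      (measurable_batchMean_comp (fun ζ => (h.sto.gxy_lip i ζ).continuous) (h.gxy_meas i) hx hy w2)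
      (measurable_apply_clm (measurable_inverse.comp hH)
        (measurable_batchMean_comp (fun ξ => (h.sto.fy_lip i ξ).continuous) (h.fy_meas i) hx hy
          w1)))

lemma meas_initState (x₁ : Vec dx) {y : X → (i : Fin m) → Vec (dy i)} {w : X → Batches Ξ Z b}
    (hy : Measurable y) (hw : Measurable w) :
    State.Meas fun a => initState p K.lam x₁ (y a) (w a) := by
  have hyi : ∀ i, Measurable fun a => y a i := fun i => (measurable_pi_apply i).comp hy
  have hH : ∀ i, Measurable fun a => proj K.lam (batchMean (p.gyy i x₁ (y a i)) ((w a).2 i)) :=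
    fun i => (continuous_proj K.lam).measurable.comp
      (h.measurable_batchMean_gyy measurable_const (hyi i) hw)
  have hz : Measurable fun a => ∑ i, hyperGrad p i x₁ (y a i)
      (proj K.lam (batchMean (p.gyy i x₁ (y a i)) ((w a).2 i))) (w a) :=
    Finset.measurable_fun_sum _ fun i _ =>
      h.measurable_hyperGrad measurable_const (hyi i) (hH i) hw
  exact ⟨measurable_const, measurable_const, hyi, hyi,
    fun i => h.measurable_batchMean_gy measurable_const (hyi i) hw, hH, hH,
    hz.fun_const_smul (m : ℝ)⁻¹⟩

lemma meas_step (c : Steps) {r : X → State dx dy} (hr : State.Meas r) {w : X → IterSample Ξ Z b}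
    (hw : Measurable w) : State.Meas fun a => step p K.lam I c (w a) (r a) := by
  have hS : Measurable fun a => (w a).1 := hw.fst
  have hB : Measurable fun a => (w a).2 := hw.snd
  have hmem : ∀ i, MeasurableSet {a | i ∈ (w a).1} := fun i =>
    hS (MeasurableSet.of_discrete (s := {T : Finset (Fin m) | i ∈ T}))
  have g1 : ∀ i, Measurable fun a => batchMean (p.gy i (r a).x ((r a).y i)) ((w a).2.2 i) :=
    fun i => h.measurable_batchMean_gy hr.x (hr.y i) hB
  have g2 : ∀ i, Measurable fun a => batchMean (p.gy i (r a).xPrev ((r a).yPrev i)) ((w a).2.2 i) :=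
    fun i => h.measurable_batchMean_gy hr.xPrev (hr.yPrev i) hB
  have k1 : ∀ i, Measurable fun a => batchMean (p.gyy i (r a).x ((r a).y i)) ((w a).2.2 i) :=
    fun i => h.measurable_batchMean_gyy hr.x (hr.y i) hB
  have k2 : ∀ i, Measurable fun a =>
      batchMean (p.gyy i (r a).xPrev ((r a).yPrev i)) ((w a).2.2 i) :=
    fun i => h.measurable_batchMean_gyy hr.xPrev (hr.yPrev i) hB
  have hG : Measurable fun a =>
      (I : ℝ)⁻¹ • ∑ i ∈ (w a).1, hyperGrad p i (r a).x ((r a).y i) ((r a).H i) (w a).2 :=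
    (measurable_sum_mem hS fun i => h.measurable_hyperGrad hr.x (hr.y i) (hr.H i) hB).fun_const_smul _
  have hG' : Measurable fun a => (I : ℝ)⁻¹ • ∑ i ∈ (w a).1,
      hyperGrad p i (r a).xPrev ((r a).yPrev i) ((r a).HPrev i) (w a).2 :=
    (measurable_sum_mem hS fun i =>
      h.measurable_hyperGrad hr.xPrev (hr.yPrev i) (hr.HPrev i) hB).fun_const_smul _
  have hz : Measurable fun a => (step p K.lam I c (w a) (r a)).z :=
    ((hr.z.fun_sub hG').fun_const_smul _).fun_add hG
  exact {
    x := hr.x.fun_sub (hz.fun_const_smul c.η)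
    xPrev := hr.x
    y := fun i => (hr.y i).fun_sub ((hr.s i).fun_const_smul _)
    yPrev := hr.y
    s := fun i => Measurable.ite (hmem i) ((((hr.s i).fun_const_smul _).fun_add ((g1 i).fun_const_smul _)).fun_add
      (((g1 i).fun_sub (g2 i)).fun_const_smul _)) (hr.s i)
    H := fun i => Measurable.ite (hmem i) ((continuous_proj K.lam).measurable.comp
      ((((hr.H i).fun_const_smul _).fun_add ((k1 i).fun_const_smul _)).fun_add
        (((k1 i).fun_sub (k2 i)).fun_const_smul _))) (hr.H i)
    HPrev := hr.H
    z := hz }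

lemma measurable_hyperMean {i : Fin m} {x : X → Vec dx} {y : X → Vec (dy i)}
    {H : X → Vec (dy i) →L[ℝ] Vec (dy i)} (hx : Measurable x) (hy : Measurable y)
    (hH : Measurable H) : Measurable fun a => p.hyperMean i (x a) (y a) (H a) := by
  have hxy : Measurable fun a => (x a, y a) := hx.prodMk hy
  have h1 := (h.fxBar_lip i).continuous.measurable.comp hxy
  have h2 := (h.gxyBar_lip i).continuous.measurable.comp hxy
  have h3 := (h.fyBar_lip i).continuous.measurable.comp hxy
  have h4 := measurable_apply_clm (measurable_inverse.comp hH) h3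
  have h5 := measurable_apply_clm h2 h4
  exact h1.fun_sub h5

omit h in
lemma measurable_blockMean {f : Fin m → X → ℝ} (hf : ∀ i, Measurable (f i)) :
    Measurable fun a => blockMean fun i => f i a :=
  (Finset.measurable_fun_sum _ fun i _ => hf i).const_mul _

omit h in
lemma measurable_frobSq {n : ℕ} : Measurable (frobSq : (Vec n →L[ℝ] Vec n) → ℝ) := by
  unfold frobSq
  exact Finset.measurable_fun_sum _ fun k _ =>
    (measurable_apply_clm measurable_id measurable_const).norm.pow_const 2

lemma measurable_potential (θ : ℝ) (c : Steps) (low : ℝ) {r : X → State dx dy}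
    (hr : State.Meas r) : Measurable fun a => p.potential K θ I c low (r a) := by
  have hF : Measurable fun a => p.F (r a).x := h.differentiable_F.continuous.measurable.comp hr.x
  have hS : Measurable fun a => p.errS (r a) := measurable_blockMean fun i =>
    ((hr.s i).fun_sub ((h.gyBar_lip i).continuous.measurable.comp
      (hr.xPrev.prodMk (hr.yPrev i)))).norm.pow_const 2
  have hH : Measurable fun a => p.errH (r a) := measurable_blockMean fun i =>
    measurable_frobSq.comp ((hr.H i).fun_sub ((h.gyyBar_lip i).continuous.measurable.comp
      (hr.xPrev.prodMk (hr.yPrev i))))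
  have hA : Measurable fun a => p.hyperAvg (r a).xPrev (r a).yPrev (r a).HPrev :=
    (Finset.measurable_fun_sum Finset.univ fun i _ =>
      h.measurable_hyperMean hr.xPrev (hr.yPrev i) (hr.HPrev i)).fun_const_smul (m : ℝ)⁻¹
  have hZ : Measurable fun a => p.errZ (r a) := (hr.z.fun_sub hA).norm.pow_const 2
  have hY : Measurable fun a => p.errY (r a) := measurable_blockMean fun i =>
    ((hr.y i).fun_sub ((h.continuous_yStar i).measurable.comp hr.x)).norm.pow_const 2
  have mX : Measurable fun a => (r a).moveX := (hr.x.fun_sub hr.xPrev).norm.pow_const 2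
  have mY : Measurable fun a => (r a).moveY := measurable_blockMean fun i =>
    ((hr.y i).fun_sub (hr.yPrev i)).norm.pow_const 2
  have mH : Measurable fun a => (r a).moveH := measurable_blockMean fun i =>
    ((hr.H i).fun_sub (hr.HPrev i)).norm.pow_const 2
  unfold potential
  exact (((((((hF.sub_const low).fun_add (hS.const_mul _)).fun_add (hH.const_mul _)).fun_add
    (hZ.const_mul _)).fun_add (hY.const_mul _)).fun_add (mX.const_mul _)).fun_add (mY.const_mul _)).fun_add
    (mH.const_mul _)

lemma measurable_gradient_F_sq {r : X → State dx dy} (hr : State.Meas r) :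
    Measurable fun a => ‖gradient p.F (r a).x‖ ^ 2 :=
  (h.continuous_gradient_F.measurable.comp hr.x).norm.pow_const 2

/-! ### The run as a function of the past -/

omit h in
/-- The state after `t` iterations with samples `u`. -/
def runOn (p : Problem m dx dy Ξ Z) (lam : ℝ) (I : ℕ) (c : Steps) (x₁ : Vec dx) {b₀ : ℕ}
    (v : ((i : Fin m) → Vec (dy i)) × Batches Ξ Z b₀) :
    (t : ℕ) → (Fin t → IterSample Ξ Z b) → State dx dy
  | 0, _ => initState p lam x₁ v.1 v.2
  | t + 1, u => step p lam I c (u (Fin.last t)) (runOn p lam I c x₁ v t fun s => u s.castSucc)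

omit h in
lemma runOn_eq (lam : ℝ) (c : Steps) (x₁ : Vec dx) {b₀ : ℕ} (y₁ : (i : Fin m) → Vec (dy i))
    (w₀ : Batches Ξ Z b₀) (w : ℕ → IterSample Ξ Z b) (t : ℕ) :
    runOn p lam I c x₁ (y₁, w₀) t (fun s => w s) = run p lam I c x₁ y₁ w₀ w t := by
  induction t with
  | zero => rfl
  | succ t ih =>
    rw [run, ← ih]
    rfl

omit h in
lemma runOn_valid (c : Steps) (x₁ : Vec dx) {b₀ : ℕ}
    (v : ((i : Fin m) → Vec (dy i)) × Batches Ξ Z b₀) (t : ℕ) (u : Fin t → IterSample Ξ Z b) :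
    (runOn p K.lam I c x₁ v t u).Valid K.lam := by
  induction t with
  | zero => exact ⟨fun i => proj_mem_geSet _ _, fun i => proj_mem_geSet _ _⟩
  | succ t ih => exact step_valid (ih _)

lemma meas_runOn (c : Steps) (x₁ : Vec dx) {b₀ : ℕ} (t : ℕ) :
    State.Meas fun a : (((i : Fin m) → Vec (dy i)) × Batches Ξ Z b₀)
      × (Fin t → IterSample Ξ Z b) => runOn p K.lam I c x₁ a.1 t a.2 := by
  induction t with
  | zero =>
    exact h.meas_initState x₁ (measurable_fst.comp measurable_fst)
      (measurable_snd.comp measurable_fst)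
  | succ t ih =>
    have h1 : Measurable fun a : (((i : Fin m) → Vec (dy i)) × Batches Ξ Z b₀)
        × (Fin (t + 1) → IterSample Ξ Z b) => (a.1, (fun s : Fin t => a.2 s.castSucc)) :=
      measurable_fst.prodMk (measurable_pi_lambda _ fun s =>
        (measurable_pi_apply _).comp measurable_snd)
    exact h.meas_step (b := b) c (ih.comp h1) ((measurable_pi_apply (Fin.last t)).comp measurable_snd)

end Standing

end Problem

/-! ### Independence of the past -/

/-- If `A` is independent of `(U, V)` and `U` of `V`, then `(A, U)` is independent of `V`. -/
lemma indepFun_prodMk_of_indepFun {Ω α β γ : Type*} [MeasurableSpace Ω] [MeasurableSpace α]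
    [MeasurableSpace β] [MeasurableSpace γ] {μ : Measure Ω} [IsProbabilityMeasure μ] {A : Ω → α}
    {U : Ω → β} {V : Ω → γ} (hA : Measurable A) (hU : Measurable U) (hV : Measurable V)
    (h1 : IndepFun A (fun ω => (U ω, V ω)) μ) (h2 : IndepFun U V μ) :
    IndepFun (fun ω => (A ω, U ω)) V μ := by
  have pA := Measure.isProbabilityMeasure_map (μ := μ) hA.aemeasurable
  have pU := Measure.isProbabilityMeasure_map (μ := μ) hU.aemeasurable
  have pV := Measure.isProbabilityMeasure_map (μ := μ) hV.aemeasurable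
  have h3 : IndepFun A U μ := h1.comp measurable_id measurable_fst
  rw [indepFun_iff_map_prod_eq_prod_map_map hA.aemeasurable (hU.prodMk hV).aemeasurable] at h1
  rw [indepFun_iff_map_prod_eq_prod_map_map hU.aemeasurable hV.aemeasurable] at h2
  rw [indepFun_iff_map_prod_eq_prod_map_map hA.aemeasurable hU.aemeasurable] at h3
  rw [indepFun_iff_map_prod_eq_prod_map_map (hA.prodMk hU).aemeasurable hV.aemeasurable, h3]
  rw [h2] at h1
  have e := (measurePreserving_prodAssoc (μ.map A) (μ.map U) (μ.map V)).symm
  rw [← e.map_eq, ← h1, Measure.map_map e.measurable (hA.prodMk (hU.prodMk hV))]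
  rfl

section

variable {m dx : ℕ} {dy : Fin m → ℕ} {Ξ Z : Fin m → Type*}
  [∀ i, MeasurableSpace (Ξ i)] [∀ i, MeasurableSpace (Z i)]
  {p : Problem m dx dy Ξ Z} {I b b₀ : ℕ} {Ω : Type*} [MeasurableSpace Ω] {μ : Measure Ω}
  [IsProbabilityMeasure μ] {y₁ : Ω → (i : Fin m) → Vec (dy i)} {w₀ : Ω → Batches Ξ Z b₀}
  {w : ℕ → Ω → IterSample Ξ Z b}

lemma IsSampling.measurable_past (hs : IsSampling p I b b₀ μ y₁ w₀ w) (t : ℕ) :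
    Measurable fun ω => ((y₁ ω, w₀ ω), fun s : Fin t => w s ω) :=
  (hs.y₁_meas.prodMk hs.w₀_meas).prodMk (measurable_pi_lambda _ fun s => hs.w_meas s)

/-- The samples of an iteration are independent of the past. -/
lemma IsSampling.indepFun_past (hs : IsSampling p I b b₀ μ y₁ w₀ w) (t : ℕ) :
    IndepFun (fun ω => ((y₁ ω, w₀ ω), fun s : Fin t => w s ω)) (w t) μ := by
  refine indepFun_prodMk_of_indepFun (hs.y₁_meas.prodMk hs.w₀_meas)
    (measurable_pi_lambda _ fun s => hs.w_meas s) (hs.w_meas t) ?_ ?_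
  · exact hs.indep_init_iter.comp (φ := id)
      (ψ := fun u : ℕ → IterSample Ξ Z b => (fun s : Fin t => u s, u t)) measurable_id
      ((measurable_pi_lambda _ fun s => measurable_pi_apply _).prodMk (measurable_pi_apply _))
  · have h1 := hs.indep_iter.indepFun_finset (Finset.range t) {t} (by simp) hs.w_meas
    exact h1.comp (φ := fun u (s : Fin t) => u ⟨s, Finset.mem_range.2 s.2⟩)
      (ψ := fun u => u ⟨t, Finset.mem_singleton_self t⟩)
      (measurable_pi_lambda _ fun s => measurable_pi_apply _)
      (measurable_pi_apply (X := fun _ : ({t} : Finset ℕ) => IterSample Ξ Z b) _)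

end

/-- Integrate out an independent variable. -/
lemma lintegral_indepFun_le {Ω α β : Type*} [MeasurableSpace Ω] [MeasurableSpace α]
    [MeasurableSpace β] {μ : Measure Ω} [IsProbabilityMeasure μ] {A : Ω → α} {V : Ω → β}
    (hA : Measurable A) (hV : Measurable V) (hi : IndepFun A V μ) {ν : Measure β}
    (hν : μ.map V = ν) {f : α × β → ENNReal} {g : α → ENNReal} (hf : Measurable f)
    (hg : Measurable g) (hfg : ∀ a, ∫⁻ v, f (a, v) ∂ν ≤ g a) :
    ∫⁻ ω, f (A ω, V ω) ∂μ ≤ ∫⁻ ω, g (A ω) ∂μ := by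
  have pV := Measure.isProbabilityMeasure_map (μ := μ) hV.aemeasurable
  rw [hν] at pV
  rw [indepFun_iff_map_prod_eq_prod_map_map hA.aemeasurable hV.aemeasurable, hν] at hi
  rw [← lintegral_map hf (hA.prodMk hV), hi, lintegral_prod _ hf.aemeasurable,
    ← lintegral_map hg hA]
  exact lintegral_mono hfg


/-- Bound for the expected initial potential: `gap` is the initial objective gap and `R` the mean
initial error of the lower-level variables. -/
def initBound (K : Consts) (D : ℕ) (θ : ℝ) (m I b₀ : ℕ) (c : Steps) (gap R : ℝ) : ℝ :=
  gap + K.wS * c.η / (I / m * c.α) * (K.σ ^ 2 / b₀)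
    + K.wH θ * c.η / (I / m * c.αb) * (D * K.σ ^ 2 / b₀) + c.η / c.β * (K.hyperVar D / b₀)
    + K.wY * c.η / (c.τ * c.τt) * R

namespace Steps.Balanced

variable {c : Steps} {K : Consts} {D : ℕ} {θ : ℝ} {m I : ℕ} (hc : c.Balanced K D θ m I)

include hc

lemma noise_nonneg (b : ℕ) : 0 ≤ noise K D θ m I b c := by
  have := hc.θ_pos
  have := hc.α_pos
  have := hc.αb_pos
  have := hc.β_pos
  have := K.wS_nonneg
  have := K.wH_nonneg hc.θ_pos
  have := K.hyperVar_nonneg D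
  have := K.hyperLip_nonneg
  have hind : (0 : ℝ) ≤ if I < m then 1 / (I : ℝ) else 0 := by split_ifs <;> positivity
  unfold noise
  positivity

lemma initBound_nonneg (b₀ : ℕ) {gap R : ℝ} (hgap : 0 ≤ gap) (hR : 0 ≤ R) :
    0 ≤ initBound K D θ m I b₀ c gap R := by
  have := hc.q_pos
  have := hc.α_pos
  have := hc.αb_pos
  have := hc.β_pos
  have := hc.a_pos
  have := hc.η_pos
  have := K.wS_nonneg
  have := K.wY_nonneg
  have := K.wH_nonneg hc.θ_pos
  have := K.hyperVar_nonneg D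
  unfold initBound
  positivity

end Steps.Balanced

/-! ### The expected potential at the start and along the run -/

namespace Problem

variable {m dx : ℕ} {dy : Fin m → ℕ} {Ξ Z : Fin m → Type*}
  [∀ i, MeasurableSpace (Ξ i)] [∀ i, MeasurableSpace (Z i)]
  {p : Problem m dx dy Ξ Z} {K : Consts} {D : ℕ} (h : p.Standing K D) {b b₀ I : ℕ}

namespace Standing

include h

lemma meanLE_errS_init (hb : 1 ≤ b₀) (hm : 1 ≤ m) (x₁ : Vec dx) (y₁ : (i : Fin m) → Vec (dy i)) :
    MeanLE (batchLaw p b₀) (fun w => p.errS (initState p K.lam x₁ y₁ w)) (K.σ ^ 2 / b₀) := by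
  refine ((MeanLE.blockMean (c := fun _ => K.σ ^ 2 / b₀) fun i => ?_).mono
    (le_of_eq (blockMean_const hm _))).of_le fun w => le_rfl
  have := h.probQ i
  exact (meanLE_batchMean_sub (h.gy_memLp i x₁ (y₁ i)) (h.gy_meas i x₁ (y₁ i))
    (h.integral_gy i x₁ (y₁ i)) (integral_norm_sub_sq_le_of_lintegral
      (h.gy_meas i x₁ (y₁ i)).aestronglyMeasurable (h.sto.gy_var i x₁ (y₁ i)))
    hb).comp_measurePreserving (h.measurePreserving_batch_snd b₀ i)

lemma meanLE_errH_init (hb : 1 ≤ b₀) (hm : 1 ≤ m) (x₁ : Vec dx) (y₁ : (i : Fin m) → Vec (dy i)) :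
    MeanLE (batchLaw p b₀) (fun w => p.errH (initState p K.lam x₁ y₁ w)) (D * K.σ ^ 2 / b₀) := by
  have hi : ∀ i, MeanLE (batchLaw p b₀)
      (fun w => ‖batchMean (fun ζ => entries (dy i) (p.gyy i x₁ (y₁ i) ζ)) (w.2 i)
        - entries (dy i) (p.gyyBar i x₁ (y₁ i))‖ ^ 2) (D * K.σ ^ 2 / b₀) := fun i => by
    have := h.probQ i
    exact (meanLE_batchMean_sub (h.entries_gyy_memLp i x₁ (y₁ i))
      (h.entries_gyy_meas i x₁ (y₁ i)) (h.integral_entries_gyy i x₁ (y₁ i))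
      (h.integral_entries_gyy_sub_le i x₁ (y₁ i)) hb).comp_measurePreserving
        (h.measurePreserving_batch_snd b₀ i)
  refine ((MeanLE.blockMean hi).mono (le_of_eq (blockMean_const hm _))).of_le fun w =>
    blockMean_mono fun i => ?_
  rw [batchMean_entries, ← map_sub, norm_entries_sq]
  exact frobSq_proj_sub_le K.lam _ (h.gyyBar_mem_geSet i x₁ (y₁ i))

/-- H₁ and z₁ share a mini-batch, so unbiasedness for fixed H is of no use here; the bound that is
uniform in H replaces it. -/
lemma meanLE_errZ_init (hb : 1 ≤ b₀) (hm : 1 ≤ m) (x₁ : Vec dx) (y₁ : (i : Fin m) → Vec (dy i)) :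
    MeanLE (batchLaw p b₀) (fun w => p.errZ (initState p K.lam x₁ y₁ w)) (K.hyperVar D / b₀) := by
  choose e he1 he2 using fun i => h.exists_hyperGrad_bound hb i x₁ (y₁ i)
  refine ((MeanLE.blockMean he1).mono (le_of_eq (blockMean_const hm _))).of_le fun w => ?_
  have e1 : (initState p K.lam x₁ y₁ w).z - p.hyperAvg (initState p K.lam x₁ y₁ w).xPrev
      (initState p K.lam x₁ y₁ w).yPrev (initState p K.lam x₁ y₁ w).HPrev
      = (m : ℝ)⁻¹ • ∑ i, (hyperGrad p i x₁ (y₁ i)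
          (proj K.lam (batchMean (p.gyy i x₁ (y₁ i)) (w.2 i))) w
        - p.hyperMean i x₁ (y₁ i) (proj K.lam (batchMean (p.gyy i x₁ (y₁ i)) (w.2 i)))) := by
    rw [Finset.sum_sub_distrib, smul_sub]
    rfl
  rw [errZ, e1]
  exact (norm_blockMean_sq_le hm _).trans (blockMean_mono fun i => he2 i w _ (proj_mem_geSet _ _))

/-- Expected initial potential, for a fixed starting point. -/
lemma meanLE_potential_init (hb : 1 ≤ b₀) {θ : ℝ} {c : Steps} (hc : c.Balanced K D θ m I)
    (low : ℝ) (x₁ : Vec dx) (y₁ : (i : Fin m) → Vec (dy i)) :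
    MeanLE (batchLaw p b₀) (fun w => p.potential K θ I c low (initState p K.lam x₁ y₁ w))
      (initBound K D θ m I b₀ c (p.F x₁ - low)
        (blockMean fun i => ‖y₁ i - p.yStar i x₁‖ ^ 2)) := by
  have hprob := h.isProbabilityMeasure_batchLaw b₀
  have hm := hc.I_pos.trans hc.I_le
  have hq := hc.q_pos
  have hα := hc.α_pos
  have hαb := hc.αb_pos
  have hβ := hc.β_pos
  have ha := hc.a_pos
  have hη := hc.η_pos
  have hwS := K.wS_nonneg
  have hwH := K.wH_nonneg hc.θ_pos
  have m1 := (h.meanLE_errS_init hb hm x₁ y₁).const_mul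
    (a := K.wS * c.η / (I / m * c.α)) (by positivity)
  have m2 := (h.meanLE_errH_init hb hm x₁ y₁).const_mul
    (a := K.wH θ * c.η / (I / m * c.αb)) (by positivity)
  have m3 := (h.meanLE_errZ_init hb hm x₁ y₁).const_mul (a := c.η / c.β) (by positivity)
  refine ((((MeanLE.const (p.F x₁ - low + K.wY * c.η / (c.τ * c.τt)
    * blockMean fun i => ‖y₁ i - p.yStar i x₁‖ ^ 2)).add m1).add m2).add m3 |>.mono ?_).of_le
      fun w => le_of_eq ?_
  · unfold initBound
    linarith
  · have e1 : (initState p K.lam x₁ y₁ w).moveX = 0 := by simp [State.moveX, initState]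
    have e2 : (initState p K.lam x₁ y₁ w).moveY = 0 := by simp [State.moveY, initState, blockMean]
    have e3 : (initState p K.lam x₁ y₁ w).moveH = 0 := by simp [State.moveH, initState, blockMean]
    have e4 : p.errY (initState p K.lam x₁ y₁ w) = blockMean fun i => ‖y₁ i - p.yStar i x₁‖ ^ 2 :=
      rfl
    have e5 : (initState p K.lam x₁ y₁ w).x = x₁ := rfl
    unfold potential
    rw [e1, e2, e3, e4, e5]
    ring

/-! ### Summation along the run -/

section Run

variable {θ : ℝ} {c : Steps} {low : ℝ} {x₁ : Vec dx}
  {Ω : Type*} [MeasurableSpace Ω] {μ : Measure Ω} [IsProbabilityMeasure μ]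
  {y₁ : Ω → (i : Fin m) → Vec (dy i)} {w₀ : Ω → Batches Ξ Z b₀} {w : ℕ → Ω → IterSample Ξ Z b}

/-- Expected initial potential. -/
lemma lintegral_potential_init_le (hb : 1 ≤ b₀) (hc : c.Balanced K D θ m I)
    (hlow : ∀ x, low ≤ p.F x) (hs : IsSampling p I b b₀ μ y₁ w₀ w) {R : ℝ} (hR : 0 ≤ R)
    (hy : ∫⁻ ω, ∑ i, ‖y₁ ω i - p.yStar i x₁‖ₑ ^ 2 ∂μ ≤ ENNReal.ofReal (m * R)) :
    ∫⁻ ω, ENNReal.ofReal (p.potential K θ I c low (initState p K.lam x₁ (y₁ ω) (w₀ ω))) ∂μ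
      ≤ ENNReal.ofReal (initBound K D θ m I b₀ c (p.F x₁ - low) R) := by
  have hm := hc.I_pos.trans hc.I_le
  have hm0 : (0 : ℝ) < m := by exact_mod_cast hm
  have hk : 0 ≤ K.wY * c.η / (c.τ * c.τt) :=
    div_nonneg (mul_nonneg K.wY_nonneg hc.η_pos.le) hc.a_pos.le
  set k := K.wY * c.η / (c.τ * c.τt) with hkk
  -- The bound is affine in the initial error of y. After integrating out the initial mini-batch for
  -- fixed y₁, only that error remains to be averaged over y₁.
  set c₀ := initBound K D θ m I b₀ c (p.F x₁ - low) 0 with hc₀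
  have hc₀0 : 0 ≤ c₀ := hc.initBound_nonneg b₀ (sub_nonneg.2 (hlow x₁)) le_rfl
  have esum : ∀ r, initBound K D θ m I b₀ c (p.F x₁ - low) r = c₀ + k * r := fun r => by
    rw [hc₀, initBound, initBound, hkk]
    ring
  have hsq : ∀ y : (i : Fin m) → Vec (dy i),
      ENNReal.ofReal (blockMean fun i => ‖y i - p.yStar i x₁‖ ^ 2)
        = ENNReal.ofReal (m : ℝ)⁻¹ * ∑ i, ‖y i - p.yStar i x₁‖ₑ ^ 2 := fun y => by
    rw [blockMean, ENNReal.ofReal_mul (by positivity),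
      ENNReal.ofReal_sum_of_nonneg fun i _ => by positivity]
    congr 1
    refine Finset.sum_congr rfl fun i _ => ?_
    rw [ENNReal.ofReal_pow (norm_nonneg _), ofReal_norm]
  have hmeas : Measurable fun y : (i : Fin m) → Vec (dy i) =>
      blockMean fun i => ‖y i - p.yStar i x₁‖ ^ 2 :=
    measurable_blockMean fun i => ((measurable_pi_apply i).sub_const _).norm.pow_const 2
  have key := lintegral_indepFun_le (f := fun a : ((i : Fin m) → Vec (dy i)) × Batches Ξ Z b₀ =>
      ENNReal.ofReal (p.potential K θ I c low (initState p K.lam x₁ a.1 a.2)))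
    (g := fun y => ENNReal.ofReal (c₀ + k * blockMean fun i => ‖y i - p.yStar i x₁‖ ^ 2))
    hs.y₁_meas hs.w₀_meas hs.indep_init hs.w₀_law
    (h.measurable_potential θ c low (h.meas_initState x₁ measurable_fst measurable_snd)).ennreal_ofReal
    ((hmeas.const_mul k).const_add c₀).ennreal_ofReal (fun y => by
      have := (h.meanLE_potential_init hb hc low x₁ y).lintegral_le
        fun w => potential_nonneg hc hlow _
      rwa [esum] at this)
  refine key.trans ?_
  rw [esum]
  have e : ∀ ω, ENNReal.ofReal (c₀ + k * blockMean fun i => ‖y₁ ω i - p.yStar i x₁‖ ^ 2)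
      = ENNReal.ofReal c₀ + ENNReal.ofReal k * (ENNReal.ofReal (m : ℝ)⁻¹
        * ∑ i, ‖y₁ ω i - p.yStar i x₁‖ₑ ^ 2) := fun ω => by
    rw [ENNReal.ofReal_add hc₀0 (mul_nonneg hk (blockMean_nonneg fun i => by positivity)),
      ENNReal.ofReal_mul hk, hsq]
  simp only [e]
  rw [lintegral_add_left measurable_const, lintegral_const_mul' _ _ ENNReal.ofReal_ne_top,
    lintegral_const_mul' _ _ ENNReal.ofReal_ne_top, ENNReal.ofReal_add hc₀0 (mul_nonneg hk hR),
    ENNReal.ofReal_mul hk]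
  rw [lintegral_const, measure_univ, mul_one]
  gcongr
  calc ENNReal.ofReal (m : ℝ)⁻¹ * ∫⁻ ω, ∑ i, ‖y₁ ω i - p.yStar i x₁‖ₑ ^ 2 ∂μ
      ≤ ENNReal.ofReal (m : ℝ)⁻¹ * ENNReal.ofReal (m * R) := by gcongr
    _ = ENNReal.ofReal R := by
        rw [← ENNReal.ofReal_mul (by positivity), inv_mul_cancel_left₀ hm0.ne']

/-- Expected descent along a run. -/
lemma lintegral_potential_run_succ_le (hb : 1 ≤ b) (hc : c.Balanced K D θ m I)
    (hlow : ∀ x, low ≤ p.F x) (hs : IsSampling p I b b₀ μ y₁ w₀ w) (t : ℕ) :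
    ∫⁻ ω, (ENNReal.ofReal (c.η / 2 * ‖gradient p.F
          (run p K.lam I c x₁ (y₁ ω) (w₀ ω) (fun t => w t ω) t).x‖ ^ 2)
        + ENNReal.ofReal (p.potential K θ I c low
          (run p K.lam I c x₁ (y₁ ω) (w₀ ω) (fun t => w t ω) (t + 1)))) ∂μ
      ≤ ∫⁻ ω, (ENNReal.ofReal (p.potential K θ I c low
          (run p K.lam I c x₁ (y₁ ω) (w₀ ω) (fun t => w t ω) t))
        + ENNReal.ofReal (c.η * noise K D θ m I b c)) ∂μ := by
  have hprob := h.isProbabilityMeasure_iterLaw (b := b) hc.I_le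
  have hη := hc.η_pos
  have hr := h.meas_runOn (I := I) (b := b) (b₀ := b₀) c x₁ t
  have hn := hc.noise_nonneg b
  have key := lintegral_indepFun_le
    (f := fun a : ((((i : Fin m) → Vec (dy i)) × Batches Ξ Z b₀)
        × (Fin t → IterSample Ξ Z b)) × IterSample Ξ Z b =>
      ENNReal.ofReal (c.η / 2 * ‖gradient p.F (runOn p K.lam I c x₁ a.1.1 t a.1.2).x‖ ^ 2)
        + ENNReal.ofReal (p.potential K θ I c low
          (step p K.lam I c a.2 (runOn p K.lam I c x₁ a.1.1 t a.1.2))))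
    (g := fun a => ENNReal.ofReal (p.potential K θ I c low (runOn p K.lam I c x₁ a.1 t a.2))
      + ENNReal.ofReal (c.η * noise K D θ m I b c))
    (hs.measurable_past t) (hs.w_meas t) (hs.indepFun_past t) (hs.w_law t)
    ((((h.measurable_gradient_F_sq hr).comp measurable_fst).const_mul _).ennreal_ofReal.add
      (h.measurable_potential θ c low
        (h.meas_step c (hr.comp measurable_fst) measurable_snd)).ennreal_ofReal)
    ((h.measurable_potential θ c low hr).ennreal_ofReal.add_const _) (fun a => by
      set st := runOn p K.lam I c x₁ a.1 t a.2
      have k1 := (MeanLE.const (ν := iterLaw p I b) (c.η / 2 * ‖gradient p.F st.x‖ ^ 2)).add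
        (h.meanLE_potential hb hc low (st := st) (runOn_valid c x₁ a.1 t a.2))
      have k2 := k1.lintegral_le fun v =>
        add_nonneg (by positivity) (potential_nonneg hc hlow _)
      rw [show c.η / 2 * ‖gradient p.F st.x‖ ^ 2 + (p.potential K θ I c low st
        - c.η / 2 * ‖gradient p.F st.x‖ ^ 2 + c.η * noise K D θ m I b c)
        = p.potential K θ I c low st + c.η * noise K D θ m I b c by ring,
        ENNReal.ofReal_add (potential_nonneg hc hlow _) (mul_nonneg hη.le hn)] at k2
      refine le_trans (le_of_eq (lintegral_congr fun v => ?_)) k2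
      rw [ENNReal.ofReal_add (by positivity) (potential_nonneg hc hlow _)])
  have e : ∀ ω, runOn p K.lam I c x₁ (y₁ ω, w₀ ω) t (fun s : Fin t => w s ω)
      = run p K.lam I c x₁ (y₁ ω) (w₀ ω) (fun t => w t ω) t := fun ω =>
    runOn_eq K.lam c x₁ (y₁ ω) (w₀ ω) (fun t => w t ω) t
  simp only [e] at key
  exact key

lemma measurable_potential_run (hs : IsSampling p I b b₀ μ y₁ w₀ w) (t : ℕ) :
    State.Meas fun ω => run p K.lam I c x₁ (y₁ ω) (w₀ ω) (fun t => w t ω) t := by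
  have := (h.meas_runOn (I := I) (b := b) (b₀ := b₀) c x₁ t).comp (hs.measurable_past t)
  have e : ∀ ω, runOn p K.lam I c x₁ (y₁ ω, w₀ ω) t (fun s : Fin t => w s ω)
      = run p K.lam I c x₁ (y₁ ω) (w₀ ω) (fun t => w t ω) t := fun ω =>
    runOn_eq K.lam c x₁ (y₁ ω) (w₀ ω) (fun t => w t ω) t
  simpa only [e] using this

/-- Telescoping; the final potential stays on the left so that no subtraction of extended
nonnegative numbers occurs. -/
lemma sum_lintegral_gradient_le (hb : 1 ≤ b) (hc : c.Balanced K D θ m I)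
    (hlow : ∀ x, low ≤ p.F x) (hs : IsSampling p I b b₀ μ y₁ w₀ w) (T : ℕ) :
    ∑ t ∈ Finset.range T, ∫⁻ ω, ENNReal.ofReal (c.η / 2 * ‖gradient p.F
          (run p K.lam I c x₁ (y₁ ω) (w₀ ω) (fun t => w t ω) t).x‖ ^ 2) ∂μ
        + ∫⁻ ω, ENNReal.ofReal (p.potential K θ I c low
          (run p K.lam I c x₁ (y₁ ω) (w₀ ω) (fun t => w t ω) T)) ∂μ
      ≤ ∫⁻ ω, ENNReal.ofReal (p.potential K θ I c low
          (initState p K.lam x₁ (y₁ ω) (w₀ ω))) ∂μ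
        + T * ENNReal.ofReal (c.η * noise K D θ m I b c) := by
  induction T with
  | zero =>
    rw [Finset.sum_range_zero, zero_add, Nat.cast_zero, zero_mul, add_zero]
    exact le_rfl
  | succ T ih =>
    have k1 := h.lintegral_potential_run_succ_le (x₁ := x₁) hb hc hlow hs T
    have mT := h.measurable_potential_run (c := c) (x₁ := x₁) hs T
    rw [lintegral_add_left ((h.measurable_gradient_F_sq mT).const_mul _).ennreal_ofReal,
      lintegral_add_left (h.measurable_potential θ c low mT).ennreal_ofReal, lintegral_const,
      measure_univ, mul_one] at k1
    rw [Finset.sum_range_succ, add_assoc]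
    refine (add_le_add le_rfl k1).trans ?_
    rw [← add_assoc]
    refine (add_le_add ih le_rfl).trans (le_of_eq ?_)
    push_cast
    ring

/-- Expected mean squared gradient norm along a run. -/
theorem integral_mean_gradient_sq_le (hb : 1 ≤ b) (hb₀ : 1 ≤ b₀) (hc : c.Balanced K D θ m I)
    (hlow : ∀ x, low ≤ p.F x) (hs : IsSampling p I b b₀ μ y₁ w₀ w) {R : ℝ} (hR : 0 ≤ R)
    (hy : ∫⁻ ω, ∑ i, ‖y₁ ω i - p.yStar i x₁‖ₑ ^ 2 ∂μ ≤ ENNReal.ofReal (m * R)) {ε : ℝ} {T : ℕ}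
    (hT : 1 ≤ T) (hle : initBound K D θ m I b₀ c (p.F x₁ - low) R
      + T * (c.η * noise K D θ m I b c) ≤ c.η / 2 * (T * ε ^ 2)) :
    Integrable (fun ω => (T : ℝ)⁻¹ * ∑ t ∈ Finset.range T, ‖gradient p.F
        (run p K.lam I c x₁ (y₁ ω) (w₀ ω) (fun t => w t ω) t).x‖ ^ 2) μ ∧
      ∫ ω, (T : ℝ)⁻¹ * ∑ t ∈ Finset.range T, ‖gradient p.F
        (run p K.lam I c x₁ (y₁ ω) (w₀ ω) (fun t => w t ω) t).x‖ ^ 2 ∂μ ≤ ε ^ 2 := by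
  have hη := hc.η_pos
  have hT0 : (0 : ℝ) < T := by exact_mod_cast hT
  set g : ℕ → Ω → ℝ := fun t ω => ‖gradient p.F
    (run p K.lam I c x₁ (y₁ ω) (w₀ ω) (fun t => w t ω) t).x‖ ^ 2 with hg
  have mg : ∀ t, Measurable (g t) := fun t =>
    h.measurable_gradient_F_sq (h.measurable_potential_run hs t)
  have hn := hc.noise_nonneg b
  have hi0 := hc.initBound_nonneg b₀ (sub_nonneg.2 (hlow x₁)) hR
  have k1 : ∑ t ∈ Finset.range T, ∫⁻ ω, ENNReal.ofReal (c.η / 2 * g t ω) ∂μ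
      ≤ ENNReal.ofReal (c.η / 2 * (T * ε ^ 2)) := by
    refine (le_add_of_nonneg_right zero_le).trans
      ((h.sum_lintegral_gradient_le (x₁ := x₁) hb hc hlow hs T).trans ?_)
    refine (add_le_add (h.lintegral_potential_init_le hb₀ hc hlow hs hR hy) le_rfl).trans ?_
    rw [← ENNReal.ofReal_natCast, ← ENNReal.ofReal_mul hT0.le,
      ← ENNReal.ofReal_add hi0 (by positivity)]
    exact ENNReal.ofReal_le_ofReal hle
  have mS : Measurable fun ω => (T : ℝ)⁻¹ * ∑ t ∈ Finset.range T, g t ω :=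
    (Finset.measurable_fun_sum _ fun t _ => mg t).const_mul _
  have n0 : ∀ ω, 0 ≤ (T : ℝ)⁻¹ * ∑ t ∈ Finset.range T, g t ω := fun ω =>
    mul_nonneg (by positivity) (Finset.sum_nonneg fun t _ => by simp only [hg]; positivity)
  have k2 : ∫⁻ ω, ENNReal.ofReal ((T : ℝ)⁻¹ * ∑ t ∈ Finset.range T, g t ω) ∂μ
      ≤ ENNReal.ofReal (ε ^ 2) := by
    have e : ∀ ω, ENNReal.ofReal ((T : ℝ)⁻¹ * ∑ t ∈ Finset.range T, g t ω)
        = ENNReal.ofReal ((c.η / 2)⁻¹ * (T : ℝ)⁻¹)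
          * ∑ t ∈ Finset.range T, ENNReal.ofReal (c.η / 2 * g t ω) := fun ω => by
      rw [← ENNReal.ofReal_sum_of_nonneg fun t _ => by simp only [hg]; positivity,
        ← ENNReal.ofReal_mul (by positivity), ← Finset.mul_sum]
      congr 1
      field_simp
    simp only [e]
    rw [lintegral_const_mul' _ _ ENNReal.ofReal_ne_top,
      lintegral_finsetSum _ fun t _ => ((mg t).const_mul _).ennreal_ofReal]
    calc _ ≤ ENNReal.ofReal ((c.η / 2)⁻¹ * (T : ℝ)⁻¹) * ENNReal.ofReal (c.η / 2 * (T * ε ^ 2)) := by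
          gcongr
      _ = ENNReal.ofReal (ε ^ 2) := by
          rw [← ENNReal.ofReal_mul (by positivity)]
          congr 1
          field_simp
  have hint : Integrable (fun ω => (T : ℝ)⁻¹ * ∑ t ∈ Finset.range T, g t ω) μ := by
    refine ⟨mS.aestronglyMeasurable, ?_⟩
    rw [hasFiniteIntegral_iff_ofReal (Filter.Eventually.of_forall n0)]
    exact k2.trans_lt ENNReal.ofReal_lt_top
  refine ⟨hint, ?_⟩
  rw [integral_eq_lintegral_of_nonneg_ae (Filter.Eventually.of_forall n0)
    mS.aestronglyMeasurable]
  exact ENNReal.toReal_le_of_le_ofReal (sq_nonneg ε) k2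

end Run

end Standing

end Problem


/-! ### The choice of the constants -/

section Rho

variable {m I B : ℕ}

lemma one_div_le_rho (m I B : ℕ) : 1 / (B : ℝ) ≤ rho m I B := by
  unfold rho
  refine le_add_of_nonneg_left ?_
  split_ifs <;> positivity

lemma ind_le_rho (m I B : ℕ) : (if I < m then 1 / (I : ℝ) else 0) ≤ rho m I B :=
  le_add_of_nonneg_right (by positivity)

lemma rho_pos (hB : 1 ≤ B) : 0 < rho m I B := by
  have hB0 : (0 : ℝ) < B := by exact_mod_cast hB
  exact lt_of_lt_of_le (by positivity) (one_div_le_rho m I B)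

lemma rho_le_two (hI : 1 ≤ I) (hB : 1 ≤ B) : rho m I B ≤ 2 := by
  have hB0 : (1 : ℝ) ≤ B := by exact_mod_cast hB
  have hI0 : (1 : ℝ) ≤ I := by exact_mod_cast hI
  have h1 : 1 / (B : ℝ) ≤ 1 := (div_le_one (by linarith)).2 hB0
  have h2 : 1 / (I : ℝ) ≤ 1 := (div_le_one (by linarith)).2 hI0
  unfold rho
  split_ifs <;> linarith

lemma inv_rho_le (hB : 1 ≤ B) : (rho m I B)⁻¹ ≤ B := by
  have hB0 : (0 : ℝ) < B := by exact_mod_cast hB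
  rw [inv_le_comm₀ (rho_pos hB) hB0, ← one_div]
  exact one_div_le_rho m I B

/-- Since 1/B ≤ 1, its square is at most 1/B ≤ ρ. Needed for the initial error of s, whose weight is
proportional to 1/α. -/
lemma one_div_le_sqrt_rho (hB : 1 ≤ B) : 1 / (B : ℝ) ≤ √(rho m I B) := by
  have hB0 : (1 : ℝ) ≤ B := by exact_mod_cast hB
  have h1 : 1 / (B : ℝ) ≤ 1 := (div_le_one (by linarith)).2 hB0
  have h0 : 0 ≤ 1 / (B : ℝ) := by positivity
  refine Real.le_sqrt_of_sq_le (le_trans ?_ (one_div_le_rho m I B))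
  nlinarith

lemma rho_le_sqrt_rho (hI : 1 ≤ I) (hB : 1 ≤ B) : rho m I B ≤ 2 * √(rho m I B) := by
  have h0 := rho_pos (m := m) (I := I) hB
  have h2 : √(rho m I B) ≤ 2 := by
    rw [Real.sqrt_le_left (by norm_num)]
    linarith [rho_le_two (m := m) hI hB]
  calc rho m I B = √(rho m I B) * √(rho m I B) := (Real.mul_self_sqrt h0.le).symm
    _ ≤ 2 * √(rho m I B) := by gcongr

/-- Subadditivity of the square root; it splits the rate into its two summands. -/
lemma sqrt_rho_le : √(rho m I B) ≤ (if I < m then 1 / √I else 0) + 1 / √B := by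
  rw [Real.sqrt_le_left (add_nonneg (by split_ifs <;> positivity) (by positivity))]
  unfold rho
  have h1 : (1 / √(B : ℝ)) ^ 2 = 1 / B := by rw [div_pow, Real.sq_sqrt (by positivity), one_pow]
  have h2 : (1 / √(I : ℝ)) ^ 2 = 1 / I := by rw [div_pow, Real.sq_sqrt (by positivity), one_pow]
  split_ifs
  · rw [add_sq, h1, h2]
    have : 0 ≤ 2 * (1 / √(I : ℝ)) * (1 / √(B : ℝ)) := by positivity
    linarith
  · rw [zero_add, zero_add, h1]

lemma le_rate (m I B : ℕ) {ε : ℝ} (hε : 0 < ε) :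
    m / (I * ε ^ 3) * √(rho m I B) ≤ rate m I B ε := by
  refine (mul_le_mul_of_nonneg_left sqrt_rho_le (by positivity)).trans (le_of_eq ?_)
  unfold rate
  split_ifs <;> ring

end Rho

namespace Consts

variable (K : Consts) (D : ℕ) (θ τ : ℝ)

/-- The constant in the bound for `τ_t`. -/
def innerStepConst : ℝ := θ / (τ ^ 2 * K.moveConst D θ)

/-- The ratio in the bound for `τ_t`. -/
def innerStepRatio : ℝ := K.innerStepConst D θ τ / (12 * K.noiseConst D θ)

/-- The constant in the bound for `η`. -/
def outerStepConst : ℝ := τ ^ 2 * θ ^ 2 * K.innerStepRatio D θ τ / K.ratioConst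

/-- The constant in the bound for the number of iterations. -/
def iterConst (Δ R κ : ℝ) : ℝ :=
  4 * (Δ / (θ * √(K.outerStepConst D θ τ)) + K.wY * R / (τ * θ * √(K.innerStepRatio D θ τ))
    + 12 * K.noiseConst D θ / (κ * θ) * (K.wS * K.σ ^ 2 + 2 * K.wH θ * (D * K.σ ^ 2)
      + 2 * K.hyperVar D)) + 1

variable {θ τ}

lemma innerStepConst_pos (hθ : 0 < θ) (hτ : 0 < τ) : 0 < K.innerStepConst D θ τ := by
  have := K.moveConst_pos D hθ
  unfold innerStepConst
  positivity

lemma innerStepRatio_pos (hθ : 0 < θ) (hτ : 0 < τ) : 0 < K.innerStepRatio D θ τ := by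
  have := K.noiseConst_pos D hθ
  have := K.innerStepConst_pos D hθ hτ
  unfold innerStepRatio
  positivity

lemma outerStepConst_pos (hθ : 0 < θ) (hτ : 0 < τ) : 0 < K.outerStepConst D θ τ := by
  have := K.innerStepRatio_pos D hθ hτ
  have := K.ratioConst_pos
  unfold outerStepConst
  positivity

lemma iterConst_pos (hθ : 0 < θ) (hτ : 0 < τ) {Δ R κ : ℝ} (hΔ : 0 ≤ Δ) (hR : 0 ≤ R) (hκ : 0 < κ) :
    0 < K.iterConst D θ τ Δ R κ := by
  have := K.noiseConst_pos D hθ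
  have := K.wS_nonneg
  have := K.wY_nonneg
  have := K.wH_nonneg hθ
  have := K.hyperVar_nonneg D
  unfold iterConst
  positivity

end Consts

variable {K : Consts} {D : ℕ} {θ τ : ℝ} {m I B : ℕ} {ε : ℝ} {c : Steps}

/-- Step sizes of the prescribed order are balanced. -/
lemma Admissible.balanced (hA : Admissible θ (K.innerStepConst D θ τ) (K.noiseConst D θ) (K.outerStepConst D θ τ)
      (2 * K.LF) m I B ε c) (hθ : 0 < θ) (hτ : 0 < τ) (hI : 1 ≤ I) (hIm : I ≤ m)
    (hB : 1 ≤ B) (hε : 0 < ε) (hcτ : c.τ = τ) : c.Balanced K D θ m I := by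
  have hI0 : (0 : ℝ) < I := by exact_mod_cast hI
  have hm0 : (0 : ℝ) < m := by exact_mod_cast hI.trans hIm
  have hB0 : (0 : ℝ) < B := by exact_mod_cast hB
  have hN := K.noiseConst_pos D hθ
  have hC8 := K.innerStepConst_pos D hθ hτ
  have hr8 := K.innerStepRatio_pos D hθ hτ
  have hC11 := K.outerStepConst_pos D hθ hτ
  have hM := K.moveConst_pos D hθ
  have hrc := K.ratioConst_pos
  have hLF := K.LF_pos
  have hρ := rho_pos (m := m) (I := I) hB
  have hρi := inv_rho_le (m := m) (I := I) hB
  set ρ := rho m I B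
  have hs : 0 < √ρ := Real.sqrt_pos.2 hρ
  have hss : (√ρ)⁻¹ ^ 2 = ρ⁻¹ := by rw [inv_pow, Real.sq_sqrt hρ.le]
  have hα : 0 < c.α := lt_of_lt_of_le (by positivity) hA.α_ord.1
  have hαb : 0 < c.αb := lt_of_lt_of_le (by positivity) hA.αb_ord.1
  have hβ : 0 < c.β := lt_of_lt_of_le (by positivity) hA.β_ord.1
  have hτt : 0 < c.τt := lt_of_lt_of_le (by positivity) hA.τt_ord.1
  have hη : 0 < c.η := lt_of_lt_of_le (by positivity) hA.η_ord.1
  have e8 : √(K.innerStepConst D θ τ / (12 * K.noiseConst D θ)) ^ 2 = K.innerStepRatio D θ τ := Real.sq_sqrt hr8.le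
  have e11 : √(K.outerStepConst D θ τ) ^ 2 = K.outerStepConst D θ τ := Real.sq_sqrt hC11.le
  -- `innerStepConst` is defined so that the upper bound for τ_t gives exactly θ times the order of
  -- ᾱ and β, which is below both; for α one uses ρ⁻¹ ≤ B.
  have a_le : K.moveConst D θ * (c.τ * c.τt) ^ 2
      ≤ (I / m : ℝ) ^ 2 * (θ * (ε ^ 2 / (12 * K.noiseConst D θ) * ρ⁻¹)) := by
    rw [hcτ]
    calc K.moveConst D θ * (τ * c.τt) ^ 2
        ≤ K.moveConst D θ * (τ * (√(K.innerStepConst D θ τ / (12 * K.noiseConst D θ)) * (I / m * ε)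
          * (√ρ)⁻¹)) ^ 2 := by
          gcongr
          exact hA.τt_ord.2
      _ = K.moveConst D θ * τ ^ 2 * (√(K.innerStepConst D θ τ / (12 * K.noiseConst D θ)) ^ 2)
          * (I / m * ε) ^ 2 * ((√ρ)⁻¹ ^ 2) := by ring
      _ = _ := by
          rw [e8, hss, Consts.innerStepRatio, Consts.innerStepConst]
          field_simp
  refine ⟨hθ, hI, hIm, hα, hA.α_le, hαb, hA.αb_le, hβ, hA.β_le, ?_, ?_, hη, ?_, ?_, ?_, ?_, ?_⟩
  · exact (mul_le_mul_of_nonneg_left hA.αb_ord.2 hθ.le).trans hA.β_ord.1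
  · rw [hcτ]
    positivity
  · have := mul_le_mul_of_nonneg_right hA.η_le hLF.le
    refine this.trans (le_of_eq ?_)
    field_simp
    norm_num
  · refine a_le.trans (mul_le_mul_of_nonneg_left (le_trans ?_ hA.α_ord.1) (sq_nonneg _))
    refine mul_le_mul_of_nonneg_left ?_ hθ.le
    calc ε ^ 2 / (12 * K.noiseConst D θ) * ρ⁻¹ ≤ ε ^ 2 / (12 * K.noiseConst D θ) * B := by gcongr
      _ = _ := by ring
  · exact a_le.trans (mul_le_mul_of_nonneg_left hA.αb_ord.1 (sq_nonneg _))
  · exact a_le.trans (mul_le_mul_of_nonneg_left hA.β_ord.1 (sq_nonneg _))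
  · calc K.ratioConst * c.η ^ 2
        ≤ K.ratioConst * (√(K.outerStepConst D θ τ) * (I / m * ε) * (√ρ)⁻¹) ^ 2 := by
          gcongr
          exact hA.η_ord.2
      _ = K.ratioConst * √(K.outerStepConst D θ τ) ^ 2 * (I / m * ε) ^ 2 * (√ρ)⁻¹ ^ 2 := by ring
      -- `outerStepConst` is chosen so that the upper bound for η matches the lower bound for τ τ_t.
      _ = (τ * (θ * (√(K.innerStepConst D θ τ / (12 * K.noiseConst D θ)) * (I / m * ε)
          * (√ρ)⁻¹))) ^ 2 := by
          rw [e11, Consts.outerStepConst]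
          have : K.ratioConst * (τ ^ 2 * θ ^ 2 * K.innerStepRatio D θ τ / K.ratioConst)
              = τ ^ 2 * θ ^ 2 * K.innerStepRatio D θ τ := by field_simp
          rw [this, ← e8]
          ring
      _ ≤ (c.τ * c.τt) ^ 2 := by
          rw [hcτ]
          gcongr
          exact hA.τt_ord.1

/-- The noise level of admissible step sizes. -/
lemma Admissible.noise_le {C8 C11 LF : ℝ} (hA : Admissible θ C8 (K.noiseConst D θ) C11 LF m I B ε c)
    (hc : c.Balanced K D θ m I) (hB : 1 ≤ B) : noise K D θ m I B c ≤ ε ^ 2 / 12 := by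
  have hB0 : (0 : ℝ) < B := by exact_mod_cast hB
  have hθ := hc.θ_pos
  have hN := K.noiseConst_pos D hθ
  have hρ := rho_pos (m := m) (I := I) hB
  have hα := hc.α_pos
  have hαb := hc.αb_pos
  have hβ := hc.β_pos
  have hwS := K.wS_nonneg
  have hwH := K.wH_nonneg hθ
  have hL := K.hyperLip_nonneg
  have hV := K.hyperVar_nonneg D
  have h1B := one_div_le_rho m I B
  have hind := ind_le_rho m I B
  set ρ := rho m I B
  set δ := ε ^ 2 / (12 * K.noiseConst D θ) with hδ
  have hδ0 : 0 ≤ δ := by positivity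
  -- Every product of a step size with its variance factor is at most δ = ε²/(12 C10). This is why α
  -- may carry the extra factor B, while ᾱ and β carry ρ⁻¹.
  have k1 : c.α * (1 / B) ≤ δ := by
    rw [mul_one_div, div_le_iff₀ hB0]
    exact hA.α_ord.2.trans (le_of_eq (by rw [hδ]; ring))
  have k0 : ∀ r, r ≤ δ * ρ⁻¹ → r * ρ ≤ δ := fun r hr => by
    rw [← div_eq_mul_inv, le_div_iff₀ hρ] at hr
    exact hr
  have k2 : c.αb * (1 / B) ≤ δ :=
    (mul_le_mul_of_nonneg_left h1B hαb.le).trans (k0 _ hA.αb_ord.2)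
  have k3 : c.β * (1 / B) ≤ δ :=
    (mul_le_mul_of_nonneg_left h1B hβ.le).trans (k0 _ hA.β_ord.2)
  have k4 : c.β * (if I < m then 1 / (I : ℝ) else 0) ≤ δ :=
    (mul_le_mul_of_nonneg_left hind hβ.le).trans (k0 _ hA.β_ord.2)
  have e : noise K D θ m I B c = 2 * K.wS * K.σ ^ 2 * (c.α * (1 / B))
      + 2 * K.wH θ * (D * K.σ ^ 2) * (c.αb * (1 / B))
      + 16 * K.hyperLip * (D * K.σ ^ 2) / θ * (c.αb * (1 / B))
      + 8 * K.hyperVar D * (c.β * (1 / B))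
      + 8 * K.hyperBound ^ 2 * (c.β * (if I < m then 1 / (I : ℝ) else 0)) := by
    unfold noise
    ring
  rw [e]
  calc _ ≤ 2 * K.wS * K.σ ^ 2 * δ + 2 * K.wH θ * (D * K.σ ^ 2) * δ
        + 16 * K.hyperLip * (D * K.σ ^ 2) / θ * δ + 8 * K.hyperVar D * δ
        + 8 * K.hyperBound ^ 2 * δ := by gcongr
    _ ≤ K.noiseConst D θ * δ := by
        unfold Consts.noiseConst
        linarith
    _ = ε ^ 2 / 12 := by
        rw [hδ]
        field_simp

/-- The initial potential in terms of the number of iterations. -/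
lemma Admissible.initBound_le (hA : Admissible θ (K.innerStepConst D θ τ) (K.noiseConst D θ) (K.outerStepConst D θ τ)
      (2 * K.LF) m I B ε c) (hθ : 0 < θ) (hτ : 0 < τ) (hI : 1 ≤ I) (hIm : I ≤ m)
    (hB : 1 ≤ B) (hε : 0 < ε) (hcτ : c.τ = τ) {Δ R κ : ℝ} (hΔ : 0 ≤ Δ) (hR : 0 ≤ R) (hκ : 0 < κ)
    {B₀ T : ℕ} (hB₀ : κ / ε ≤ B₀) (hT : K.iterConst D θ τ Δ R κ * rate m I B ε ≤ T) :
    initBound K D θ m I B₀ c Δ R ≤ c.η / 4 * (T * ε ^ 2) := by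
  have hc := hA.balanced hθ hτ hI hIm hB hε hcτ
  have hI0 : (0 : ℝ) < I := by exact_mod_cast hI
  have hm0 : (0 : ℝ) < m := by exact_mod_cast hI.trans hIm
  have hB0 : (0 : ℝ) < B := by exact_mod_cast hB
  have hb0 : (0 : ℝ) < B₀ := lt_of_lt_of_le (by positivity) hB₀
  have hN := K.noiseConst_pos D hθ
  have hr8 := K.innerStepRatio_pos D hθ hτ
  have hC11 := K.outerStepConst_pos D hθ hτ
  have hCT := K.iterConst_pos D hθ hτ hΔ hR hκ
  have hα := hc.α_pos
  have hαb := hc.αb_pos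
  have hβ := hc.β_pos
  have hη := hc.η_pos
  have ha := hc.a_pos
  have hq := hc.q_pos
  have hq1 := hc.q_le
  have hwS := K.wS_nonneg
  have hwY := K.wY_nonneg
  have hwH := K.wH_nonneg hθ
  have hV := K.hyperVar_nonneg D
  have hρ := rho_pos (m := m) (I := I) hB
  have hρs := rho_le_sqrt_rho (m := m) hI hB
  have hBs := one_div_le_sqrt_rho (m := m) (I := I) hB
  have hrate := le_rate m I B hε
  set ρ := rho m I B
  set s := √ρ with hs'
  have hs : 0 < s := Real.sqrt_pos.2 hρ
  set q : ℝ := I / m with hqq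
  -- The common scale of all terms: N is ε² times (m/I) ε⁻³ √ρ, so after division by η every part of
  -- the initial potential is a constant times N.
  set N : ℝ := s / (q * ε) with hNN
  have hN0 : 0 < N := by positivity
  have i1 : 1 ≤ c.η * (N / (θ * √(K.outerStepConst D θ τ))) := by
    have h1 : θ * (√(K.outerStepConst D θ τ) * (q * ε) * s⁻¹) ≤ c.η := hA.η_ord.1
    calc (1 : ℝ) = θ * (√(K.outerStepConst D θ τ) * (q * ε) * s⁻¹) * (N / (θ * √(K.outerStepConst D θ τ))) := by
          rw [hNN]
          field_simp
      _ ≤ _ := by gcongr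
  have i2 : 1 / (c.τ * c.τt) ≤ N / (τ * θ * √(K.innerStepRatio D θ τ)) := by
    have h1 : θ * (√(K.innerStepRatio D θ τ) * (q * ε) * s⁻¹) ≤ c.τt := hA.τt_ord.1
    have h2 : τ * (θ * (√(K.innerStepRatio D θ τ) * (q * ε) * s⁻¹)) ≤ c.τ * c.τt := by
      rw [hcτ]
      gcongr
    calc 1 / (c.τ * c.τt) ≤ 1 / (τ * (θ * (√(K.innerStepRatio D θ τ) * (q * ε) * s⁻¹))) := by gcongr
      _ = _ := by
          rw [hNN]
          field_simp
  -- The initial batch of size κ/ε turns the factor ε⁻² of 1/α into ε⁻¹, the order of N.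
  have i3 : 1 / (q * c.α) * (1 / B₀) ≤ 12 * K.noiseConst D θ / (κ * θ) * N := by
    calc 1 / (q * c.α) * (1 / B₀)
        ≤ 1 / (q * (θ * (B * ε ^ 2 / (12 * K.noiseConst D θ)))) * (1 / (κ / ε)) := by
          gcongr
          exact hA.α_ord.1
      _ = 12 * K.noiseConst D θ / (κ * θ) * (1 / B / (q * ε)) := by field_simp
      _ ≤ _ := by rw [hNN]; gcongr
  have i0 : ∀ r, θ * (ε ^ 2 / (12 * K.noiseConst D θ) * ρ⁻¹) ≤ r →
      1 / (q * r) * (1 / B₀) ≤ 12 * K.noiseConst D θ / (κ * θ) * (2 * N) := fun r hr => by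
    calc 1 / (q * r) * (1 / B₀)
        ≤ 1 / (q * (θ * (ε ^ 2 / (12 * K.noiseConst D θ) * ρ⁻¹))) * (1 / (κ / ε)) := by gcongr
      _ = 12 * K.noiseConst D θ / (κ * θ) * (ρ / (q * ε)) := by field_simp
      _ ≤ 12 * K.noiseConst D θ / (κ * θ) * (2 * s / (q * ε)) := by gcongr
      _ = _ := by rw [hNN]; ring
  have i4 := i0 _ hA.αb_ord.1
  have i5 : 1 / c.β * (1 / B₀) ≤ 12 * K.noiseConst D θ / (κ * θ) * (2 * N) := by
    refine le_trans ?_ (i0 _ hA.β_ord.1)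
    gcongr
    exact mul_le_of_le_one_left hβ.le hq1
  have j1 := mul_le_mul_of_nonneg_left i1 hΔ
  have j2 := mul_le_mul_of_nonneg_left i2 (show 0 ≤ K.wY * c.η * R by positivity)
  have j3 := mul_le_mul_of_nonneg_left i3 (show 0 ≤ K.wS * c.η * K.σ ^ 2 by positivity)
  have j4 := mul_le_mul_of_nonneg_left i4 (show 0 ≤ K.wH θ * c.η * (D * K.σ ^ 2) by positivity)
  have j5 := mul_le_mul_of_nonneg_left i5 (show 0 ≤ c.η * K.hyperVar D by positivity)
  have eI : initBound K D θ m I B₀ c Δ R = Δ * 1 + K.wS * c.η * K.σ ^ 2 * (1 / (q * c.α) * (1 / B₀))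
      + K.wH θ * c.η * (D * K.σ ^ 2) * (1 / (q * c.αb) * (1 / B₀))
      + c.η * K.hyperVar D * (1 / c.β * (1 / B₀)) + K.wY * c.η * R * (1 / (c.τ * c.τt)) := by
    unfold initBound
    ring
  have eT : c.η / 4 * (K.iterConst D θ τ Δ R κ * N) = Δ * (c.η * (N / (θ * √(K.outerStepConst D θ τ))))
      + K.wS * c.η * K.σ ^ 2 * (12 * K.noiseConst D θ / (κ * θ) * N)
      + K.wH θ * c.η * (D * K.σ ^ 2) * (12 * K.noiseConst D θ / (κ * θ) * (2 * N))
      + c.η * K.hyperVar D * (12 * K.noiseConst D θ / (κ * θ) * (2 * N))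
      + K.wY * c.η * R * (N / (τ * θ * √(K.innerStepRatio D θ τ))) + c.η / 4 * N := by
    unfold Consts.iterConst
    ring
  have hTN : K.iterConst D θ τ Δ R κ * N ≤ T * ε ^ 2 := by
    calc K.iterConst D θ τ Δ R κ * N = K.iterConst D θ τ Δ R κ * (m / (I * ε ^ 3) * s) * ε ^ 2 := by
          rw [hNN, hqq]
          field_simp
      _ ≤ K.iterConst D θ τ Δ R κ * rate m I B ε * ε ^ 2 := by gcongr
      _ ≤ T * ε ^ 2 := by gcongr
  refine le_trans ?_ (mul_le_mul_of_nonneg_left hTN (show 0 ≤ c.η / 4 by positivity))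
  rw [eI, eT]
  have : 0 ≤ c.η / 4 * N := by positivity
  linarith

lemma rate_pos (hI : 1 ≤ I) (hIm : I ≤ m) (hB : 1 ≤ B) (hε : 0 < ε) : 0 < rate m I B ε := by
  have hI0 : (0 : ℝ) < I := by exact_mod_cast hI
  have hm0 : (0 : ℝ) < m := by exact_mod_cast hI.trans hIm
  have := Real.sqrt_pos.2 (rho_pos (m := m) (I := I) hB)
  exact lt_of_lt_of_le (by positivity) (le_rate m I B hε)

end

end MBBO

/-! ### The theorem: constants and conclusion -/

theorem theorem6
    -- constants of the assumptions, dimension bound, initial gaps, mini-batch constant, step sizes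
    (K : MBBO.Consts) (D : ℕ) (Δ R κ θ τ : ℝ) (hΔ : 0 ≤ Δ) (hR : 0 ≤ R) (hκ : 0 < κ)
    (hθ : 0 < θ) (hθ1 : θ ≤ 1) (hτ : 0 < τ) (hτg : τ ≤ 2 / (3 * K.Lg)) :
    ∃ C8 C10 C11 LF CT : ℝ, 0 < C8 ∧ 0 < C10 ∧ 0 < C11 ∧ 0 < LF ∧ 0 < CT ∧
    ∀ (m dx : ℕ) (dy : Fin m → ℕ) (Ξ Z : Fin m → Type*)
      [∀ i, MeasurableSpace (Ξ i)] [∀ i, MeasurableSpace (Z i)]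
      (p : MBBO.Problem m dx dy Ξ Z),
      (∀ i, dy i ≤ D) → p.Regular → p.LowerLevel K → p.Stochastic K →
      -- `LF` is a smoothness constant of `F`
      (Differentiable ℝ p.F ∧ ∀ x x', ‖gradient p.F x - gradient p.F x'‖ ≤ LF * ‖x - x'‖) ∧
      ∀ (I B B₀ : ℕ) (ε : ℝ) (c : MBBO.Steps) (x₁ : MBBO.Vec dx),
      1 ≤ I → I ≤ m → 1 ≤ B → 0 < ε → κ / ε ≤ B₀ →
      c.τ = τ → MBBO.Admissible θ C8 C10 C11 LF m I B ε c →
      (∀ x, p.F x₁ - p.F x ≤ Δ) →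
      ∀ (Ω : Type*) [MeasurableSpace Ω] (μ : MeasureTheory.Measure Ω)
        [MeasureTheory.IsProbabilityMeasure μ]
        (y₁ : Ω → (i : Fin m) → MBBO.Vec (dy i)) (w₀ : Ω → MBBO.Batches Ξ Z B₀)
        (w : ℕ → Ω → MBBO.IterSample Ξ Z B),
        MBBO.IsSampling p I B B₀ μ y₁ w₀ w →
        (∫⁻ ω, ∑ i, ‖y₁ ω i - p.yStar i x₁‖ₑ ^ 2 ∂μ ≤ ENNReal.ofReal (m * R)) →
        ∀ T : ℕ, CT * MBBO.rate m I B ε ≤ T →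
          let gradSq : Ω → ℝ := fun ω => (T : ℝ)⁻¹ * ∑ t ∈ Finset.range T,
            ‖gradient p.F (MBBO.run p K.lam I c x₁ (y₁ ω) (w₀ ω) (fun t => w t ω) t).x‖ ^ 2
          MeasureTheory.Integrable gradSq μ ∧ ∫ ω, gradSq ω ∂μ ≤ ε ^ 2 := by
  have hLF := K.LF_pos
  -- The smoothness constant is doubled because the descent estimate, with its quadratic term
  -- lacking the factor 1/2, needs η `K.LF` ≤ 1/4, and η ≤ 1/(2 · 2 `K.LF`) provides this.
  refine ⟨K.innerStepConst D θ τ, K.noiseConst D θ, K.outerStepConst D θ τ, 2 * K.LF, K.iterConst D θ τ Δ R κ, K.innerStepConst_pos D hθ hτ,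
    K.noiseConst_pos D hθ, K.outerStepConst_pos D hθ hτ, by positivity, K.iterConst_pos D hθ hτ hΔ hR hκ, ?_⟩
  intro m dx dy Ξ Z _ _ p hdim hreg hlow hsto
  have h : p.Standing K D := ⟨hdim, hreg, hlow, hsto⟩
  refine ⟨⟨h.differentiable_F, fun x x' => (h.norm_gradient_F_sub_le x x').trans ?_⟩, ?_⟩
  · gcongr
    linarith
  intro I B B₀ ε c x₁ hI hIm hB hε hB₀ hcτ hA hgap Ω _ μ _ y₁ w₀ w hs hy T hT
  have hc := hA.balanced hθ hτ hI hIm hB hε hcτ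
  have hB₀1 : 1 ≤ B₀ := by
    have : (0 : ℝ) < B₀ := lt_of_lt_of_le (by positivity) hB₀
    exact_mod_cast this
  have hT0 : (0 : ℝ) < T :=
    lt_of_lt_of_le (mul_pos (K.iterConst_pos D hθ hτ hΔ hR hκ) (MBBO.rate_pos hI hIm hB hε)) hT
  have hinit := hA.initBound_le hθ hτ hI hIm hB hε hcτ hΔ hR hκ hB₀ hT
  have hnoise := hA.noise_le hc hB
  have hη := hc.η_pos
  refine h.integral_mean_gradient_sq_le (low := p.F x₁ - Δ) hB hB₀1 hc
    (fun x => by linarith [hgap x]) hs hR hy (by exact_mod_cast hT0) ?_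
  rw [sub_sub_cancel]
  -- Of the available (η/2) T ε², the initial potential uses 1/4 and the noise 1/12 of η T ε².
  have h1 : T * (c.η * MBBO.noise K D θ m I B c) ≤ T * (c.η * (ε ^ 2 / 12)) := by gcongr
  have h2 : 0 ≤ T * (c.η * ε ^ 2) := by positivity
  linarith
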